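/- Let $x_1,x_2,\ldots$ be noncommuting variables and $\theta_1,\theta_2,\ldots$ variables with $\theta_i\theta_j=-\theta_j\theta_i$ and $x_i\theta_j=\theta_jx_i$, and consider formal power series of bounded degree over $\mathbb{Q}$ in them. **Set superpartitions.** A set superpartition $I$ of bidegree $(n,m)$ is a tuple $(I_1,\ldots,I_k)$ of nonempty subsets (blocks) of $\{0,\ldots,n\}$ covering $\{1,\ldots,n\}$, with $I_i\cap I_j\subseteq\{0\}$ for $i\ne j$, such that $0\in I_i$ exactly for $i\le m$, and $I_i\neq I_j$, $\min(I_i\setminus I_j)<\min(I_j\setminus I_i)$ for $i<j$ (where $\min\emptyset=0$). Its monomial function is $m_I=\sum\theta_{a_1}\cdots\theta_{a_m}x_{b_1}\cdots x_{b_n}$, over all tuples of positive integers such that $a_i=b_j$ if and only if $j\in I_i$, and $b_i=b_j$ if and only if $i,j$ lie in the same block. **Superpartitions.** A superpartition $\Lambda=(\Lambda_1,\ldots,\Lambda_m;\Lambda_{m+1},\ldots,\Lambda_k)$ consists of integers $\Lambda_1>\cdots>\Lambda_m\ge0$ and $\Lambda_{m+1}\ge\cdots\ge\Lambda_k\geq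 1$; $\mathrm{sPar}_{n,m}$ is the set of those with $m$ components before the semicolon (fermionic degree $m$) and $\sum_i\Lambda_i=n$. Put $\Lambda!=\prod_i\Lambda_i!$. Let $\Lambda^+$ and $\Lambda^\oplus$ be the decreasing rearrangements of $(\Lambda_1,\ldots,\Lambda_k)$ and of $(\Lambda_1+1,\ldots,\Lambda_m+1,\Lambda_{m+1},\ldots,\Lambda_k)$. The diagram of $\Lambda$ is the Young diagram of $\Lambda^+$ ($n$ boxes) together with the $m$ cells of $\Lambda^\oplus/\Lambda^+$, called circles. A set superpartition $I$ has type $\Lambda(I)=\Omega$ if $\Omega$ is obtained by sorting decreasingly the two parts of $(|I_1|-1,\ldots,|I_m|-1;|I_{m+1}|,\ldots,|I_k|)$ (so the fermionic blocks $I_1,\dots,I_m$ have different sizes); $\varepsilon(I)$ is then the minimal number of transpositions that sort $(|I_1|-1,\ldots,|I_m|-1)$ decreasingly. **Tableaux.** Let $\alpha_1,\ldots,\alpha_r\in\mathbb{N}_0\cup\bar{\mathbb{N}}_0$ be numbers or barred numbers, with $|a|=|\bar a|=a$. A super semistandard Young tableau $T$ of shape $\Lambda$ and weight $(\alpha_1,\ldots,\alpha_r)$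 is a sequence of superpartitions $\emptyset=\Lambda_{(0)},\ldots,\Lambda_{(r)}=\Lambda$ such that for each $i$: 1. $\Lambda_{(i)}^+/\Lambda_{(i-1)}^+$ is a horizontal $|\alpha_i|$-strip. 2. If $\alpha_i\in\mathbb{N}_0$, then $\Lambda_{(i)}$ and $\Lambda_{(i-1)}$ have the same fermionic degree, and if the $j$th circle (from top to bottom) of $\Lambda_{(i-1)}$ is in row $s$, then the $j$th circle of $\Lambda_{(i)}$ is in row $s$ if row $s$ of the strip is empty, and in row $s+1$ otherwise. 3. If $\alpha_i\in\bar{\mathbb{N}}_0$, then the fermionic degree increases by one, $\Lambda_{(i)}$ has a unique circle (the new one) in a column $c$ such that column $c$ of the strip is empty and all columns to its left are nonempty, and after removal of the new circle condition 2 holds. The boxes of $\Lambda_{(i)}^+/\Lambda_{(i-1)}^+$, and the new circle if there is one, get label $i$; circles keep their labels when they move. Tableaux that give the same labelling of the diagram of $\Lambda$ are identified (that is, trailing weights $0$ are ignored). Let $c(T^s_1),\ldots,c(T^s_n)$ be the labels of the boxes in a fixed reading order, and $c(T^a_1),\ldots,c(T^a_m)$ those of the circles from top to bottom; $\operatorname{inv}(T)$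 is the number of inversions of the word $c(T^a_1)\cdots c(T^a_m)$. Set $$S_\Lambda=\sum_T[\theta x]^T,\qquad [\theta x]^T=\theta_{c(T^a_1)}\cdots\theta_{c(T^a_m)}\sum_{\sigma\in\mathfrak{S}_n}x_{c(T^s_{\sigma(1)})}\cdots x_{c(T^s_{\sigma(n)})},$$ over all super semistandard Young tableaux $T$ of shape $\Lambda$ (of any weight), and, for $\Lambda,\Omega\in\mathrm{sPar}_{n,m}$, let $K_{\Lambda,\Omega}=\sum_T(-1)^{\operatorname{inv}(T)}$ over those of shape $\Lambda$ and weight $(\bar\Omega_1,\ldots,\bar\Omega_m,\Omega_{m+1},\ldots,\Omega_k)$. **Proposition.** Let $n,m\geq 0$ and $\Lambda\in\mathrm{sPar}_{n,m}$. These sums are well defined (each monomial has a nonzero coefficient in $[\theta x]^T$ for only finitely many $T$, and the sum defining $K_{\Lambda,\Omega}$ is finite for every $\Omega\in\mathrm{sPar}_{n,m}$), and $$S_\Lambda=\sum_{\Omega\in\mathrm{sPar}_{n,m}}K_{\Lambda,\Omega}\,\Omega!\sum_{\Lambda(I)=\Omega}(-1)^{\varepsilon(I)}m_I,$$ where the inner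 sum runs over the set superpartitions $I$ of bidegree $(n,m)$ and type $\Omega$. -/

import Mathlib

namespace SuperNC

/-! ### Functions in noncommuting variables in superspace -/

/-- The number of inversions of a word. -/
def inv (w : List ℕ) : ℕ :=
  (Finset.univ.filter fun p : Fin w.length × Fin w.length =>
    p.1 < p.2 ∧ w.get p.2 < w.get p.1).card

/-- Normal forms of monomials. The variables are `x_i` and `θ_i` with `i : ℕ` (numbered from `0`).
The pair `(s, w)` stands for `θ_{s_1} ⋯ θ_{s_m} x_{w_1} ⋯ x_{w_n}`, where `s_1 < ⋯ < s_m` are the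
elements of `s`. Since the `θ`s anticommute with each other, commute with the `x`s, and the `x`s
are free, these are a basis of the polynomials in superspace. -/
abbrev SuperMonomial : Type := Finset ℕ × List ℕ

/-- Formal power series of bounded degree in the variables `x_i` and `θ_i`, given by their
rational coefficients on the monomials in normal form. -/
def SuperSeries : Submodule ℚ (SuperMonomial → ℚ) where
  carrier := {f | ∃ N : ℕ, ∀ u : SuperMonomial, N < u.1.card + u.2.length → f u = 0}
  zero_mem' := ⟨0, fun _ _ => rfl⟩
  add_mem' := by
    rintro f g ⟨N, hN⟩ ⟨M, hM⟩
    refine ⟨max N M, fun u hu => ?_⟩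
    rw [Pi.add_apply, hN u (lt_of_le_of_lt (le_max_left _ _) hu),
      hM u (lt_of_le_of_lt (le_max_right _ _) hu), add_zero]
  smul_mem' := by
    rintro c f ⟨N, hN⟩
    exact ⟨N, fun u hu => by rw [Pi.smul_apply, hN u hu, smul_zero]⟩

/-- The coefficient of the normal form `u` in the product `θ_{a_1} ⋯ θ_{a_m} x_{b_1} ⋯ x_{b_n}`.
The product vanishes if two of the `a_i` agree; otherwise sorting the `θ`s produces the sign
`(-1) ^ inv a`. -/
def coeffProd (a b : List ℕ) (u : SuperMonomial) : ℚ :=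
  if a.Nodup ∧ a.toFinset = u.1 ∧ b = u.2 then (-1) ^ inv a else 0

theorem coeffProd_eq_zero {a b : List ℕ} {u : SuperMonomial}
    (h : a.length + b.length < u.1.card + u.2.length) : coeffProd a b u = 0 := by
  unfold coeffProd
  rw [if_neg]
  rintro ⟨_, h1, h2⟩
  rw [← h1, ← h2] at h
  have := List.toFinset_card_le a
  omega

/-! ### Partial set supercompositions and set superpartitions -/

/-- Partial set supercompositions of bidegree `(n, m)`. Blocks are subsets of `{0, …, n}`; the
fermionic blocks, those that contain `0`, are the first `m` ones. -/
structure PartialSetSupercomposition (n m : ℕ) where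
  /-- The tuple of blocks. -/
  blocks : List (Finset ℕ)
  m_le : m ≤ n + 1
  nonempty : ∀ B ∈ blocks, B.Nonempty
  cover : ∀ x : ℕ, (x ≠ 0 ∧ ∃ B ∈ blocks, x ∈ B) ↔ (1 ≤ x ∧ x ≤ n)
  inter : blocks.Pairwise fun A B => A ∩ B ⊆ {0}
  m_le_length : m ≤ blocks.length
  fermionic : ∀ B ∈ blocks.take m, 0 ∈ B
  bosonic : ∀ B ∈ blocks.drop m, 0 ∉ B
  sorted : (blocks.drop m).Pairwise fun A B => sInf (A : Set ℕ) < sInf (B : Set ℕ)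

/-- Set superpartitions of bidegree `(n, m)`. Here `sInf ∅ = 0` is the minimum of the empty set. -/
structure SetSuperpartition (n m : ℕ) extends PartialSetSupercomposition n m where
  order : blocks.Pairwise fun A B =>
    A ≠ B ∧ sInf ((A \ B : Finset ℕ) : Set ℕ) < sInf ((B \ A : Finset ℕ) : Set ℕ)

/-- The index set of the monomial function `m_K`: tuples `(a_1, …, a_m, b_1, …, b_n)` such that
`a_i = b_j` if and only if `j` lies in the `i`th block of `K`, and `b_i = b_j` if and only if
`i, j` lie in the same block of `K`. Positions are `Fin m` and `Fin n`, hence the shift by one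
for the elements of the blocks. -/
def PartialSetSupercomposition.indexSet {n m : ℕ} (K : PartialSetSupercomposition n m) :
    Set ((Fin m → ℕ) × (Fin n → ℕ)) :=
  {p | (∀ (i : Fin m) (j : Fin n), p.1 i = p.2 j ↔ (j : ℕ) + 1 ∈ K.blocks.getD i ∅) ∧
    ∀ i j : Fin n, p.2 i = p.2 j ↔ ∃ B ∈ K.blocks, (i : ℕ) + 1 ∈ B ∧ (j : ℕ) + 1 ∈ B}

/-- Each coefficient of `m_K` is a finite sum. -/
theorem finite_indexSet_support {n m : ℕ} (u : SuperMonomial) :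
    {p : (Fin m → ℕ) × (Fin n → ℕ) |
      coeffProd (List.ofFn p.1) (List.ofFn p.2) u ≠ 0}.Finite := by
  have h1 : (Set.pi Set.univ fun _ : Fin m => (u.1 : Set ℕ)).Finite :=
    Set.Finite.pi fun _ => u.1.finite_toSet
  have h2 : (Set.pi Set.univ fun _ : Fin n => (u.2.toFinset : Set ℕ)).Finite :=
    Set.Finite.pi fun _ => u.2.toFinset.finite_toSet
  refine (h1.prod h2).subset ?_
  rintro ⟨a, b⟩ h
  simp only [Set.mem_ofPred_eq, coeffProd, ne_eq, ite_eq_right_iff, not_forall] at h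
  obtain ⟨⟨_, ha, hb⟩, _⟩ := h
  refine ⟨fun i _ => ?_, fun i _ => ?_⟩
  · rw [← ha]; simp
  · rw [← hb]; simp

/-- The monomial function `m_K`, the sum of `θ_{a_1} ⋯ θ_{a_m} x_{b_1} ⋯ x_{b_n}` over the
index set of `K`. -/
noncomputable def PartialSetSupercomposition.monomial {n m : ℕ}
    (K : PartialSetSupercomposition n m) : SuperSeries :=
  ⟨fun u => ∑ᶠ p ∈ K.indexSet, coeffProd (List.ofFn p.1) (List.ofFn p.2) u, m + n, fun u hu =>
    finsum_mem_eq_zero_of_forall_eq_zero fun _ _ => coeffProd_eq_zero (by simpa using hu)⟩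

/-- There are finitely many lists of bounded length with entries in a finite set. -/
theorem finite_lists {α : Type*} (S : Finset α) (N : ℕ) :
    {l : List α | l.length ≤ N ∧ ∀ x ∈ l, x ∈ S}.Finite := by
  refine ((List.finite_length_le (↥S) N).image (List.map Subtype.val)).subset ?_
  rintro l ⟨h1, h2⟩
  exact ⟨l.attach.map fun x => ⟨x.1, h2 x.1 x.2⟩, by simpa using h1, by simp⟩

instance {n m : ℕ} : Finite (SetSuperpartition n m) := by
  have := (finite_lists (Finset.range (n + 1)).powerset
    (Finset.range (n + 1)).powerset.card).to_subtype
  refine Finite.of_injective (β := {l : List (Finset ℕ) |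
    l.length ≤ (Finset.range (n + 1)).powerset.card ∧
      ∀ x ∈ l, x ∈ (Finset.range (n + 1)).powerset}) (fun I => ⟨I.blocks, ?_, ?_⟩) ?_
  · have hnd : I.blocks.Nodup := I.order.imp fun h => h.1
    rw [← List.toFinset_card_of_nodup hnd]
    refine Finset.card_le_card fun B hB => ?_
    rw [List.mem_toFinset] at hB
    rw [Finset.mem_powerset]
    intro x hx
    rw [Finset.mem_range]
    by_cases h0 : x = 0
    · omega
    · have := (I.cover x).1 ⟨h0, B, hB, hx⟩
      omega
  · intro B hB
    rw [Finset.mem_powerset]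
    intro x hx
    rw [Finset.mem_range]
    by_cases h0 : x = 0
    · omega
    · have := (I.cover x).1 ⟨h0, B, hB, hx⟩
      omega
  · rintro ⟨⟨b, _, _, _, _, _, _, _, _⟩, _⟩ ⟨⟨b', _, _, _, _, _, _, _, _⟩, _⟩ h
    simp only [Subtype.mk.injEq] at h
    subst h
    rfl

noncomputable instance {n m : ℕ} : Fintype (SetSuperpartition n m) := Fintype.ofFinite _

/-! ### Superpartitions -/

/-- Sort a list in (weakly) decreasing order. -/
def sortDesc (l : List ℕ) : List ℕ := l.mergeSort fun x y => decide (y ≤ x)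

/-- Superpartitions `(Λ_1, …, Λ_m; Λ_{m+1}, …, Λ_k)`: the list `a` of fermionic components is
strictly decreasing (and may end in `0`), the list `s` is a partition into positive parts. -/
@[ext] structure SuperPartition where
  /-- The fermionic components. -/
  a : List ℕ
  /-- The remaining components. -/
  s : List ℕ
  a_sorted : a.Pairwise (· > ·)
  s_sorted : s.Pairwise (· ≥ ·)
  s_pos : ∀ x ∈ s, 0 < x

namespace SuperPartition

/-- The empty superpartition. -/
def empty : SuperPartition := ⟨[], [], by simp, by simp, by simp⟩

/-- The degree. -/
def deg (L : SuperPartition) : ℕ := L.a.sum + L.s.sum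

/-- The fermionic degree. -/
def df (L : SuperPartition) : ℕ := L.a.length

/-- `Λ!`, the product of the factorials of all components. -/
def factorial (L : SuperPartition) : ℕ := ((L.a ++ L.s).map Nat.factorial).prod

/-- The length `k` of `(Λ_1, …, Λ_m; Λ_{m+1}, …, Λ_k)`. -/
def length (L : SuperPartition) : ℕ := L.a.length + L.s.length

/-- `Λ⁺ = sort(Λ_1, …, Λ_k)`. -/
def plus (L : SuperPartition) : List ℕ := sortDesc (L.a ++ L.s)

/-- `Λ^⊕ = sort(Λ_1 + 1, …, Λ_m + 1, Λ_{m+1}, …, Λ_k)`. -/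
def oplus (L : SuperPartition) : List ℕ := sortDesc (L.a.map (· + 1) ++ L.s)

/-- The number of boxes in row `r` of the super Young diagram (rows are numbered from `0`). -/
def row (L : SuperPartition) (r : ℕ) : ℕ := L.plus.getD r 0

/-- The rows that contain a circle, that is, a box of `Λ^⊕ / Λ⁺`, listed from top to bottom.
The circle of such a row `r` lies in column `L.row r` (columns are numbered from `0`). -/
def circles (L : SuperPartition) : List ℕ :=
  (List.range L.length).filter fun r => decide (L.row r < L.oplus.getD r 0)

/-- The boxes (row, column) of the diagram of `Λ⁺`, read row by row. -/
def boxes (L : SuperPartition) : List (ℕ × ℕ) :=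
  (List.range L.length).flatMap fun r => (List.range (L.row r)).map fun c => (r, c)

end SuperPartition

/-- The superpartitions of bidegree `(n, m)` form a finite set. -/
theorem finite_sPar (n m : ℕ) : {L : SuperPartition | L.deg = n ∧ L.df = m}.Finite := by
  have hfin := (finite_lists (Finset.range (n + 1)) m).prod
    (finite_lists (Finset.range (n + 1)) n)
  refine Set.Finite.of_finite_image (f := fun L : SuperPartition => (L.a, L.s))
    (hfin.subset ?_) ?_
  · rintro _ ⟨L, ⟨hd, hm⟩, rfl⟩
    unfold SuperPartition.deg at hd
    unfold SuperPartition.df at hm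
    refine ⟨⟨hm.le, fun x hx => ?_⟩, ⟨?_, fun x hx => ?_⟩⟩
    · have := List.le_sum_of_mem hx
      simp only at this
      rw [Finset.mem_range]; omega
    · have : L.s.length ≤ L.s.sum := List.length_le_sum_of_one_le _ fun x hx => L.s_pos x hx
      change L.s.length ≤ n
      omega
    · have := List.le_sum_of_mem hx
      simp only at this
      rw [Finset.mem_range]; omega
  · intro L _ L' _ h
    simp only [Prod.mk.injEq] at h
    exact SuperPartition.ext h.1 h.2

/-- The superpartitions of degree `n` and fermionic degree `m`. -/
noncomputable def sPar (n m : ℕ) : Finset SuperPartition := (finite_sPar n m).toFinset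

/-! ### Type and sign of a set superpartition -/

namespace SetSuperpartition

variable {n m : ℕ}

/-- `(|I_1| - 1, …, |I_m| - 1)`. -/
def fermSizes (I : SetSuperpartition n m) : List ℕ :=
  (I.blocks.take m).map fun B => B.card - 1

/-- `(|I_{m+1}|, …, |I_k|)`. -/
def bosSizes (I : SetSuperpartition n m) : List ℕ :=
  (I.blocks.drop m).map fun B => B.card

/-- `I` is of type `Ω`, that is,
`sort(|I_1| - 1, …, |I_m| - 1; |I_{m+1}|, …, |I_k|) = Ω`. As the fermionic components of a
superpartition are distinct, this forces the fermionic blocks of `I` to have different sizes. -/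
def HasType (I : SetSuperpartition n m) (Om : SuperPartition) : Prop :=
  sortDesc I.fermSizes = Om.a ∧ sortDesc I.bosSizes = Om.s

/-- `ε(I)`: the minimal number of transpositions needed to sort
`(|I_1| - 1, …, |I_m| - 1)` in decreasing order. -/
noncomputable def eps (I : SetSuperpartition n m) : ℕ :=
  sInf {k | ∃ l : List (Equiv.Perm (Fin m)), l.length = k ∧ (∀ t ∈ l, t.IsSwap) ∧
    Antitone fun i : Fin m => I.fermSizes.getD (l.prod i) 0}

end SetSuperpartition

open Classical in
/-- The set superpartitions of bidegree `(n, m)` and type `Ω`. -/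
noncomputable def ofType (n m : ℕ) (Om : SuperPartition) : Finset (SetSuperpartition n m) :=
  Finset.univ.filter fun I => I.HasType Om

/-! ### Super semistandard Young tableaux -/

/-- The elements of `ℕ₀ ∪ ℕ̄₀`: numbers and barred numbers. -/
inductive SuperWeight : Type
  | plain : ℕ → SuperWeight
  | barred : ℕ → SuperWeight

/-- `|α|`. -/
def SuperWeight.abs : SuperWeight → ℕ
  | .plain k => k
  | .barred k => k

/-- The boxes (row, column) of the skew diagram `D⁺ / C⁺`. -/
def skew (C D : SuperPartition) : Set (ℕ × ℕ) := {p | C.row p.1 ≤ p.2 ∧ p.2 < D.row p.1}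

/-- `D⁺ / C⁺` is a horizontal `k`-strip. -/
structure IsHorizontalStrip (C D : SuperPartition) (k : ℕ) : Prop where
  contained : ∀ r, C.row r ≤ D.row r
  deg_eq : D.deg = C.deg + k
  column : ∀ p ∈ skew C D, ∀ q ∈ skew C D, p.2 = q.2 → p = q

/-- The old circles move correctly from `C` to `D`, where `l` lists (top to bottom) the rows of the
circles of `D` that are not new: the `j`th circle of `C`, in row `r`, becomes the `j`th one of
`l`, in the same row if row `r` of `D⁺ / C⁺` is empty, and in the next row otherwise. -/
def CirclesMove (C D : SuperPartition) (l : List ℕ) : Prop :=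
  l.length = C.circles.length ∧
  ∀ j r : ℕ, C.circles[j]? = some r →
    ((∀ c, (r, c) ∉ skew C D) → l[j]? = some r) ∧
    ((∃ c, (r, c) ∈ skew C D) → l[j]? = some (r + 1))

/-- The `p`th circle of `D` (from top to bottom, starting with `p = 0`) lies in a column that is
empty in `D⁺ / C⁺` while all columns to its left are nonempty. -/
def IsNewCircle (C D : SuperPartition) (p : ℕ) : Prop :=
  ∃ r, D.circles[p]? = some r ∧ (∀ r', (r', D.row r) ∉ skew C D) ∧
    ∀ c < D.row r, ∃ r', (r', c) ∈ skew C D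

/-- The position, among the circles of `D` from top to bottom, of the new circle. -/
noncomputable def newIdx (C D : SuperPartition) : ℕ := sInf {p | IsNewCircle C D p}

/-- One step `C = Λ_(i-1)`, `D = Λ_(i)` of a super semistandard Young tableau. -/
def IsStep (C : SuperPartition) (w : SuperWeight) (D : SuperPartition) : Prop :=
  IsHorizontalStrip C D w.abs ∧
  match w with
  | .plain _ => D.df = C.df ∧ CirclesMove C D D.circles
  | .barred _ => D.df = C.df + 1 ∧
      ∃ p, IsNewCircle C D p ∧ (∀ q, IsNewCircle C D q → q = p) ∧
        CirclesMove C D (D.circles.eraseIdx p)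

/-- Super semistandard Young tableaux of shape `L`. Labels are natural numbers, numbered from `0`
like the variables, and `chain i` is the part of the tableau with labels `< i`; the step from
`chain i` to `chain (i + 1)` has weight `weight i` and adds the boxes (and possibly the circle) with
label `i`. A step of weight `plain 0` does not change anything. Thus a sequence
`(Λ_(0), …, Λ_(r))` with weight `(α_1, …, α_r)` is continued by the shape `L` and the weight
`plain 0`, and every filling of `L` occurs exactly once. -/
structure SSYT (L : SuperPartition) where
  /-- The sequence of superpartitions. -/
  chain : ℕ → SuperPartition
  /-- The weight. -/
  weight : ℕ → SuperWeight
  chain_zero : chain 0 = SuperPartition.empty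
  step : ∀ i, IsStep (chain i) (weight i) (chain (i + 1))
  stable : ∃ r, ∀ i, r ≤ i → chain i = L ∧ weight i = .plain 0

namespace SSYT

variable {L : SuperPartition}

/-- The labels of the circles of `chain i`, from top to bottom. -/
noncomputable def circleLabels (T : SSYT L) : ℕ → List ℕ
  | 0 => []
  | i + 1 =>
    match T.weight i with
    | .plain _ => T.circleLabels i
    | .barred _ => (T.circleLabels i).insertIdx (newIdx (T.chain i) (T.chain (i + 1))) i

/-- The number of steps after which nothing changes any more. -/
noncomputable def steps (T : SSYT L) : ℕ :=
  sInf {r | ∀ i, r ≤ i → T.chain i = L ∧ T.weight i = .plain 0}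

/-- The word `c(T_1^a) ⋯ c(T_m^a)` of the labels of all circles, from top to bottom. -/
noncomputable def circleWord (T : SSYT L) : List ℕ := T.circleLabels T.steps

/-- The label of a box: the `i` such that the box is added in the step from `chain i` to
`chain (i + 1)`. -/
noncomputable def boxLabel (T : SSYT L) (p : ℕ × ℕ) : ℕ :=
  sInf {i | p ∈ skew (T.chain i) (T.chain (i + 1))}

/-- The coefficients of `[θx]^T`, the product `θ_{c(T_1^a)} ⋯ θ_{c(T_m^a)}` times the sum over all
permutations `σ` of the boxes of `x_{c(T_{σ(1)}^s)} ⋯ x_{c(T_{σ(n)}^s)}`. -/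
noncomputable def term (T : SSYT L) (u : SuperMonomial) : ℚ :=
  ∑ σ : Equiv.Perm (Fin L.boxes.length),
    coeffProd T.circleWord (List.ofFn fun i => T.boxLabel (L.boxes.get (σ i))) u

theorem length_circleLabels_le (T : SSYT L) (i : ℕ) :
    (T.circleLabels i).length ≤ (T.chain i).df := by
  induction i with
  | zero => simp [circleLabels]
  | succ i ih =>
    have h := (T.step i).2
    unfold circleLabels
    cases hw : T.weight i with
    | plain k =>
      rw [hw] at h
      simp only at h ⊢
      omega
    | barred k =>
      rw [hw] at h
      simp only at h ⊢
      have h1 := h.1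
      rw [List.length_insertIdx]
      split_ifs <;> omega

theorem term_eq_zero (T : SSYT L) {u : SuperMonomial}
    (h : L.df + L.boxes.length < u.1.card + u.2.length) : T.term u = 0 := by
  refine Finset.sum_eq_zero fun σ _ => coeffProd_eq_zero ?_
  have h1 : T.circleWord.length ≤ L.df := by
    have h2 := T.length_circleLabels_le T.steps
    rw [(Nat.sInf_mem T.stable T.steps le_rfl).1] at h2
    exact h2
  rw [List.length_ofFn]
  omega

end SSYT

/-- The Schur function `S_Λ`, the sum of `[θx]^T` over all super semistandard Young tableaux `T` of
shape `Λ`. -/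
noncomputable def schur (L : SuperPartition) : SuperSeries :=
  ⟨fun u => ∑ᶠ T : SSYT L, T.term u, L.df + L.boxes.length, fun _ hu =>
    finsum_eq_zero_of_forall_eq_zero fun T => T.term_eq_zero hu⟩

/-- The weight `(Ω̄_1, …, Ω̄_m, Ω_{m+1}, …, Ω_k)`, continued by `plain 0`. -/
def SuperPartition.weight (Om : SuperPartition) (i : ℕ) : SuperWeight :=
  (Om.a.map SuperWeight.barred ++ Om.s.map SuperWeight.plain).getD i (.plain 0)

/-- The super semistandard Young tableaux of shape `Λ` and weight
`(Ω̄_1, …, Ω̄_m, Ω_{m+1}, …, Ω_k)`. -/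
def tableauxOfWeight (L Om : SuperPartition) : Set (SSYT L) := {T | T.weight = Om.weight}

/-- `K_{Λ,Ω}`: the sum of `(-1) ^ inv(T)` over the tableaux of shape `Λ` and weight
`(Ω̄_1, …, Ω̄_m, Ω_{m+1}, …, Ω_k)`. -/
noncomputable def kostka (L Om : SuperPartition) : ℤ :=
  ∑ᶠ T ∈ tableauxOfWeight L Om, (-1) ^ inv T.circleWord

end SuperNC

/-! Both sides are compared at a monomial `u`, a product of distinct `θ_i`, `i ∈ u.1`, and a word
`u.2` in the `x_i`. A tableau contributes to `u` exactly when its weight is `u.weight`: the label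
`i` is barred iff `θ_i` occurs, and its size is the multiplicity of `x_i`. The contribution is then
`(-1) ^ inv` of the circle word times the product of the factorials of the multiplicities
(`SSYT.term_eq`). So the coefficient of `u` in the Schur function is, up to that product, the signed
number `tabSum` of tableaux of a fixed weight, and `kostka` is the same number for the sorted
weight.

The theorem therefore rests on a symmetry: interchanging two adjacent entries of the weight
preserves the signed number of tableaux, except for a factor `-1` if both are barred
(`tabSum_swap`). Sorting the weight then costs exactly the sign of the permutation of the barred
labels, and two equal barred entries force the number to vanish.

The symmetry comes from a solvable vertex model. In terms of column heights, the conditions on a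
step are local: read from right to left, a step `D / C` is a path through four states, with a factor
`t` for each box and `-1` for each old circle to the left of the new one. Two consecutive steps are
two rows of the model, and an `R`-matrix (`crossing`) passes through one column after the other by
the Yang–Baxter equation. At the far right, where both steps are empty, it is the scalar `t`; at
column `0` it has become `t` times the expected sign. Cancelling `t` shows that the rows commute up
to this sign (`transfer₂_comm`), and comparing powers of `t` fixes the sizes of the two steps
(`sum_stepCoeff_comm`). The signs of the steps multiply to `(-1) ^ inv`, since every new label
exceeds the older ones.

On the other side, `u` occurs in `m_I` for at most one `I`, through a single index (`Fits.unique`),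
and some `I` exists as soon as the degrees are right and the `θ`-letters have distinct
multiplicities (`exists_fits`). Then `ε(I)` is the parity of the sorting permutation, so the signs
agree. If no `I` of a type contributes, then `tabSum` vanishes, by degree or by the cancellation of
equal barred entries. -/

namespace SuperNC

/-! ### A vertex model for the steps of a tableau

A step is read off column by column, from right to left. Between two columns the state of the step
is a `Strand`. -/

/-- The state of a step `D / C` in a column: the column is `empty` or `full` in `D⁺ / C⁺`, it is
empty and a circle is in `transit` to the left, or it is full and to the left of the new circle
(`below`). -/
inductive Strand : Type
  | empty | full | transit | below

section Vertex

variable {K : Type*} [CommRing K]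

/-- The possible transitions at a column index `c` that occurs in `C` as a fermionic component
(`k = true`) or not (`k = false`), and `n` times as another component. -/
def siteOp (t : K) (φ : Strand → Bool → ℕ → K) : Strand → Bool → ℕ → K
  | .empty, false, n => φ .empty false n + t * φ .full false (n + 1) + t * φ .below true n
  | .empty, true, n => φ .empty true n + t * φ .full true (n + 1)
  | .full, k, n + 1 => φ .empty k n + t * φ .full k (n + 1)
  | .full, false, 0 => t * φ .full false 0
  | .full, true, 0 => φ .transit false 0 + t * φ .full true 0
  | .transit, true, _ => 0
  | .transit, false, 0 => φ .transit false 0 + t * φ .full true 0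
  | .transit, false, n + 1 => φ .empty true n + t * φ .full true (n + 1)
  | .below, false, n => t * φ .below false n
  | .below, true, n => -(t * φ .below true n)

/-- The transitions at column index `0`, for a step of plain (`β = false`) or barred (`β = true`)
weight. -/
def bottomOp (β : Bool) (φ : Bool → K) : Strand → Bool → K
  | .empty, k => bif β then bif k then 0 else φ true else φ k
  | .full, k => bif β then 0 else φ k
  | .transit, k => bif β then 0 else bif k then 0 else φ true
  | .below, k => bif β then bif k then -φ k else φ k else 0

/-- The `R`-matrix that intertwines two consecutive steps. -/
def crossing (s t : K) (ψ : Strand → Strand → K) : Strand → Strand → K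
  | .empty, .empty => t * ψ .empty .empty
  | .empty, .full => t * (ψ .empty .full - ψ .transit .below - ψ .below .transit)
  | .empty, .transit => t * ψ .empty .transit
  | .empty, .below => t * ψ .below .empty
  | .full, .empty => (t - s) * ψ .empty .full +
      s * (ψ .full .empty + ψ .transit .below + ψ .below .transit)
  | .full, .full => t * ψ .full .full
  | .full, .transit => s * ψ .full .transit + (t - s) * ψ .transit .full
  | .full, .below => t * ψ .below .full
  | .transit, .empty => (t - s) * ψ .empty .transit + s * ψ .transit .empty
  | .transit, .full => t * ψ .transit .full
  | .transit, .transit => s * ψ .transit .transit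
  | .transit, .below => -(t * ψ .below .transit)
  | .below, .empty => t * ψ .empty .below
  | .below, .full => t * ψ .full .below
  | .below, .transit => -(t * ψ .transit .below)
  | .below, .below => -(t * ψ .below .below)

/-- The Yang–Baxter equation. -/
theorem crossing_siteOp (s t : K) (φ : Strand → Strand → Bool → ℕ → K) (k : Bool) (n : ℕ)
    (a₁ a₂ : Strand) :
    crossing s t (fun a₁ a₂ => siteOp s (fun b₁ => siteOp t (φ b₁) a₂) a₁ k n) a₁ a₂ =
      siteOp t (fun b₁ => siteOp s
        (fun b₂ k n => crossing s t (fun b₁ b₂ => φ b₁ b₂ k n) b₁ b₂) a₂) a₁ k n := by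
  -- Each of the two steps lowers the multiplicity by at most one, so only `0`, `1` and `n + 2` have
  -- to be distinguished.
  rcases n with _ | _ | n <;> cases k <;> cases a₁ <;> cases a₂ <;>
    simp only [crossing, siteOp] <;> ring

/-- The Yang–Baxter equation at column index `0`. -/
theorem crossing_bottomOp (s t : K) (β₁ β₂ : Bool) (φ : Bool → K) (k : Bool) (a₁ a₂ : Strand) :
    crossing s t (fun a₁ a₂ => bottomOp β₁ (bottomOp β₂ φ a₂) a₁ k) a₁ a₂ =
      t * (bif β₁ && β₂ then -1 else 1) * bottomOp β₂ (bottomOp β₁ φ a₂) a₁ k := by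
  cases β₁ <;> cases β₂ <;> cases k <;> cases a₁ <;> cases a₂ <;>
    simp [crossing, bottomOp] <;> ring

end Vertex

end SuperNC

/-! ### Transfer operators and the commutation of two steps -/

namespace SuperNC

section Transfer

variable {K : Type*} [CommRing K]

theorem siteOp_add (t : K) (φ ψ : Strand → Bool → ℕ → K) (a : Strand) (k : Bool) (n : ℕ) :
    siteOp t (fun b k n => φ b k n + ψ b k n) a k n = siteOp t φ a k n + siteOp t ψ a k n := by
  rcases n with _ | n <;> cases k <;> cases a <;> simp only [siteOp] <;> ring

theorem siteOp_mul (t r : K) (φ : Strand → Bool → ℕ → K) (a : Strand) (k : Bool) (n : ℕ) :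
    siteOp t (fun b k n => r * φ b k n) a k n = r * siteOp t φ a k n := by
  rcases n with _ | n <;> cases k <;> cases a <;> simp only [siteOp] <;> ring

theorem bottomOp_add (β : Bool) (φ ψ : Bool → K) (a : Strand) (k : Bool) :
    bottomOp β (fun k => φ k + ψ k) a k = bottomOp β φ a k + bottomOp β ψ a k := by
  cases β <;> cases k <;> cases a <;> simp [bottomOp]; ring

theorem bottomOp_mul (β : Bool) (r : K) (φ : Bool → K) (a : Strand) (k : Bool) :
    bottomOp β (fun k => r * φ k) a k = r * bottomOp β φ a k := by
  cases β <;> cases k <;> cases a <;> simp [bottomOp]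

/-- Column data: for each `c`, whether `c` is a fermionic component and how often it is another
component. -/
abbrev Config : Type := ℕ → Bool × ℕ

/-- The configuration that is concentrated in column index `0`. -/
def Config.bottom (k : Bool) : Config := fun c => if c = 0 then (k, 0) else (false, 0)

/-- The sum of `Φ` over all results of a step of type `β` from `x`, with columns up to `c` in play
and in the state `a` to the right of them. -/
def transfer (t : K) (β : Bool) : ℕ → Config → (Config → K) → Strand → K
  | 0, x, Φ, a => bottomOp β (fun k => Φ (Config.bottom k)) a (x 0).1
  | c + 1, x, Φ, a => siteOp t
      (fun b k n => transfer t β c x (fun y => Φ (Function.update y (c + 1) (k, n))) b)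
      a (x (c + 1)).1 (x (c + 1)).2

theorem transfer_congr (t : K) (β : Bool) (c : ℕ) {x x' : Config} (h : ∀ i ≤ c, x i = x' i)
    (Φ : Config → K) (a : Strand) : transfer t β c x Φ a = transfer t β c x' Φ a := by
  induction c generalizing Φ a with
  | zero => rw [transfer, transfer, h 0 le_rfl]
  | succ c ih =>
    rw [transfer, transfer, h (c + 1) le_rfl]
    congr 1
    funext b k n
    exact ih (fun i hi => h i (by omega)) _ _

theorem transfer_add (t : K) (β : Bool) (c : ℕ) (x : Config) (Φ Ψ : Config → K) (a : Strand) :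
    transfer t β c x (fun y => Φ y + Ψ y) a = transfer t β c x Φ a + transfer t β c x Ψ a := by
  induction c generalizing Φ Ψ a with
  | zero => exact bottomOp_add ..
  | succ c ih =>
    simp only [transfer]
    rw [← siteOp_add]
    congr 1
    funext b k n
    exact ih _ _ _

theorem transfer_mul (t r : K) (β : Bool) (c : ℕ) (x : Config) (Φ : Config → K) (a : Strand) :
    transfer t β c x (fun y => r * Φ y) a = r * transfer t β c x Φ a := by
  induction c generalizing Φ a with
  | zero => exact bottomOp_mul ..
  | succ c ih =>
    simp only [transfer]
    rw [← siteOp_mul]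
    congr 1
    funext b k n
    exact ih _ _

theorem transfer_neg (t : K) (β : Bool) (c : ℕ) (x : Config) (Φ : Config → K) (a : Strand) :
    transfer t β c x (fun y => -Φ y) a = -transfer t β c x Φ a := by
  simpa using transfer_mul t (-1) β c x Φ a

theorem transfer_zero (t : K) (β : Bool) (c : ℕ) (x : Config) (a : Strand) :
    transfer t β c x (fun _ => 0) a = 0 := by
  simpa using transfer_mul t 0 β c x (fun _ => 0) a

/-- For a fixed state and fixed column data, `siteOp` is a finite linear combination of values, so
it commutes with the linear map `transfer`. This lets column `c + 1` of the second step be handled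
before the lower columns of the first one. -/
theorem transfer_siteOp (t u : K) (β : Bool) (c : ℕ) (x : Config)
    (G : Config → Strand → Bool → ℕ → K) (a₁ a₂ : Strand) (k : Bool) (n : ℕ) :
    transfer t β c x (fun y => siteOp u (G y) a₂ k n) a₁ =
      siteOp u (fun b k n => transfer t β c x (fun y => G y b k n) a₁) a₂ k n := by
  rcases n with _ | n <;> cases k <;> cases a₂ <;>
    simp only [siteOp, transfer_add, transfer_mul, transfer_neg, transfer_zero]

/-- Two consecutive steps. -/
def transfer₂ (s t : K) (β₁ β₂ : Bool) (c : ℕ) (x : Config) (Φ : Config → K) (a₁ a₂ : Strand) : K :=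
  transfer s β₁ c x (fun y => transfer t β₂ c y Φ a₂) a₁

theorem transfer₂_succ (s t : K) (β₁ β₂ : Bool) (c : ℕ) (x : Config) (Φ : Config → K)
    (a₁ a₂ : Strand) :
    transfer₂ s t β₁ β₂ (c + 1) x Φ a₁ a₂ =
      siteOp s (fun b₁ => siteOp t (fun b₂ k n => transfer₂ s t β₁ β₂ c x
        (fun z => Φ (Function.update z (c + 1) (k, n))) b₁ b₂) a₂) a₁
        (x (c + 1)).1 (x (c + 1)).2 := by
  unfold transfer₂
  conv_lhs => rw [transfer]
  congr 1
  funext b₁ k n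
  rw [← transfer_siteOp]
  congr 1
  funext y
  rw [transfer, Function.update_self]
  congr 1
  funext b₂ k' n'
  refine transfer_congr _ _ _ (fun i hi => ?_) _ _
  rw [Function.update_of_ne (by omega)]

/-- The train argument: `crossing_siteOp` moves the crossing past the rightmost column and exchanges
the two steps there, induction moves it past the others, and `crossing_bottomOp` absorbs it into a
scalar at the left end. -/
theorem crossing_transfer₂ (s t : K) (β₁ β₂ : Bool) (c : ℕ) (x : Config) (Φ : Config → K)
    (a₁ a₂ : Strand) :
    crossing s t (transfer₂ s t β₁ β₂ c x Φ) a₁ a₂ =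
      t * (bif β₁ && β₂ then -1 else 1) * transfer₂ t s β₂ β₁ c x Φ a₁ a₂ := by
  induction c generalizing Φ a₁ a₂ with
  | zero =>
    have h : ∀ (s t : K) (β₁ β₂ : Bool), transfer₂ s t β₁ β₂ 0 x Φ = fun a₁ a₂ =>
        bottomOp β₁ (bottomOp β₂ (fun k => Φ (Config.bottom k)) a₂) a₁ (x 0).1 := by
      intro s t β₁ β₂
      funext a₁ a₂
      simp only [transfer₂, transfer]
      rfl
    rw [h, h]
    exact crossing_bottomOp ..
  | succ c ih =>
    have h := funext₂ (transfer₂_succ s t β₁ β₂ c x Φ)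
    rw [h, crossing_siteOp, transfer₂_succ]
    simp only [ih]
    rw [← siteOp_mul]
    congr 1
    funext b k n
    rw [← siteOp_mul]

theorem transfer₂_comm (s t : K) (ht : IsLeftRegular t) (β₁ β₂ : Bool) (c : ℕ) (x : Config)
    (Φ : Config → K) :
    transfer₂ s t β₁ β₂ c x Φ .empty .empty =
      (bif β₁ && β₂ then -1 else 1) * transfer₂ t s β₂ β₁ c x Φ .empty .empty := by
  -- On the pair of empty states the crossing is multiplication by `t`, which is cancelled here.
  apply ht
  simpa only [crossing, mul_assoc] using crossing_transfer₂ s t β₁ β₂ c x Φ .empty .empty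

/-- A sum of values with finitely many coefficients. -/
def IsFiniteCombination {Y : Type*} (F : (Y → K) → K) : Prop :=
  ∃ f : Y →₀ K, ∀ Φ, F Φ = Finsupp.linearCombination K Φ f

namespace IsFiniteCombination

variable {Y Z : Type*}

theorem eval (y : Y) : IsFiniteCombination (K := K) fun Φ => Φ y :=
  ⟨Finsupp.single y 1, fun Φ => by simp⟩

theorem zero : IsFiniteCombination (K := K) fun _ : Y → K => 0 :=
  ⟨0, fun Φ => by simp⟩

theorem add {F G : (Y → K) → K} (hF : IsFiniteCombination F) (hG : IsFiniteCombination G) :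
    IsFiniteCombination fun Φ => F Φ + G Φ := by
  obtain ⟨f, hf⟩ := hF
  obtain ⟨g, hg⟩ := hG
  exact ⟨f + g, fun Φ => by simp only [hf, hg, map_add]⟩

theorem mul (r : K) {F : (Y → K) → K} (hF : IsFiniteCombination F) :
    IsFiniteCombination fun Φ => r * F Φ := by
  obtain ⟨f, hf⟩ := hF
  exact ⟨r • f, fun Φ => by simp only [hf, map_smul, smul_eq_mul]⟩

theorem neg {F : (Y → K) → K} (hF : IsFiniteCombination F) :
    IsFiniteCombination fun Φ => -F Φ := by
  simpa using hF.mul (-1)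

theorem comp {F : (Y → K) → K} (hF : IsFiniteCombination F) (g : Y → Z) :
    IsFiniteCombination fun Φ : Z → K => F (fun y => Φ (g y)) := by
  obtain ⟨f, hf⟩ := hF
  refine ⟨f.mapDomain g, fun Φ => ?_⟩
  simp only [hf, Finsupp.linearCombination_mapDomain]
  rfl

end IsFiniteCombination

-- A transfer is defined by recursion on a test function `Φ`. Knowing that it involves finitely many
-- values of `Φ` turns it into an honest sum over target configurations.
open IsFiniteCombination in
theorem isFiniteCombination_transfer (t : K) (β : Bool) (c : ℕ) (x : Config) (a : Strand) :
    IsFiniteCombination fun Φ => transfer t β c x Φ a := by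
  induction c generalizing a with
  | zero =>
    simp only [transfer]
    cases β <;> cases (x 0).1 <;> cases a <;> simp only [bottomOp, cond_true, cond_false] <;>
      first | exact eval _ | exact zero | exact (eval _).neg
  | succ c ih =>
    have h : ∀ b k n, IsFiniteCombination fun Φ : Config → K =>
        transfer t β c x (fun y => Φ (Function.update y (c + 1) (k, n))) b :=
      fun b k n => (ih b).comp fun y => Function.update y (c + 1) (k, n)
    simp only [transfer]
    rcases (x (c + 1)).2 with _ | n <;> cases (x (c + 1)).1 <;> cases a <;> simp only [siteOp] <;>
      first
      | exact zero
      | exact (h ..).mul _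
      | exact ((h ..).mul _).neg
      | exact (h ..).add ((h ..).mul _)
      | exact ((h ..).add ((h ..).mul _)).add ((h ..).mul _)

/-- The values of `Φ` on configurations that are not supported in columns up to `c` are
irrelevant. -/
theorem transfer_congr_right (t : K) (β : Bool) (c : ℕ) (x : Config) {Φ Ψ : Config → K}
    (h : ∀ y : Config, (y 0).2 = 0 → (∀ i > c, y i = (false, 0)) → Φ y = Ψ y) (a : Strand) :
    transfer t β c x Φ a = transfer t β c x Ψ a := by
  induction c generalizing Φ Ψ a with
  | zero =>
    simp only [transfer]
    congr 1
    funext k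
    exact h _ rfl fun i hi => if_neg (by omega)
  | succ c ih =>
    simp only [transfer]
    congr 1
    funext b k n
    refine ih (fun y h0 hy => h _ ?_ fun i hi => ?_) b
    · rwa [Function.update_of_ne (by omega)]
    · rw [Function.update_of_ne (by omega)]
      exact hy i (by omega)

open Classical in
/-- The coefficient of the configuration `z` after a step from `x`. -/
noncomputable def amplitude (t : K) (β : Bool) (c : ℕ) (x z : Config) (a : Strand) : K :=
  transfer t β c x (fun y => if y = z then 1 else 0) a

theorem amplitude_eq_zero (t : K) (β : Bool) (c : ℕ) (x z : Config) (a : Strand)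
    (hz : ¬((z 0).2 = 0 ∧ ∀ i > c, z i = (false, 0))) : amplitude t β c x z a = 0 := by
  unfold amplitude
  refine (transfer_congr_right t β c x (fun y h0 hy => if_neg ?_) a).trans
    (transfer_zero t β c x a)
  rintro rfl
  exact hz ⟨h0, hy⟩

/-- A transfer is the sum over all injectively parametrized configurations. -/
theorem transfer_eq_sum {ι : Type*} (P : Finset ι) (g : ι → Config) (hg : Function.Injective g)
    (t : K) (β : Bool) (c : ℕ) (x : Config) (Φ : Config → K) (a : Strand)
    (h : ∀ y : Config, (y 0).2 = 0 → (∀ i > c, y i = (false, 0)) →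
      amplitude t β c x y a * Φ y ≠ 0 → ∃ i ∈ P, g i = y) :
    transfer t β c x Φ a = ∑ i ∈ P, amplitude t β c x (g i) a * Φ (g i) := by
  classical
  -- The coefficients of this combination are recovered by testing on indicator functions, so they
  -- are the amplitudes.
  obtain ⟨f, hf⟩ := isFiniteCombination_transfer t β c x a
  simp only at hf
  have hamp : ∀ z, f z = amplitude t β c x z a := by
    intro z
    rw [amplitude, hf, Finsupp.linearCombination_apply, Finsupp.sum]
    simp
  rw [hf, Finsupp.linearCombination_apply, Finsupp.sum]
  simp only [hamp, smul_eq_mul]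
  rw [← Finset.sum_image (f := fun y => amplitude t β c x y a * Φ y) (g := g) fun _ _ _ _ e => hg e]
  refine Finset.sum_congr_of_eq_on_inter ?_ ?_ fun _ _ _ => rfl
  · intro y _ hy
    by_contra hne
    refine hy ?_
    have hy' : (y 0).2 = 0 ∧ ∀ i > c, y i = (false, 0) := by
      by_contra hc
      exact hne (by rw [amplitude_eq_zero t β c x y a hc, zero_mul])
    obtain ⟨i, hi, rfl⟩ := h y hy'.1 hy'.2 hne
    exact Finset.mem_image_of_mem g hi
  · intro y _ hy
    rw [Finsupp.mem_support_iff, not_not, hamp] at hy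
    rw [hy, zero_mul]

end Transfer

end SuperNC

/-! ### Superpartitions and steps in terms of column heights -/

namespace SuperNC

theorem sortDesc_perm (l : List ℕ) : (sortDesc l).Perm l := List.mergeSort_perm _ _

theorem sortDesc_pairwise (l : List ℕ) : (sortDesc l).Pairwise (· ≥ ·) := by
  have := List.pairwise_mergeSort (le := fun x y : ℕ => decide (y ≤ x))
    (fun a b c h1 h2 => by simp at *; omega) (fun a b => by simp; omega) l
  exact this.imp fun h => by simpa using h

theorem sortDesc_eq_of_perm {l l' : List ℕ} (h : l.Perm l') (hl : l'.Pairwise (· ≥ ·)) :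
    sortDesc l = l' :=
  List.Perm.eq_of_pairwise (fun _ _ _ _ h1 h2 => le_antisymm h2 h1) (sortDesc_pairwise l) hl
    ((sortDesc_perm l).trans h)

/-- Conjugation of partitions: in a decreasing list the entries larger than `v` form an initial
segment. -/
theorem lt_getD_iff {l : List ℕ} (hl : l.Pairwise (· ≥ ·)) (v r : ℕ) :
    v < l.getD r 0 ↔ r < l.countP (v < ·) := by
  induction l generalizing r with
  | nil => simp
  | cons x l ih =>
    rw [List.pairwise_cons] at hl
    rcases r with _ | r
    · rw [List.getD_cons_zero, List.countP_cons]
      by_cases h : v < x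
      · simp [h]
      · have : l.countP (v < ·) = 0 := by
          rw [List.countP_eq_zero]
          intro y hy
          have := hl.1 y hy
          simp; omega
        rw [this]; simp [h]
    · rw [List.getD_cons_succ, ih hl.2, List.countP_cons]
      by_cases h : v < x
      · simp [h]
      · have : l.countP (v < ·) = 0 := by
          rw [List.countP_eq_zero]
          intro y hy
          have := hl.1 y hy
          simp; omega
        rw [this]; simp [h]

namespace SuperPartition

variable (L : SuperPartition)

theorem a_nodup : L.a.Nodup := L.a_sorted.imp fun h => ne_of_gt h

/-- The number of components that are larger than `v`; this is the number of boxes in column `v`. -/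
def col (v : ℕ) : ℕ := (L.a ++ L.s).countP (v < ·)

theorem lt_row_iff (v r : ℕ) : v < L.row r ↔ r < L.col v := by
  rw [row, plus, lt_getD_iff (sortDesc_pairwise _), (sortDesc_perm _).countP_eq, col]

/-- Raising a component `v` by one adds a cell to column `v` only, and fermionic components are
distinct, so no column gains more than one. -/
theorem lt_oplus_iff (v r : ℕ) :
    v < L.oplus.getD r 0 ↔ r < L.col v + if v ∈ L.a then 1 else 0 := by
  rw [oplus, lt_getD_iff (sortDesc_pairwise _), (sortDesc_perm _).countP_eq, col,
    List.countP_append, List.countP_append, List.countP_map]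
  have : L.a.countP ((fun x => decide (v < x)) ∘ (· + 1)) =
      L.a.countP (v < ·) + if v ∈ L.a then 1 else 0 := by
    have key : ∀ l : List ℕ, l.countP ((fun x => decide (v < x)) ∘ (· + 1)) =
        l.countP (v < ·) + l.count v := by
      intro l
      induction l with
      | nil => rfl
      | cons x l ih =>
        rw [List.countP_cons, List.countP_cons, List.count_cons, ih]
        simp only [Function.comp_apply, decide_eq_true_eq, beq_iff_eq]
        split_ifs <;> omega
    rw [key]
    split_ifs with h
    · rw [List.count_eq_one_of_mem L.a_nodup h]
    · rw [List.count_eq_zero_of_not_mem h]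
  rw [this]
  omega

theorem col_anti : Antitone L.col := by
  intro v w h
  exact List.countP_mono_left fun x _ hx => by simp at *; omega

theorem col_succ_lt {v w : ℕ} (hw : w ∈ L.a ++ L.s) (h : v < w) : L.col w < L.col v := by
  unfold col
  generalize L.a ++ L.s = l at hw
  induction l with
  | nil => simp at hw
  | cons x l ih =>
    have hle : l.countP (w < ·) ≤ l.countP (v < ·) :=
      List.countP_mono_left fun x _ hx => by simp at *; omega
    rw [List.countP_cons, List.countP_cons]
    simp only [decide_eq_true_eq]
    rcases List.mem_cons.1 hw with rfl | hw
    · rw [if_pos h, if_neg (lt_irrefl _)]; omega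
    · have := ih hw
      split_ifs <;> omega

theorem col_lt_length {w : ℕ} (hw : w ∈ L.a ++ L.s) : L.col w < L.length := by
  have h : L.col w ≠ (L.a ++ L.s).length := by
    intro h
    rw [col, List.countP_eq_length] at h
    simpa using h w hw
  have h2 := List.countP_le_length (p := fun x => decide (w < x)) (l := L.a ++ L.s)
  change L.col w ≤ _ at h2
  rw [List.length_append] at h h2
  unfold length
  omega

theorem row_col {w : ℕ} (hw : w ∈ L.a ++ L.s) : L.row (L.col w) = w := by
  apply le_antisymm
  · by_contra! h
    rw [lt_row_iff] at h
    omega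
  · by_contra! h
    have h1 := L.col_succ_lt hw h
    rw [← lt_row_iff] at h1
    omega

theorem mem_circles_iff (r : ℕ) : r ∈ L.circles ↔ ∃ v ∈ L.a, L.col v = r := by
  rw [circles, List.mem_filter, List.mem_range, decide_eq_true_eq, lt_oplus_iff]
  have h0 : ¬ r < L.col (L.row r) := by rw [← lt_row_iff]; omega
  constructor
  · rintro ⟨_, h⟩
    split_ifs at h with hm
    · exact ⟨_, hm, by omega⟩
    · omega
  · rintro ⟨v, hv, rfl⟩
    have hv' : v ∈ L.a ++ L.s := List.mem_append_left _ hv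
    rw [L.row_col hv', if_pos hv]
    exact ⟨L.col_lt_length hv', by omega⟩

theorem col_strictAntiOn {v w : ℕ} (hv : v ∈ L.a) (h : w < v) : L.col v < L.col w :=
  L.col_succ_lt (List.mem_append_left _ hv) h

theorem map_col_sorted : (L.a.map L.col).Pairwise (· < ·) := by
  rw [List.pairwise_map]
  exact L.a_sorted.imp_of_mem fun ha _ h => L.col_strictAntiOn ha h

/-- A fermionic component `v` has its circle directly under column `v`, in row `L.col v`. Decreasing
components thus list the circles from top to bottom. -/
theorem circles_eq : L.circles = L.a.map L.col := by
  have h1 : L.circles.Pairwise (· < ·) := List.pairwise_lt_range.filter _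
  refine List.Perm.eq_of_pairwise (fun _ _ _ _ h1 h2 => absurd h1 (lt_asymm h2)) h1
    L.map_col_sorted ?_
  rw [List.perm_ext_iff_of_nodup (h1.imp ne_of_lt) (L.map_col_sorted.imp ne_of_lt)]
  intro r
  rw [mem_circles_iff, List.mem_map]

theorem col_eq (v : ℕ) :
    L.col v = L.col (v + 1) + (if v + 1 ∈ L.a then 1 else 0) + L.s.count (v + 1) := by
  have key : ∀ l : List ℕ, l.countP (v < ·) = l.countP (v + 1 < ·) + l.count (v + 1) := by
    intro l
    induction l with
    | nil => rfl
    | cons x l ih =>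
      rw [List.countP_cons, List.countP_cons, List.count_cons, ih]
      simp only [decide_eq_true_eq, beq_iff_eq]
      split_ifs <;> omega
  rw [col, col, key, List.count_append]
  have : L.a.count (v + 1) = if v + 1 ∈ L.a then 1 else 0 := by
    split_ifs with h
    · exact List.count_eq_one_of_mem L.a_nodup h
    · exact List.count_eq_zero_of_not_mem h
  omega

theorem col_eq_zero {M : ℕ} (h : ∀ x ∈ L.a ++ L.s, x ≤ M) : L.col M = 0 := by
  rw [col, List.countP_eq_zero]
  intro x hx
  have := h x hx
  simp; omega

theorem deg_eq_sum {M : ℕ} (h : ∀ x ∈ L.a ++ L.s, x ≤ M) :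
    L.deg = ∑ v ∈ Finset.range M, L.col v := by
  rw [deg, ← List.sum_append]
  unfold col
  generalize L.a ++ L.s = l at h
  induction l with
  | nil => simp
  | cons x l ih =>
    simp only [List.countP_cons, Finset.sum_add_distrib, List.sum_cons, decide_eq_true_eq]
    rw [← ih fun y hy => h y (List.mem_cons_of_mem _ hy), Finset.sum_boole, add_comm]
    have hx := h x List.mem_cons_self
    have : (Finset.range M).filter (· < x) = Finset.range x := by
      ext i; simp; omega
    rw [this]; simp

end SuperPartition

open SuperPartition

/-- `D⁺ / C⁺` is a horizontal strip. -/
def IsStrip (C D : SuperPartition) : Prop := ∀ v, C.col v ≤ D.col v ∧ D.col v ≤ C.col v + 1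

theorem mem_skew_iff (C D : SuperPartition) (r c : ℕ) :
    (r, c) ∈ skew C D ↔ C.col c ≤ r ∧ r < D.col c := by
  change C.row r ≤ c ∧ c < D.row r ↔ _
  rw [D.lt_row_iff, ← not_lt, C.lt_row_iff, not_lt]

theorem isHorizontalStrip_iff (C D : SuperPartition) (k : ℕ) :
    IsHorizontalStrip C D k ↔ IsStrip C D ∧ D.deg = C.deg + k := by
  constructor
  · rintro ⟨h1, h2, h3⟩
    refine ⟨fun v => ?_, h2⟩
    have hle : C.col v ≤ D.col v := by
      by_contra! h
      rw [← C.lt_row_iff] at h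
      have := D.lt_row_iff v (D.col v)
      have := h1 (D.col v)
      omega
    refine ⟨hle, ?_⟩
    by_contra! h
    have := h3 (C.col v, v) ((mem_skew_iff ..).2 (by omega)) (C.col v + 1, v)
      ((mem_skew_iff ..).2 (by omega)) rfl
    simp at this
  · rintro ⟨h1, h2⟩
    refine ⟨fun r => ?_, h2, ?_⟩
    · by_contra! h
      rw [C.lt_row_iff] at h
      have h3 := (h1 (D.row r)).1
      have h4 := D.lt_row_iff (D.row r) r
      omega
    · rintro ⟨r, c⟩ hp ⟨r', c'⟩ hq h
      simp only at h
      subst h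
      rw [mem_skew_iff] at hp hq
      have := h1 c
      simp only [Prod.mk.injEq, and_true]
      omega

/-- The circle under column `v` of `C` has to move down one row exactly when column `v` grows. In
both cases its new row is `D.col v`, so the two alternatives of the rule merge into one formula. -/
theorem circlesMove_iff {C D : SuperPartition} (h : IsStrip C D) (l : List ℕ) :
    CirclesMove C D l ↔ l = C.a.map D.col := by
  -- Row `C.col v` of `C` has length `v`, so a box of the strip in this row lies in column `v` or
  -- further to the right, and then column `v` has one too.
  have key : ∀ v ∈ C.a, (∃ c, (C.col v, c) ∈ skew C D) ↔ D.col v = C.col v + 1 := by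
    intro v hv
    constructor
    · rintro ⟨c, hc⟩
      rw [mem_skew_iff] at hc
      have h1 := h v
      have h2 := h c
      rcases lt_or_ge c v with hcv | hcv
      · have := C.col_strictAntiOn hv hcv
        omega
      · have := D.col_anti hcv
        omega
    · intro h1
      exact ⟨v, (mem_skew_iff ..).2 (by omega)⟩
  unfold CirclesMove
  rw [circles_eq, List.length_map]
  constructor
  · rintro ⟨h1, h2⟩
    apply List.ext_getElem?
    intro j
    rw [List.getElem?_map]
    rcases hj : C.a[j]? with _ | v
    · simp only [Option.map_none]
      rw [List.getElem?_eq_none_iff] at hj ⊢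
      omega
    · obtain ⟨h3, h4⟩ := h2 j (C.col v) (by rw [List.getElem?_map, hj]; rfl)
      have hv : v ∈ C.a := List.mem_of_getElem? hj
      by_cases hc : ∃ c, (C.col v, c) ∈ skew C D
      · rw [h4 hc, Option.map_some, (key v hv).1 hc]
      · have h5 := h v
        have h6 := (key v hv).not.1 hc
        rw [h3 (by simpa using hc), Option.map_some]
        congr 1
        omega
  · rintro rfl
    refine ⟨List.length_map .., ?_⟩
    intro j r hr
    rw [List.getElem?_map] at hr ⊢
    rcases hj : C.a[j]? with _ | v
    · simp [hj] at hr
    · rw [hj, Option.map_some, Option.some_inj] at hr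
      subst hr
      have hv : v ∈ C.a := List.mem_of_getElem? hj
      have h5 := h v
      rw [Option.map_some, Option.some_inj, Option.some_inj]
      refine ⟨fun hc => ?_, fun hc => (key v hv).1 hc⟩
      have h6 := (key v hv).not.1 (by simpa using hc)
      omega

theorem isNewCircle_iff {C D : SuperPartition} (h : IsStrip C D) (p : ℕ) :
    IsNewCircle C D p ↔ ∃ v, D.a[p]? = some v ∧ D.col v = C.col v ∧
      ∀ c < v, D.col c = C.col c + 1 := by
  have key : ∀ c, (∃ r, (r, c) ∈ skew C D) ↔ D.col c = C.col c + 1 := by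
    intro c
    have := h c
    simp only [mem_skew_iff]
    constructor
    · rintro ⟨r, hr⟩; omega
    · intro h1; exact ⟨C.col c, by omega⟩
  unfold IsNewCircle
  rw [circles_eq, List.getElem?_map]
  rcases hj : D.a[p]? with _ | v
  · simp
  · have hv : v ∈ D.a ++ D.s := List.mem_append_left _ (List.mem_of_getElem? hj)
    simp only [Option.map_some, Option.some_inj, exists_eq_left', D.row_col hv, key,
      ← not_exists]
    have := h v
    refine and_congr_left fun _ => ?_
    omega

theorem isStep_plain_iff (C D : SuperPartition) (k : ℕ) :
    IsStep C (.plain k) D ↔ IsStrip C D ∧ D.deg = C.deg + k ∧ D.a.map D.col = C.a.map D.col := by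
  unfold IsStep
  rw [isHorizontalStrip_iff]
  constructor
  · rintro ⟨⟨h1, h2⟩, _, h3⟩
    rw [circlesMove_iff h1, circles_eq] at h3
    exact ⟨h1, h2, h3⟩
  · rintro ⟨h1, h2, h3⟩
    refine ⟨⟨h1, h2⟩, ?_, ?_⟩
    · simpa [df] using congrArg List.length h3
    · rw [circlesMove_iff h1, circles_eq]
      exact h3

/-- `v` is the leftmost empty column of `D⁺ / C⁺`. -/
def IsFirstGap (C D : SuperPartition) (v : ℕ) : Prop :=
  D.col v = C.col v ∧ ∀ c < v, D.col c = C.col c + 1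

theorem IsFirstGap.unique {C D : SuperPartition} {v w : ℕ} (hv : IsFirstGap C D v)
    (hw : IsFirstGap C D w) : v = w := by
  rcases lt_trichotomy v w with h | h | h
  · have := hw.2 v h; have := hv.1; omega
  · exact h
  · have := hv.2 w h; have := hw.1; omega

theorem isNewCircle_idxOf {C D : SuperPartition} (h : IsStrip C D) {v : ℕ} (hv : v ∈ D.a)
    (hg : IsFirstGap C D v) (p : ℕ) : IsNewCircle C D p ↔ p = D.a.idxOf v := by
  rw [isNewCircle_iff h]
  constructor
  · rintro ⟨w, hw, hw'⟩
    obtain rfl := IsFirstGap.unique hw' hg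
    obtain ⟨hp, rfl⟩ := List.getElem?_eq_some_iff.1 hw
    exact (D.a_nodup.idxOf_getElem p hp).symm
  · rintro rfl
    exact ⟨v, by simp [List.getElem?_eq_getElem (List.idxOf_lt_length_of_mem hv)], hg⟩

theorem newIdx_eq {C D : SuperPartition} (h : IsStrip C D) {v : ℕ} (hv : v ∈ D.a)
    (hg : IsFirstGap C D v) : newIdx C D = D.a.idxOf v := by
  simp [newIdx, isNewCircle_idxOf h hv hg]

/-- The new circle must lie in the leftmost empty column of the strip. This column is unique, so
uniqueness of the new circle is automatic, and removing the circle amounts to erasing one component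
of `D.a`. -/
theorem isStep_barred_iff (C D : SuperPartition) (k : ℕ) :
    IsStep C (.barred k) D ↔ IsStrip C D ∧ D.deg = C.deg + k ∧
      ∃ v ∈ D.a, IsFirstGap C D v ∧ (D.a.erase v).map D.col = C.a.map D.col := by
  unfold IsStep
  rw [isHorizontalStrip_iff]
  constructor
  · rintro ⟨⟨h1, h2⟩, _, p, h3, _, h4⟩
    refine ⟨h1, h2, ?_⟩
    obtain ⟨v, hv, hv'⟩ := (isNewCircle_iff h1 p).1 h3
    have hm : v ∈ D.a := List.mem_of_getElem? hv
    refine ⟨v, hm, hv', ?_⟩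
    obtain rfl := (isNewCircle_idxOf h1 hm hv' p).1 h3
    rw [circlesMove_iff h1, circles_eq, List.eraseIdx_map, ← List.erase_eq_eraseIdx_of_idxOf rfl]
      at h4
    exact h4
  · rintro ⟨h1, h2, v, hm, hv, h3⟩
    refine ⟨⟨h1, h2⟩, ?_, D.a.idxOf v, (isNewCircle_idxOf h1 hm hv _).2 rfl,
      fun q hq => (isNewCircle_idxOf h1 hm hv _).1 hq, ?_⟩
    · have := congrArg List.length h3
      rw [List.length_map, List.length_map, List.length_erase_of_mem hm] at this
      have := List.length_pos_of_mem hm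
      unfold df
      omega
    · rw [circlesMove_iff h1, circles_eq, List.eraseIdx_map,
        ← List.erase_eq_eraseIdx_of_idxOf rfl]
      exact h3

end SuperNC

/-! ### Amplitudes, configurations of superpartitions, and movement of circles -/

namespace SuperNC

open SuperPartition

section Amplitude

variable {K : Type*} [CommRing K]

/-- The coefficient of `z` after a step from `x`, by recursion on the columns. -/
def amp (t : K) (β : Bool) (x z : Config) : ℕ → Strand → K
  | 0, a => bottomOp β (fun k => if k = (z 0).1 then 1 else 0) a (x 0).1
  | c + 1, a => siteOp t
      (fun b k n => if k = (z (c + 1)).1 ∧ n = (z (c + 1)).2 then amp t β x z c b else 0)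
      a (x (c + 1)).1 (x (c + 1)).2

/-- With the target fixed, each column must produce the prescribed data. The recursion in `amp` can
keep the full target `z`, whereas the amplitude up to column `c` sees its truncation `z'`. -/
theorem amplitude_eq_amp (t : K) (β : Bool) (x z z' : Config) (c : ℕ) (a : Strand)
    (hz0 : (z 0).2 = 0) (h : ∀ i ≤ c, z' i = z i) (h' : ∀ i > c, z' i = (false, 0)) :
    amplitude t β c x z' a = amp t β x z c a := by
  classical
  induction c generalizing z' a with
  | zero =>
    unfold amplitude
    simp only [transfer, amp]
    congr 1
    funext k
    refine if_congr ?_ rfl rfl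
    have h0 := h 0 le_rfl
    constructor
    · rintro rfl
      rw [← h0]; rfl
    · intro hk
      funext i
      unfold Config.bottom
      split_ifs with hi
      · subst hi
        rw [h0]
        exact Prod.ext hk hz0.symm
      · exact (h' i (by omega)).symm
  | succ c ih =>
    unfold amplitude
    simp only [transfer, amp]
    congr 1
    funext b k n
    have hih := ih (fun i => if i ≤ c then z i else (false, 0)) b (fun i hi => if_pos hi)
      (fun i hi => if_neg (by omega))
    unfold amplitude at hih
    rw [← hih]
    have hc := h (c + 1) le_rfl
    split_ifs with hkn
    · refine transfer_congr_right t β c x (fun y _ hy => if_congr ?_ rfl rfl) b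
      constructor
      · rintro rfl
        funext i
        split_ifs with hi
        · rw [← h i (by omega), Function.update_of_ne (by omega)]
        · exact hy i (by omega)
      · rintro rfl
        funext i
        rcases lt_trichotomy i (c + 1) with hi | rfl | hi
        · rw [Function.update_of_ne (by omega), if_pos (by omega), h i (by omega)]
        · rw [Function.update_self, hc, hkn.1, hkn.2]
        · rw [Function.update_of_ne (by omega), if_neg (by omega), h' i hi]
    · refine (transfer_congr_right t β c x (fun y _ hy => if_neg ?_) b).trans
        (transfer_zero t β c x b)
      rintro rfl
      rw [Function.update_self] at hc
      exact hkn (by rw [← hc]; exact ⟨rfl, rfl⟩)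

end Amplitude

namespace SuperPartition

/-- The column data of a superpartition. -/
def cfg (L : SuperPartition) : Config := fun c => (decide (c ∈ L.a), L.s.count c)

/-- The number of fermionic components that are larger than `v`. -/
def fcol (L : SuperPartition) (v : ℕ) : ℕ := L.a.countP (v < ·)

theorem countP_lt_succ {l : List ℕ} (hl : l.Nodup) (v : ℕ) :
    l.countP (v < ·) = l.countP (v + 1 < ·) + if v + 1 ∈ l then 1 else 0 := by
  have key : l.countP (v < ·) = l.countP (v + 1 < ·) + l.count (v + 1) := by
    clear hl
    induction l with
    | nil => rfl
    | cons x l ih =>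
      rw [List.countP_cons, List.countP_cons, List.count_cons, ih]
      simp only [decide_eq_true_eq, beq_iff_eq]
      split_ifs <;> omega
  rw [key]
  split_ifs with h
  · rw [List.count_eq_one_of_mem hl h]
  · rw [List.count_eq_zero_of_not_mem h]

theorem length_eq_countP {l : List ℕ} (hl : l.Nodup) :
    l.length = l.countP (0 < ·) + if 0 ∈ l then 1 else 0 := by
  have key : l.length = l.countP (0 < ·) + l.count 0 := by
    clear hl
    induction l with
    | nil => rfl
    | cons x l ih =>
      rw [List.countP_cons, List.length_cons, List.count_cons, ih]
      simp only [decide_eq_true_eq, beq_iff_eq]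
      split_ifs <;> omega
  rw [key]
  split_ifs with h
  · rw [List.count_eq_one_of_mem hl h]
  · rw [List.count_eq_zero_of_not_mem h]

theorem fcol_eq (L : SuperPartition) (v : ℕ) :
    L.fcol v = L.fcol (v + 1) + if v + 1 ∈ L.a then 1 else 0 := countP_lt_succ L.a_nodup v

theorem df_eq (L : SuperPartition) : L.df = L.fcol 0 + if 0 ∈ L.a then 1 else 0 :=
  length_eq_countP L.a_nodup

theorem fcol_eq_zero (L : SuperPartition) {M : ℕ} (h : ∀ x ∈ L.a ++ L.s, x ≤ M) :
    L.fcol M = 0 := by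
  rw [fcol, List.countP_eq_zero]
  intro x hx
  have := h x (List.mem_append_left _ hx)
  simp; omega

theorem cfg_zero_snd (L : SuperPartition) : (L.cfg 0).2 = 0 :=
  List.count_eq_zero_of_not_mem fun h => lt_irrefl _ (L.s_pos 0 h)

theorem cfg_eq_of_gt (L : SuperPartition) {M : ℕ} (h : ∀ x ∈ L.a ++ L.s, x ≤ M) (i : ℕ)
    (hi : i > M) : L.cfg i = (false, 0) := by
  have h1 : i ∉ L.a := fun h' => by have := h i (List.mem_append_left _ h'); omega
  have h2 : i ∉ L.s := fun h' => by have := h i (List.mem_append_right _ h'); omega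
  simp [cfg, h1, List.count_eq_zero_of_not_mem h2]

theorem cfg_injective : Function.Injective cfg := by
  intro L L' h
  have h' := fun c => congrFun h c
  simp only [cfg, Prod.mk.injEq, decide_eq_decide] at h'
  have ha : L.a = L'.a := by
    refine List.Perm.eq_of_pairwise (fun _ _ _ _ h1 h2 => absurd h1 (lt_asymm h2)) L.a_sorted
      L'.a_sorted ?_
    rw [List.perm_ext_iff_of_nodup L.a_nodup L'.a_nodup]
    exact fun c => (h' c).1
  have hs : L.s = L'.s := by
    refine List.Perm.eq_of_pairwise (fun _ _ _ _ h1 h2 => le_antisymm h2 h1) L.s_sorted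
      L'.s_sorted ?_
    rw [List.perm_iff_count]
    exact fun c => (h' c).2
  exact SuperPartition.ext ha hs

theorem exists_cfg_eq {c : ℕ} (y : Config) (h0 : (y 0).2 = 0) (h : ∀ i > c, y i = (false, 0)) :
    ∃ L : SuperPartition, L.cfg = y := by
  have hlt : (List.range (c + 1)).reverse.Pairwise (· > ·) := by
    rw [List.pairwise_reverse]
    exact List.pairwise_lt_range
  refine ⟨⟨(List.range (c + 1)).reverse.filter fun i => (y i).1,
    (List.range (c + 1)).reverse.flatMap fun i => List.replicate (y i).2 i, ?_, ?_, ?_⟩, ?_⟩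
  · exact hlt.filter _
  · rw [List.pairwise_flatMap]
    refine ⟨fun i _ => by simp [List.pairwise_replicate], hlt.imp ?_⟩
    intro i j hij a ha b hb
    rw [List.eq_of_mem_replicate ha, List.eq_of_mem_replicate hb]
    exact le_of_lt hij
  · intro x hx
    rw [List.mem_flatMap] at hx
    obtain ⟨i, _, hi⟩ := hx
    obtain rfl := List.eq_of_mem_replicate hi
    by_contra hx0
    obtain rfl : x = 0 := by omega
    rw [h0] at hi
    simp at hi
  · funext i
    unfold cfg
    ext1
    · by_cases hi : i ≤ c
      · simp [Nat.lt_succ_of_le hi]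
      · simp [h i (by omega)]
    · simp only [List.count_flatMap, Function.comp_def, List.count_replicate]
      have : ∀ l : List ℕ, l.Nodup →
          (l.map fun j => if (j == i) = true then (y j).2 else 0).sum =
            if i ∈ l then (y i).2 else 0 := by
        intro l hl
        induction l with
        | nil => rfl
        | cons j l ih =>
          rw [List.nodup_cons] at hl
          rw [List.map_cons, List.sum_cons, ih hl.2]
          by_cases hj : j = i
          · subst hj; simp [hl.1]
          · simp [hj, Ne.symm hj]
      rw [this _ (List.nodup_reverse.2 List.nodup_range)]
      split_ifs with hi
      · rfl
      · rw [h i (by simpa using hi)]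

end SuperPartition

/-- Circle positions move down to the next component of `D`, in terms of counting functions. -/
theorem map_eq_map_iff {a d : List ℕ} (ha : a.Pairwise (· > ·)) (hd : d.Pairwise (· > ·))
    {g : ℕ → ℕ} (hg : Antitone g) (hgd : ∀ w ∈ d, ∀ v < w, g w < g v) :
    d.map g = a.map g ↔ a.length = d.length ∧
      ∀ v, a.countP (v < ·) = d.countP (v < ·) ∨
        (a.countP (v < ·) = d.countP (v < ·) + 1 ∧ g v = g (v + 1)) := by
  have Ha := fun v j => lt_getD_iff (ha.imp le_of_lt) v j
  have Hd := fun v j => lt_getD_iff (hd.imp le_of_lt) v j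
  have La := fun v => List.countP_le_length (p := fun x => decide (v < x)) (l := a)
  have Ld := fun v => List.countP_le_length (p := fun x => decide (v < x)) (l := d)
  have gets : ∀ (l : List ℕ) (j : ℕ) (hj : j < l.length), l.getD j 0 = l[j] := by
    intro l j hj; simp [hj]
  have dmem : ∀ j, j < d.length → d.getD j 0 ∈ d := by
    intro j hj; rw [gets d j hj]; exact List.getElem_mem hj
  have dlt : ∀ j, j + 1 < d.length → d.getD (j + 1) 0 < d.getD j 0 := by
    intro j hj
    rw [gets d _ hj, gets d j (by omega)]
    exact List.pairwise_iff_getElem.1 hd j (j + 1) (by omega) hj (by omega)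
  constructor
  · intro h
    have hlen : a.length = d.length := by simpa using (congrArg List.length h).symm
    have hj : ∀ j, j < d.length → g (d.getD j 0) = g (a.getD j 0) := by
      intro j hj
      have h1 := congrArg (fun l : List ℕ => l[j]?) h
      simp only [List.getElem?_map, List.getElem?_eq_getElem hj,
        List.getElem?_eq_getElem (hlen ▸ hj), Option.map_some, Option.some_inj] at h1
      rw [gets d j hj, gets a j (hlen ▸ hj)]
      exact h1
    -- A circle never moves to the right: `g` is strictly larger to the left of an entry of `d` than
    -- at this entry.
    have hle : ∀ j, j < d.length → d.getD j 0 ≤ a.getD j 0 := by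
      intro j hjd
      by_contra! hlt
      have h1 := hgd _ (dmem j hjd) _ hlt
      have h2 := hj j hjd
      omega
    refine ⟨hlen, fun v => ?_⟩
    have h1 : d.countP (v < ·) ≤ a.countP (v < ·) := by
      by_contra! hlt
      have h2 := (Hd v _).2 hlt
      have h3 := hle (a.countP (v < ·)) (by have := Ld v; omega)
      have h4 := (Ha v (a.countP (v < ·))).1 (by omega)
      omega
    rcases Nat.eq_or_lt_of_le h1 with h2 | h2
    · exact Or.inl h2.symm
    refine Or.inr ?_
    have h3 := (Ha v _).2 h2
    have h4 := (Hd v (d.countP (v < ·))).not.2 (lt_irrefl _)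
    have hdl : d.countP (v < ·) < d.length := by have := La v; omega
    have h5 := hj _ hdl
    constructor
    -- With `j = d.countP (v < ·)`, a second entry of `a` beyond `v` would give `g a_{j+1} ≤ g d_j <
    -- g d_{j+1} = g a_{j+1}`.
    · by_contra h6
      have h7 : d.countP (v < ·) + 1 < a.countP (v < ·) := by omega
      have h8 := (Ha v _).2 h7
      have hdl' : d.countP (v < ·) + 1 < d.length := by have := La v; omega
      have h9 := dlt _ hdl'
      have h10 := hgd _ (dmem _ hdl) _ h9
      have h11 := hj _ hdl'
      have h12 : g (a.getD (d.countP (v < ·) + 1) 0) ≤ g (d.getD (d.countP (v < ·)) 0) :=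
        hg (by omega)
      omega
    · have h6 : g (v + 1) ≤ g v := hg (by omega)
      have h7 : g v ≤ g (d.getD (d.countP (v < ·)) 0) := hg (by omega)
      have h8 : g (a.getD (d.countP (v < ·)) 0) ≤ g (v + 1) := hg (by omega)
      omega
  · rintro ⟨hlen, h⟩
    apply List.ext_getElem (by simpa using hlen.symm)
    intro j hjd hja
    rw [List.length_map] at hjd hja
    rw [List.getElem_map, List.getElem_map, ← gets d j hjd, ← gets a j hja]
    have hle : d.getD j 0 ≤ a.getD j 0 := by
      by_contra! hlt
      have h1 := (Hd _ _).1 hlt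
      have h2 := (Ha (a.getD j 0) j).not.1 (lt_irrefl _)
      have := h (a.getD j 0)
      omega
    -- Between `d_j` and `a_j` the two counting functions differ, so `g` is constant at each unit
    -- step.
    have step : ∀ u, d.getD j 0 ≤ u → u ≤ a.getD j 0 → g (d.getD j 0) = g u := by
      intro u hu
      induction u, hu using Nat.le_induction with
      | base => intro _; rfl
      | succ u hu ih =>
        intro hua
        rw [ih (by omega)]
        have h1 := (Ha u j).1 (by omega)
        have h2 := (Hd u j).not.1 (by omega)
        rcases h u with h3 | h3
        · omega
        · exact h3.2
    exact step _ hle le_rfl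

end SuperNC

/-! ### Evaluation of the vertex model -/

namespace SuperNC

open SuperPartition

theorem SuperPartition.col_eq_cfg (L : SuperPartition) (v : ℕ) :
    L.col v = L.col (v + 1) + (bif (L.cfg (v + 1)).1 then 1 else 0) + (L.cfg (v + 1)).2 := by
  simpa [cfg, Bool.cond_decide] using L.col_eq v

theorem SuperPartition.fcol_eq_cfg (L : SuperPartition) (v : ℕ) :
    L.fcol v = L.fcol (v + 1) + (bif (L.cfg (v + 1)).1 then 1 else 0) := by
  simpa [cfg, Bool.cond_decide] using L.fcol_eq v

theorem SuperPartition.df_eq_cfg (L : SuperPartition) :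
    L.df = L.fcol 0 + (bif (L.cfg 0).1 then 1 else 0) := by
  simpa [cfg, Bool.cond_decide] using L.df_eq

section Evaluation

/-- `r` if `p` holds, and `0` otherwise. -/
noncomputable def indicate {K : Type*} [Zero K] (p : Prop) (r : K) : K :=
  open Classical in if p then r else 0

theorem indicate_pos {K : Type*} [Zero K] {p : Prop} (h : p) (r : K) : indicate p r = r := if_pos h

theorem indicate_neg {K : Type*} [Zero K] {p : Prop} (h : ¬p) (r : K) : indicate p r = 0 := if_neg h

variable {K : Type*} [CommRing K] (t : K) (C D : SuperPartition)

/-- The state of the step `D / C` in column `c` is `a`. -/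
def StateAt (c : ℕ) : Strand → Prop
  | .empty => D.col c = C.col c ∧ C.fcol c = D.fcol c
  | .full => D.col c = C.col c + 1 ∧ C.fcol c = D.fcol c
  | .transit => D.col c = C.col c ∧ C.fcol c = D.fcol c + 1
  | .below => False

/-- Column `v` is admissible: the strip has at most one box there, and at most one circle passes
from its right to its left, which does not pass by a component of `D`. -/
def ColumnOK (v : ℕ) : Prop :=
  (C.col v ≤ D.col v ∧ D.col v ≤ C.col v + 1) ∧
    (C.fcol v = D.fcol v ∨ (C.fcol v = D.fcol v + 1 ∧ D.col v = D.col (v + 1)))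

/-- The number of boxes of the strip in columns to the left of `c`, if there is a strip. -/
def boxesBefore (c : ℕ) : ℕ := ∑ v ∈ Finset.range c, (D.col v - C.col v)

theorem boxesBefore_succ (c : ℕ) :
    boxesBefore C D (c + 1) = boxesBefore C D c + (D.col c - C.col c) :=
  Finset.sum_range_succ _ _

/-- Apart from `below`, the state in a column is determined by `C` and `D`, so at most one branch of
`siteOp` survives. It carries a factor `t` iff column `c` has a box, and no branch survives if the
column is inadmissible. -/
theorem siteOp_amp_eq (β : Bool) (c : ℕ) (V : K)
    (hbelow : D.col c = C.col c + 1 → amp t β C.cfg D.cfg c .below = 0)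
    (hV : ∀ a, StateAt C D c a → amp t β C.cfg D.cfg c a = V) (a : Strand)
    (ha : StateAt C D (c + 1) a) :
    amp t β C.cfg D.cfg (c + 1) a =
      indicate (ColumnOK C D c) (t ^ (D.col c - C.col c) * V) := by
  classical
  have c1 := C.col_eq_cfg c
  have c2 := D.col_eq_cfg c
  have f1 := C.fcol_eq_cfg c
  have f2 := D.fcol_eq_cfg c
  have hE : ∀ p : Prop, [Decidable p] → (p → StateAt C D c .empty) →
      (if p then amp t β C.cfg D.cfg c .empty else 0) = if p then V else 0 := by
    intro p _ hp; split_ifs with h; exacts [hV _ (hp h), rfl]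
  have hF : ∀ p : Prop, [Decidable p] → (p → StateAt C D c .full) →
      (if p then amp t β C.cfg D.cfg c .full else 0) = if p then V else 0 := by
    intro p _ hp; split_ifs with h; exacts [hV _ (hp h), rfl]
  have hT : ∀ p : Prop, [Decidable p] → (p → StateAt C D c .transit) →
      (if p then amp t β C.cfg D.cfg c .transit else 0) = if p then V else 0 := by
    intro p _ hp; split_ifs with h; exacts [hV _ (hp h), rfl]
  have hB : ∀ p : Prop, [Decidable p] → (p → D.col c = C.col c + 1) →
      (if p then amp t β C.cfg D.cfg c .below else 0) = 0 := by
    intro p _ hp; split_ifs with h; exacts [hbelow (hp h), rfl]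
  rw [amp, indicate]
  generalize C.cfg (c + 1) = x at *
  generalize D.cfg (c + 1) = z at *
  obtain ⟨kC, nC⟩ := x
  obtain ⟨kD, nD⟩ := z
  -- The recursions for `col` and `fcol` decide, in each case, which of the states matches column
  -- `c`.
  cases kC <;> cases kD <;>
    simp only [cond_true, cond_false] at c1 c2 f1 f2 ⊢ <;>
    rcases nC with _ | nC <;> cases a <;>
    simp only [siteOp, StateAt, false_and, true_and, if_false, reduceCtorEq,
      mul_zero, add_zero, zero_add] at ha ⊢ <;>
    (try rw [hE _ (by simp only [StateAt]; omega)]) <;>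
    (try rw [hF _ (by simp only [StateAt]; omega)]) <;>
    (try rw [hT _ (by simp only [StateAt]; omega)]) <;>
    (try rw [hB _ (by omega)]) <;>
    split_ifs <;>
    first
    | (exfalso; simp only [ColumnOK] at *; omega)
    | ((try simp only [mul_zero, add_zero, zero_add])
       first
       | done
       | rw [show D.col c - C.col c = 0 by omega, pow_zero, one_mul]
       | rw [show D.col c - C.col c = 1 by omega, pow_one])

theorem amp_plain_below (x z : Config) (c : ℕ) : amp t false x z c .below = 0 := by
  induction c with
  | zero => simp [amp, bottomOp]
  | succ c ih => cases h : (x (c + 1)).1 <;> simp [amp, siteOp, ih, h]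

theorem amp_plain (c : ℕ) (a : Strand) (ha : StateAt C D c a) :
    amp t false C.cfg D.cfg c a =
      indicate (C.df = D.df ∧ ∀ v < c, ColumnOK C D v) (t ^ boxesBefore C D c) := by
  induction c generalizing a with
  | zero =>
    have h1 := C.df_eq_cfg
    have h2 := D.df_eq_cfg
    simp only [amp, boxesBefore, Finset.range_zero, Finset.sum_empty, pow_zero]
    generalize (C.cfg 0).1 = kC at *
    generalize (D.cfg 0).1 = kD at *
    cases kC <;> cases kD <;> cases a <;>
      simp [bottomOp, StateAt, indicate] at h1 h2 ha ⊢ <;> omega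
  | succ c ih =>
    rw [siteOp_amp_eq t C D false c _ (fun _ => amp_plain_below ..) ih a ha, boxesBefore_succ]
    rw [Nat.forall_lt_succ_right]
    by_cases h1 : ColumnOK C D c <;> by_cases h2 : C.df = D.df ∧ ∀ v < c, ColumnOK C D v
    · rw [indicate_pos h1, indicate_pos h2, indicate_pos ⟨h2.1, h2.2, h1⟩, pow_add, mul_comm]
    · rw [indicate_pos h1, indicate_neg h2, indicate_neg (fun h => h2 ⟨h.1, h.2.1⟩), mul_zero]
    · rw [indicate_neg h1, indicate_neg (fun h => h1 h.2.2)]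
    · rw [indicate_neg h1, indicate_neg (fun h => h1 h.2.2)]

/-- If the new circle has not been met and all remaining columns are nonempty in the strip, no place
is left for it. -/
theorem amp_barred_full (c : ℕ) (h : ∀ v ≤ c, C.col v < D.col v) (hc : D.col c = C.col c + 1) :
    amp t true C.cfg D.cfg c .full = 0 := by
  induction c with
  | zero => simp [amp, bottomOp]
  | succ c ih =>
    have c1 := C.col_eq_cfg c
    have c2 := D.col_eq_cfg c
    have hc' := h c (by omega)
    have hF : ∀ p : Prop, [Decidable p] → (p → D.col c = C.col c + 1) →
        (if p then amp t true C.cfg D.cfg c .full else 0) = 0 := by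
      intro p _ hp
      split_ifs with h1
      exacts [ih (fun v hv => h v (by omega)) (hp h1), rfl]
    rw [amp]
    generalize C.cfg (c + 1) = x at *
    generalize D.cfg (c + 1) = z at *
    obtain ⟨kC, nC⟩ := x
    obtain ⟨kD, nD⟩ := z
    cases kC <;> cases kD <;>
      simp only [cond_true, cond_false] at c1 c2 ⊢ <;>
      rcases nC with _ | nC <;>
      simp only [siteOp, false_and, true_and, if_false, reduceCtorEq, mul_zero, add_zero,
        zero_add] <;>
      (try rw [hF _ (by omega)]) <;>
      (try rw [if_neg (by omega)]) <;>
      simp only [mul_zero, add_zero]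

theorem SuperPartition.fcol_le_df (L : SuperPartition) (v : ℕ) : L.fcol v ≤ L.df :=
  List.countP_le_length

theorem SuperPartition.mem_iff_cfg (L : SuperPartition) (v : ℕ) :
    v ∈ L.a ↔ (L.cfg v).1 = true := by simp [cfg]

/-- To the left of the new circle every column is full and no circle changes its column. Each of the
columns `0, …, c - 1` gives a factor `t`, that of column `c` having been paid on entering it. Each
circle in a column `≤ c` gives `-1`, and there are `C.df - C.fcol c` of them. -/
theorem amp_barred_below (c : ℕ) (hc : D.col c = C.col c + 1) :
    amp t true C.cfg D.cfg c .below =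
      indicate (∀ v ≤ c, D.col v = C.col v + 1 ∧ (v ∈ C.a ↔ v ∈ D.a))
        (t ^ c * (-1) ^ (C.df - C.fcol c)) := by
  induction c with
  | zero =>
    have h1 := C.df_eq_cfg
    simp only [Nat.le_zero_eq, forall_eq, mem_iff_cfg, hc, true_and, amp, pow_zero, one_mul]
    generalize (C.cfg 0).1 = kC at *
    generalize (D.cfg 0).1 = kD at *
    cases kC <;> cases kD <;> simp [bottomOp, h1, indicate]
  | succ c ih =>
    have c1 := C.col_eq_cfg c
    have c2 := D.col_eq_cfg c
    have f1 := C.fcol_eq_cfg c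
    have f2 := C.fcol_le_df c
    have hx : (∀ v ≤ c + 1, D.col v = C.col v + 1 ∧ (v ∈ C.a ↔ v ∈ D.a)) ↔
        (∀ v ≤ c, D.col v = C.col v + 1 ∧ (v ∈ C.a ↔ v ∈ D.a)) ∧
          ((C.cfg (c + 1)).1 = true ↔ (D.cfg (c + 1)).1 = true) := by
      rw [← mem_iff_cfg, ← mem_iff_cfg]
      constructor
      · intro h
        exact ⟨fun v hv => h v (by omega), (h (c + 1) le_rfl).2⟩
      · rintro ⟨h1, h2⟩ v hv
        rcases Nat.lt_or_eq_of_le hv with hv | rfl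
        · exact h1 v (by omega)
        · exact ⟨hc, h2⟩
    rw [hx, amp]
    have hc' : D.col c = C.col c + 1 ∨
        ¬ ∀ v ≤ c, D.col v = C.col v + 1 ∧ (v ∈ C.a ↔ v ∈ D.a) := by
      by_cases h : D.col c = C.col c + 1
      · exact Or.inl h
      · exact Or.inr fun h' => h (h' c le_rfl).1
    generalize (∀ v ≤ c, D.col v = C.col v + 1 ∧ (v ∈ C.a ↔ v ∈ D.a)) = P at *
    generalize C.cfg (c + 1) = x at *
    generalize D.cfg (c + 1) = z at *
    obtain ⟨kC, nC⟩ := x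
    obtain ⟨kD, nD⟩ := z
    cases kC <;> cases kD <;>
      simp only [cond_true, cond_false] at c1 c2 f1 ⊢ <;>
      simp only [siteOp, false_and, true_and, if_false, reduceCtorEq, mul_zero, neg_zero,
        iff_false, iff_true, and_false, and_true, not_true]
    · split_ifs with h1
      · rw [ih (by omega), f1, add_zero]
        unfold indicate
        split_ifs <;> ring
      · rw [indicate_neg (hc'.resolve_left (by omega)), mul_zero]
    · rw [indicate_neg not_false]
    · rw [indicate_neg not_false]
    · split_ifs with h1
      · rw [ih (by omega), show C.df - C.fcol (c + 1) = C.df - C.fcol c + 1 by omega]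
        unfold indicate
        split_ifs <;> ring
      · rw [indicate_neg (hc'.resolve_left (by omega)), mul_zero, neg_zero]

/-- The new circle of the step `D / C` is in column `g`, the leftmost empty one, and the circles to
the left of it do not move. -/
def IsNewCircleColumn (g : ℕ) : Prop :=
  C.fcol g = D.fcol g ∧ g ∉ C.a ∧ g ∈ D.a ∧
    ∀ v < g, D.col v = C.col v + 1 ∧ (v ∈ C.a ↔ v ∈ D.a)

/-- At the leftmost empty column the new circle must be created: continuing with `full` gives zero
by `amp_barred_full`, and `below` is evaluated by `amp_barred_below`. A circle in transit cannot be
accommodated here. -/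
theorem amp_barred_gap (g : ℕ) (hg : D.col g ≤ C.col g) (hg' : ∀ v < g, C.col v < D.col v)
    (a : Strand) (ha : StateAt C D g a) :
    amp t true C.cfg D.cfg g a =
      indicate (IsNewCircleColumn C D g) (t ^ g * (-1) ^ (C.df - C.fcol g)) := by
  unfold IsNewCircleColumn
  rcases g with _ | c
  · have h1 := C.df_eq_cfg
    simp only [amp, mem_iff_cfg, pow_zero, one_mul]
    generalize (C.cfg 0).1 = kC at *
    generalize (D.cfg 0).1 = kD at *
    cases kC <;> cases kD <;> cases a <;>
      simp [bottomOp, StateAt, indicate] at h1 ha ⊢ <;> first | omega | simp [h1, ha] 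
  · have c1 := C.col_eq_cfg c
    have c2 := D.col_eq_cfg c
    have f1 := C.fcol_eq_cfg c
    have hc := hg' c (by omega)
    have hF : ∀ p : Prop, [Decidable p] → (p → D.col c = C.col c + 1) →
        (if p then amp t true C.cfg D.cfg c .full else 0) = 0 := by
      intro p _ hp
      split_ifs with h1
      exacts [amp_barred_full t C D c (fun v hv => hg' v (by omega)) (hp h1), rfl]
    have hB := amp_barred_below t C D c
    have hc' : D.col c = C.col c + 1 ∨
        ¬ ∀ v ≤ c, D.col v = C.col v + 1 ∧ (v ∈ C.a ↔ v ∈ D.a) := by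
      by_cases h : D.col c = C.col c + 1
      · exact Or.inl h
      · exact Or.inr fun h' => h (h' c le_rfl).1
    simp only [Nat.lt_succ_iff, mem_iff_cfg C (c + 1), mem_iff_cfg D (c + 1)]
    rw [amp]
    generalize (∀ v ≤ c, D.col v = C.col v + 1 ∧ (v ∈ C.a ↔ v ∈ D.a)) = P at *
    generalize C.cfg (c + 1) = x at *
    generalize D.cfg (c + 1) = z at *
    obtain ⟨kC, nC⟩ := x
    obtain ⟨kD, nD⟩ := z
    cases kC <;> cases kD <;>
      simp only [cond_true, cond_false] at c1 c2 f1 ⊢ <;>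
      rcases nC with _ | nC <;> cases a <;>
      simp only [siteOp, StateAt, false_and, true_and, if_false, reduceCtorEq, mul_zero, add_zero,
        zero_add, and_false, not_true, not_false_iff] at ha ⊢ <;>
      (try rw [hF _ (by omega)]) <;>
      (try (exfalso; omega)) <;>
      (try simp only [mul_zero, add_zero]) <;>
      (try rw [if_neg (by omega)]) <;>
      (try rw [indicate_neg (by tauto)]) <;>
      (try rw [indicate_neg (by omega)])
    all_goals
      rw [and_iff_right ha.2]
      split_ifs with h1
      · rw [hB (by omega), f1, add_zero]
        unfold indicate
        split_ifs <;> ring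
      · rw [indicate_neg (hc'.resolve_left (by omega)), mul_zero]

/-- To the right of the gap `g` the new circle cannot have been created yet, since `below` would
require column `g` to be full. So the columns from `g` on behave as in a plain step. -/
theorem amp_barred (g : ℕ) (hg : D.col g ≤ C.col g) (hg' : ∀ v < g, C.col v < D.col v) (c : ℕ)
    (hc : g ≤ c) (a : Strand) (ha : StateAt C D c a) :
    amp t true C.cfg D.cfg c a =
      indicate (IsNewCircleColumn C D g ∧ ∀ v, g ≤ v → v < c → ColumnOK C D v)
        (t ^ boxesBefore C D c * (-1) ^ (C.df - C.fcol g)) := by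
  induction c, hc using Nat.le_induction generalizing a with
  | base =>
    rw [amp_barred_gap t C D g hg hg' a ha]
    have h : (∀ v, g ≤ v → v < g → ColumnOK C D v) ↔ True :=
      iff_true_intro fun v h1 h2 => absurd h1 (not_le.2 h2)
    rw [h, and_true]
    by_cases h2 : IsNewCircleColumn C D g
    · have : boxesBefore C D g = ∑ v ∈ Finset.range g, 1 :=
        Finset.sum_congr rfl fun v hv => by
          rw [(h2.2.2.2 v (Finset.mem_range.1 hv)).1, Nat.add_sub_cancel_left]
      rw [this]
      simp
    · rw [indicate_neg h2, indicate_neg h2]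
  | succ c hgc ih =>
    have hb : D.col c = C.col c + 1 → amp t true C.cfg D.cfg c .below = 0 := by
      intro h1
      rw [amp_barred_below t C D c h1, indicate_neg]
      intro h
      have := (h g hgc).1
      omega
    rw [siteOp_amp_eq t C D true c _ hb ih a ha, boxesBefore_succ]
    have hx : (∀ v, g ≤ v → v < c + 1 → ColumnOK C D v) ↔
        (∀ v, g ≤ v → v < c → ColumnOK C D v) ∧ ColumnOK C D c := by
      constructor
      · intro h
        exact ⟨fun v h1 h2 => h v h1 (by omega), h c hgc (by omega)⟩
      · rintro ⟨h1, h2⟩ v h3 h4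
        rcases Nat.lt_or_eq_of_le (Nat.lt_succ_iff.1 h4) with h5 | rfl
        exacts [h1 v h3 h5, h2]
    rw [hx]
    by_cases h1 : ColumnOK C D c <;>
      by_cases h2 : IsNewCircleColumn C D g ∧ ∀ v, g ≤ v → v < c → ColumnOK C D v
    · rw [indicate_pos h1, indicate_pos h2, indicate_pos ⟨h2.1, h2.2, h1⟩, pow_add]
      ring
    · rw [indicate_pos h1, indicate_neg h2, indicate_neg (fun h => h2 ⟨h.1, h.2.1⟩), mul_zero]
    · rw [indicate_neg h1, indicate_neg (fun h => h1 h.2.2)]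
    · rw [indicate_neg h1, indicate_neg (fun h => h1 h.2.2)]

end Evaluation

end SuperNC

/-! ### The amplitude of a step is its signed indicator -/

namespace SuperNC

open SuperPartition

/-- A number or barred number. -/
def SuperWeight.ofBarred (β : Bool) (k : ℕ) : SuperWeight := bif β then .barred k else .plain k

/-- The coefficient of `D` after a step of weight `w` from `C`: the sign of moving the new circle
to the right end of the word of circle labels. -/
noncomputable def stepCoeff (C : SuperPartition) (w : SuperWeight) (D : SuperPartition) : ℤ :=
  indicate (IsStep C w D) (match w with
    | .plain _ => 1
    | .barred _ => (-1) ^ (C.df - newIdx C D))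

section

variable {C D : SuperPartition} {M : ℕ}

theorem col_eq_zero_of_le {L : SuperPartition} (h : ∀ x ∈ L.a ++ L.s, x ≤ M) {v : ℕ} (hv : M ≤ v) :
    L.col v = 0 :=
  L.col_eq_zero fun x hx => (h x hx).trans hv

theorem fcol_eq_zero_of_le {L : SuperPartition} (h : ∀ x ∈ L.a ++ L.s, x ≤ M) {v : ℕ}
    (hv : M ≤ v) : L.fcol v = 0 :=
  L.fcol_eq_zero fun x hx => (h x hx).trans hv

theorem columnOK_of_le (hC : ∀ x ∈ C.a ++ C.s, x ≤ M) (hD : ∀ x ∈ D.a ++ D.s, x ≤ M) {v : ℕ}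
    (hv : M ≤ v) : ColumnOK C D v := by
  unfold ColumnOK
  rw [col_eq_zero_of_le hC hv, col_eq_zero_of_le hD hv, fcol_eq_zero_of_le hC hv,
    fcol_eq_zero_of_le hD hv]
  simp

theorem IsStrip.deg_eq (h : IsStrip C D) (hC : ∀ x ∈ C.a ++ C.s, x ≤ M)
    (hD : ∀ x ∈ D.a ++ D.s, x ≤ M) : D.deg = C.deg + boxesBefore C D M := by
  rw [C.deg_eq_sum hC, D.deg_eq_sum hD, boxesBefore, ← Finset.sum_add_distrib]
  exact Finset.sum_congr rfl fun v _ => by have := h v; omega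

/-- The columns from `M` on are empty in both diagrams, so the step enters in the state `empty`.
`map_eq_map_iff` identifies the local conditions with the rule for the circles. -/
theorem amp_plain_cfg {K : Type*} [CommRing K] (t : K) (hC : ∀ x ∈ C.a ++ C.s, x ≤ M)
    (hD : ∀ x ∈ D.a ++ D.s, x ≤ M) : amp t false C.cfg D.cfg M .empty =
      t ^ (D.deg - C.deg) * (stepCoeff C (.plain (D.deg - C.deg)) D : K) := by
  rw [amp_plain]
  swap
  · simp [StateAt, col_eq_zero_of_le hC le_rfl, col_eq_zero_of_le hD le_rfl,
      fcol_eq_zero_of_le hC le_rfl, fcol_eq_zero_of_le hD le_rfl]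
  have hstep : (C.df = D.df ∧ ∀ v < M, ColumnOK C D v) ↔
      IsStep C (.plain (D.deg - C.deg)) D := by
    rw [isStep_plain_iff, map_eq_map_iff C.a_sorted D.a_sorted D.col_anti
      fun w hw v hv => D.col_strictAntiOn hw hv]
    constructor
    · rintro ⟨h1, h2⟩
      have h3 : ∀ v, ColumnOK C D v := fun v =>
        (lt_or_ge v M).elim (h2 v) (columnOK_of_le hC hD)
      have h4 : IsStrip C D := fun v => (h3 v).1
      exact ⟨h4, by have := h4.deg_eq hC hD; omega, h1, fun v => (h3 v).2⟩
    · rintro ⟨h1, _, h2, h3⟩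
      exact ⟨h2, fun v _ => ⟨h1 v, h3 v⟩⟩
  rw [hstep, stepCoeff]
  by_cases h : IsStep C (.plain (D.deg - C.deg)) D
  · have h1 := ((isStep_plain_iff ..).1 h).1.deg_eq hC hD
    rw [indicate_pos h, indicate_pos h, h1]
    simp
  · rw [indicate_neg h, indicate_neg h]
    simp

theorem idxOf_eq_countP {l : List ℕ} (hl : l.Pairwise (· > ·)) {v : ℕ} (hv : v ∈ l) :
    l.idxOf v = l.countP (v < ·) := by
  induction l with
  | nil => simp at hv
  | cons x l ih =>
    rw [List.pairwise_cons] at hl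
    rw [List.countP_cons]
    by_cases h : x = v
    · subst h
      have : l.countP (x < ·) = 0 := by
        rw [List.countP_eq_zero]
        intro y hy
        have := hl.1 y hy
        simp; omega
      simp [this]
    · have hv' : v ∈ l := (List.mem_cons.1 hv).resolve_left (Ne.symm h)
      have := hl.1 v hv'
      rw [List.idxOf_cons_ne l h, ih hl.2 hv', if_pos (by simpa using this)]

theorem fcol_eq_of_below {a d : List ℕ} (ha : a.Nodup) (hd : d.Nodup) {g : ℕ}
    (hg : a.countP (g < ·) = d.countP (g < ·)) (h : ∀ v ≤ g, v ∈ a ↔ v ∈ d) (v : ℕ) (hv : v ≤ g) :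
    a.countP (v < ·) = d.countP (v < ·) := by
  induction hv using Nat.decreasingInduction with
  | self => exact hg
  | of_succ v hv ih =>
    rw [countP_lt_succ ha, countP_lt_succ hd, ih, if_congr (h (v + 1) (by omega)) rfl rfl]

theorem countP_erase_eq {l : List ℕ} (g v : ℕ) (hg : g ∈ l) :
    l.countP (v < ·) = (l.erase g).countP (v < ·) + if v < g then 1 else 0 := by
  rw [(List.perm_cons_erase hg).countP_eq, List.countP_cons]
  simp

/-- To the left of the gap all columns grow by one, so `D` keeps the descents of `C` and a circle of
`C` there cannot leave its column. To the right of the gap, erasing `g` does not change the counts,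
and the rule is that of a plain step. -/
theorem newCircleColumn_iff (hstrip : IsStrip C D) {g : ℕ} (hg : IsFirstGap C D g) :
    (IsNewCircleColumn C D g ∧ ∀ v, g ≤ v → ColumnOK C D v) ↔
      g ∈ D.a ∧ (D.a.erase g).map D.col = C.a.map D.col := by
  have hnd : (D.a.erase g).Nodup := D.a_nodup.erase g
  have herase : ∀ v, v ∈ D.a.erase g ↔ v ≠ g ∧ v ∈ D.a := fun v => D.a_nodup.mem_erase_iff
  have hmem : ∀ w ∈ D.a.erase g, ∀ v < w, D.col w < D.col v := fun w hw v hv =>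
    D.col_strictAntiOn ((herase w).1 hw).2 hv
  have hsort : (D.a.erase g).Pairwise (· > ·) := D.a_sorted.sublist List.erase_sublist
  constructor
  · rintro ⟨⟨h1, h2, h3, h4⟩, h5⟩
    refine ⟨h3, ?_⟩
    have hc := fun v => countP_erase_eq (l := D.a) g v h3
    have hge : ∀ v, g ≤ v → D.fcol v = (D.a.erase g).countP (v < ·) := by
      intro v hv
      rw [fcol, hc, if_neg (by omega), add_zero]
    have hiff : ∀ v ≤ g, v ∈ C.a ↔ v ∈ D.a.erase g := by
      intro v hv
      rw [herase]
      rcases Nat.lt_or_eq_of_le hv with hv | rfl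
      · rw [(h4 v hv).2, and_iff_right (by omega)]
      · simp [h2]
    have hle := fcol_eq_of_below C.a_nodup hnd (h1.trans (hge g le_rfl)) hiff
    rw [map_eq_map_iff C.a_sorted hsort D.col_anti hmem]
    refine ⟨?_, fun v => ?_⟩
    · rw [length_eq_countP C.a_nodup, length_eq_countP hnd, hle 0 (by omega),
        if_congr (hiff 0 (by omega)) rfl rfl]
    · rcases le_or_gt v g with hv | hv
      · exact Or.inl (hle v hv)
      · rw [← hge v hv.le]
        exact (h5 v hv.le).2
  · rintro ⟨h3, h⟩
    have hc := fun v => countP_erase_eq (l := D.a) g v h3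
    have hge : ∀ v, g ≤ v → D.fcol v = (D.a.erase g).countP (v < ·) := by
      intro v hv
      rw [fcol, hc, if_neg (by omega), add_zero]
    rw [map_eq_map_iff C.a_sorted hsort D.col_anti hmem] at h
    obtain ⟨hlen, h⟩ := h
    have hdD : ∀ v, v + 1 ∈ D.a → D.col (v + 1) < D.col v := fun v hv =>
      D.col_strictAntiOn hv (by omega)
    have hdC : ∀ v, v + 1 ∈ C.a → C.col (v + 1) < C.col v := fun v hv =>
      C.col_strictAntiOn hv (by omega)
    have sC := fun v => countP_lt_succ C.a_nodup v
    have sD := fun v => countP_lt_succ hnd v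
    have zC := length_eq_countP C.a_nodup
    have zD := length_eq_countP hnd
    have hgg : g ∉ D.a.erase g := fun h => ((herase g).1 h).1 rfl
    -- Since `g` is a component of `D`, the height drops between the columns `g - 1` and `g`, so no
    -- old circle moves past `g`. For `g = 0` the equality of the lengths takes over this role.
    have hat : C.a.countP (g < ·) = (D.a.erase g).countP (g < ·) ∧ g ∉ C.a := by
      rcases g with _ | c
      · rw [if_neg hgg] at zD
        have h0 := h 0
        split_ifs at zC with h0'
        · omega
        · exact ⟨by omega, h0'⟩
      · have h1 := h c
        have h2 := hdD c h3
        have h3 := h (c + 1)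
        have h4 := sC c
        have h5 := sD c
        rw [if_neg hgg] at h5
        split_ifs at h4 with h6
        · omega
        · exact ⟨by omega, h6⟩
    have hbelow : ∀ v, v ≤ g → C.a.countP (v < ·) = (D.a.erase g).countP (v < ·) ∧
        (∀ u, v < u → u < g → (u ∈ C.a ↔ u ∈ D.a.erase g)) := by
      intro v hv
      induction hv using Nat.decreasingInduction with
      | self => exact ⟨hat.1, fun u h1 h2 => absurd h1 (by omega)⟩
      | of_succ v hv ih =>
        have h1 := h v
        have h4 := sC v
        have h5 := sD v
        have hkey : (v + 1 ∈ C.a ↔ v + 1 ∈ D.a.erase g) := by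
          by_cases h6 : v + 1 ∈ C.a <;> by_cases h7 : v + 1 ∈ D.a.erase g
          · simp [h6, h7]
          -- A circle leaving column `v + 1` would need `D.col v = D.col (v + 1)`. Both columns gain
          -- one box, however, and `C` has a descent there.
          · exfalso
            rw [if_pos h6] at h4
            rw [if_neg h7] at h5
            have h8 := hdC v h6
            have h9 := hg.2 v (by omega)
            have h10 := hstrip (v + 1)
            have h11 : v + 1 ≠ g := fun h => hat.2 (h ▸ h6)
            have h12 := hg.2 (v + 1) (by omega)
            omega
          · exfalso
            rw [if_neg h6] at h4
            rw [if_pos h7] at h5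
            omega
          · simp [h6, h7]
        rw [if_congr hkey rfl rfl] at h4
        refine ⟨by omega, fun u h8 h9 => ?_⟩
        rcases Nat.lt_or_eq_of_le (Nat.succ_le_of_lt h8) with h10 | rfl
        · exact ih.2 u h10 h9
        · exact hkey
    have hmemlt : ∀ v < g, v ∈ C.a ↔ v ∈ D.a := by
      intro v hv
      have h1 : v ∈ C.a ↔ v ∈ D.a.erase g := by
        rcases v with _ | v
        · have h2 := (hbelow 0 (by omega)).1
          by_cases h6 : 0 ∈ C.a <;> by_cases h7 : 0 ∈ D.a.erase g <;>
            simp only [h6, h7, if_true, if_false] at zC zD ⊢ <;> omega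
        · exact (hbelow v (by omega)).2 (v + 1) (by omega) hv
      rw [h1, herase, and_iff_right (by omega)]
    refine ⟨⟨by rw [hge g le_rfl]; exact hat.1, hat.2, h3, fun v hv => ⟨hg.2 v hv, hmemlt v hv⟩⟩,
      fun v hv => ⟨hstrip v, ?_⟩⟩
    rw [hge v hv]
    exact h v

theorem exists_firstGap (hC : ∀ x ∈ C.a ++ C.s, x ≤ M) (hD : ∀ x ∈ D.a ++ D.s, x ≤ M) :
    ∃ g ≤ M, D.col g ≤ C.col g ∧ ∀ v < g, C.col v < D.col v := by
  classical
  have h : ∃ g, D.col g ≤ C.col g := ⟨M, by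
    rw [col_eq_zero_of_le hC le_rfl, col_eq_zero_of_le hD le_rfl]⟩
  refine ⟨Nat.find h, Nat.find_le ?_, Nat.find_spec h, fun v hv => ?_⟩
  · rw [col_eq_zero_of_le hC le_rfl, col_eq_zero_of_le hD le_rfl]
  · exact not_le.1 (Nat.find_min h hv)

theorem amp_barred_cfg {K : Type*} [CommRing K] (t : K) (hC : ∀ x ∈ C.a ++ C.s, x ≤ M)
    (hD : ∀ x ∈ D.a ++ D.s, x ≤ M) : amp t true C.cfg D.cfg M .empty =
      t ^ (D.deg - C.deg) * (stepCoeff C (.barred (D.deg - C.deg)) D : K) := by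
  obtain ⟨g, hgM, hg, hg'⟩ := exists_firstGap hC hD
  rw [amp_barred t C D g hg hg' M hgM]
  swap
  · simp [StateAt, col_eq_zero_of_le hC le_rfl, col_eq_zero_of_le hD le_rfl,
      fcol_eq_zero_of_le hC le_rfl, fcol_eq_zero_of_le hD le_rfl]
  have hfirst : IsStrip C D → IsFirstGap C D g := fun h =>
    ⟨by have := h g; omega, fun v hv => by have := h v; have := hg' v hv; omega⟩
  have hext : (∀ v, g ≤ v → v < M → ColumnOK C D v) ↔ ∀ v, g ≤ v → ColumnOK C D v :=
    ⟨fun h v h1 => (lt_or_ge v M).elim (h v h1) (columnOK_of_le hC hD), fun h v h1 _ => h v h1⟩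
  have hstrip : (IsNewCircleColumn C D g ∧ ∀ v, g ≤ v → ColumnOK C D v) → IsStrip C D := by
    rintro ⟨h1, h2⟩ v
    rcases lt_or_ge v g with hv | hv
    · have := (h1.2.2.2 v hv).1
      omega
    · exact (h2 v hv).1
  have hstep : (IsNewCircleColumn C D g ∧ ∀ v, g ≤ v → v < M → ColumnOK C D v) ↔
      IsStep C (.barred (D.deg - C.deg)) D := by
    rw [hext, isStep_barred_iff]
    constructor
    · intro h
      have hs := hstrip h
      have h1 := (newCircleColumn_iff hs (hfirst hs)).1 h
      exact ⟨hs, by have := hs.deg_eq hC hD; omega, g, h1.1, hfirst hs, h1.2⟩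
    · rintro ⟨hs, _, v, hv, hv', h⟩
      obtain rfl := hv'.unique (hfirst hs)
      exact (newCircleColumn_iff hs hv').2 ⟨hv, h⟩
  by_cases h : IsStep C (.barred (D.deg - C.deg)) D
  · have h1 := hstep.2 h
    rw [indicate_pos h1, stepCoeff, indicate_pos h]
    rw [hext] at h1
    have hs := hstrip h1
    -- The index of the new circle is `D.fcol g`, which equals `C.fcol g`, so the sign of the model
    -- is the sign in `stepCoeff`.
    rw [hs.deg_eq hC hD, newIdx_eq hs h1.1.2.2.1 (hfirst hs),
      idxOf_eq_countP D.a_sorted h1.1.2.2.1, Nat.add_sub_cancel_left, h1.1.1]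
    simp [fcol]
  · rw [indicate_neg (hstep.not.2 h), stepCoeff, indicate_neg h]
    simp

theorem amplitude_cfg {K : Type*} [CommRing K] (t : K) (β : Bool) (hC : ∀ x ∈ C.a ++ C.s, x ≤ M)
    (hD : ∀ x ∈ D.a ++ D.s, x ≤ M) : amplitude t β M C.cfg D.cfg .empty =
      t ^ (D.deg - C.deg) * (stepCoeff C (.ofBarred β (D.deg - C.deg)) D : K) := by
  rw [amplitude_eq_amp t β C.cfg D.cfg D.cfg M .empty D.cfg_zero_snd (fun _ _ => rfl)
    (D.cfg_eq_of_gt hD)]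
  cases β
  exacts [amp_plain_cfg t hC hD, amp_barred_cfg t hC hD]

end

end SuperNC

/-! ### Symmetry of the signed number of tableaux in the weight -/

namespace SuperNC

open SuperPartition

theorem mem_sPar {n m : ℕ} {L : SuperPartition} : L ∈ sPar n m ↔ L.deg = n ∧ L.df = m := by
  simp [sPar]

open Classical in
/-- The superpartitions whose degree and fermionic degree are at most those of `L`. -/
noncomputable def below (L : SuperPartition) : Finset SuperPartition :=
  (Finset.range (L.deg + 1) ×ˢ Finset.range (L.df + 1)).biUnion fun p => sPar p.1 p.2

theorem mem_below {C L : SuperPartition} : C ∈ below L ↔ C.deg ≤ L.deg ∧ C.df ≤ L.df := by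
  simp [below, mem_sPar]

theorem IsStep.deg_eq {C D : SuperPartition} {w : SuperWeight} (h : IsStep C w D) :
    D.deg = C.deg + w.abs := h.1.deg_eq

theorem IsStep.mem_below {C D : SuperPartition} {w : SuperWeight} (h : IsStep C w D) :
    C ∈ below D := by
  rw [SuperNC.mem_below]
  refine ⟨by have := h.deg_eq; omega, ?_⟩
  have := h.2
  cases w <;> simp only at this <;> omega

theorem stepCoeff_ne_zero {C D : SuperPartition} {w : SuperWeight} (h : stepCoeff C w D ≠ 0) :
    IsStep C w D := by
  by_contra h'
  exact h (indicate_neg h' _)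

theorem le_deg {L : SuperPartition} {x : ℕ} (hx : x ∈ L.a ++ L.s) : x ≤ L.deg := by
  rw [deg, ← List.sum_append]
  exact List.le_sum_of_mem hx

theorem le_of_cfg {L : SuperPartition} {M : ℕ} (h : ∀ i > M, L.cfg i = (false, 0)) :
    ∀ x ∈ L.a ++ L.s, x ≤ M := by
  intro x hx
  by_contra! hM
  have h1 := h x hM
  simp only [cfg, Prod.mk.injEq, decide_eq_false_iff_not, List.count_eq_zero] at h1
  exact (List.mem_append.1 hx).elim h1.1 h1.2

theorem abs_ofBarred (β : Bool) (k : ℕ) : (SuperWeight.ofBarred β k).abs = k := by cases β <;> rfl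

theorem transfer₂_cfg {K : Type*} [CommRing K] (s t : K) (β₁ β₂ : Bool) (C E : SuperPartition)
    {M : ℕ} (hC : ∀ x ∈ C.a ++ C.s, x ≤ M) (hE : E.deg ≤ M) :
    transfer₂ s t β₁ β₂ M C.cfg (open Classical in fun y => if y = E.cfg then 1 else 0)
      .empty .empty = ∑ D ∈ below E,
        (s ^ (D.deg - C.deg) * (stepCoeff C (.ofBarred β₁ (D.deg - C.deg)) D : K)) *
          (t ^ (E.deg - D.deg) * (stepCoeff D (.ofBarred β₂ (E.deg - D.deg)) E : K)) := by
  have hE' : ∀ x ∈ E.a ++ E.s, x ≤ M := fun x hx => (le_deg hx).trans hE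
  rw [transfer₂, transfer_eq_sum (below E) cfg cfg_injective]
  · refine Finset.sum_congr rfl fun D hD => ?_
    rw [mem_below] at hD
    have hD' : ∀ x ∈ D.a ++ D.s, x ≤ M := fun x hx => (le_deg hx).trans (hD.1.trans hE)
    rw [amplitude_cfg s β₁ hC hD', ← amplitude_cfg t β₂ hD' hE']
    rfl
  · intro y h0 hy hne
    obtain ⟨D, rfl⟩ := exists_cfg_eq y h0 hy
    refine ⟨D, ?_, rfl⟩
    have hD' := le_of_cfg hy
    have h1 := right_ne_zero_of_mul hne
    change amplitude t β₂ M D.cfg E.cfg .empty ≠ 0 at h1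
    rw [amplitude_cfg t β₂ hD' hE'] at h1
    refine (stepCoeff_ne_zero (w := .ofBarred β₂ (E.deg - D.deg)) fun h => ?_).mem_below
    rw [h] at h1
    simp at h1

/-- The commutation of the transfers, with the sizes of the steps separated: one parameter is a
polynomial variable and the total number of boxes is determined by `C` and `E`. -/
theorem sum_stepCoeff_comm (β₁ β₂ : Bool) (k₁ k₂ : ℕ) (C E : SuperPartition) :
    ∑ D ∈ below E, stepCoeff C (.ofBarred β₁ k₁) D * stepCoeff D (.ofBarred β₂ k₂) E =
      (bif β₁ && β₂ then -1 else 1) *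
        ∑ D ∈ below E, stepCoeff C (.ofBarred β₂ k₂) D * stepCoeff D (.ofBarred β₁ k₁) E := by
  by_cases hdeg : E.deg = C.deg + (k₁ + k₂)
  swap
  · have hz : ∀ (β₁ β₂ : Bool) (k k' : ℕ), k + k' = k₁ + k₂ → ∀ D,
        stepCoeff C (.ofBarred β₁ k) D * stepCoeff D (.ofBarred β₂ k') E = 0 := by
      intro β₁ β₂ k k' hk D
      by_contra h
      have h1 := (stepCoeff_ne_zero (left_ne_zero_of_mul h)).deg_eq
      have h2 := (stepCoeff_ne_zero (right_ne_zero_of_mul h)).deg_eq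
      rw [abs_ofBarred] at h1 h2
      omega
    rw [Finset.sum_eq_zero fun D _ => hz β₁ β₂ k₁ k₂ rfl D,
      Finset.sum_eq_zero fun D _ => hz β₂ β₁ k₂ k₁ (add_comm _ _) D, mul_zero]
  have hC : ∀ x ∈ C.a ++ C.s, x ≤ C.deg + E.deg := fun x hx => (le_deg hx).trans (by omega)
  -- The parameters are `s = 1` and `t = X`, so the exponent of `X` is the size of the step of type
  -- `β₂`, which comes second on the left and first on the right.
  have h := transfer₂_comm (1 : Polynomial ℤ) Polynomial.X
    (IsRegular.of_ne_zero Polynomial.X_ne_zero).left β₁ β₂ (C.deg + E.deg) C.cfg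
    (open Classical in fun y => if y = E.cfg then 1 else 0)
  rw [transfer₂_cfg _ _ _ _ C E hC (by omega), transfer₂_cfg _ _ _ _ C E hC (by omega)] at h
  have hsign : (bif β₁ && β₂ then -1 else 1 : Polynomial ℤ) =
      Polynomial.C (bif β₁ && β₂ then -1 else 1) := by
    cases β₁ && β₂ <;> simp
  rw [hsign] at h
  have h' := congrArg (fun p => Polynomial.coeff p k₂) h
  simp only [one_pow, one_mul, Polynomial.coeff_C_mul, Polynomial.finsetSum_coeff] at h'
  have coeff1 : ∀ (a b : ℤ) (e : ℕ),
      ((a : Polynomial ℤ) * (Polynomial.X ^ e * (b : Polynomial ℤ))).coeff k₂ = if k₂ = e then a * b else 0 := by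
    intro a b e
    rw [← Polynomial.coeff_C_mul_X_pow]
    congr 1
    simp only [← Polynomial.C_eq_intCast, map_mul, Int.cast_id]
    ring
  have coeff2 : ∀ (a b : ℤ) (e : ℕ),
      ((Polynomial.X ^ e * (a : Polynomial ℤ)) * (b : Polynomial ℤ)).coeff k₂ = if k₂ = e then a * b else 0 := by
    intro a b e
    rw [← coeff1]
    congr 1
    ring
  simp only [coeff1, coeff2] at h'
  convert h' using 1
  · refine Finset.sum_congr rfl fun D hD => ?_
    rw [mem_below] at hD
    split_ifs with he
    · rw [← he, show D.deg - C.deg = k₁ by omega]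
    · by_contra hne
      have := (stepCoeff_ne_zero (right_ne_zero_of_mul hne)).deg_eq
      rw [abs_ofBarred] at this
      omega
  · congr 1
    refine Finset.sum_congr rfl fun D hD => ?_
    rw [mem_below] at hD
    by_cases hs : IsStep C (.ofBarred β₂ k₂) D
    · have := hs.deg_eq
      rw [abs_ofBarred] at this
      rw [show D.deg - C.deg = k₂ by omega, show E.deg - D.deg = k₁ by omega, if_pos rfl]
    · have h0 : stepCoeff C (.ofBarred β₂ k₂) D = 0 := indicate_neg hs _
      split_ifs with he
      · rw [← he]
        simp [h0]
      · simp [h0]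

/-- Whether a weight is barred. -/
def SuperWeight.isBarred : SuperWeight → Bool
  | .plain _ => false
  | .barred _ => true

theorem SuperWeight.ofBarred_abs (w : SuperWeight) : .ofBarred w.isBarred w.abs = w := by
  cases w <;> rfl

/-- The signed number of tableaux of shape `L`, where the list holds the weights, last one
first. -/
noncomputable def tabSum : List SuperWeight → SuperPartition → ℤ
  | [], L => indicate (L = SuperPartition.empty) 1
  | w :: l, L => ∑ C ∈ below L, stepCoeff C w L * tabSum l C

theorem below_mono {D E : SuperPartition} (h : D ∈ below E) : below D ⊆ below E := by
  intro C hC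
  rw [mem_below] at *
  omega

theorem tabSum_swap_head (v w : SuperWeight) (l : List SuperWeight) (L : SuperPartition) :
    tabSum (v :: w :: l) L =
      (bif v.isBarred && w.isBarred then -1 else 1) * tabSum (w :: v :: l) L := by
  have key : ∀ v w : SuperWeight, tabSum (v :: w :: l) L =
      ∑ C ∈ below L, (∑ D ∈ below L, stepCoeff C w D * stepCoeff D v L) * tabSum l C := by
    intro v w
    simp only [tabSum, Finset.sum_mul]
    rw [Finset.sum_comm]
    refine Finset.sum_congr rfl fun D hD => ?_
    -- The inner range is enlarged from `below D` to `below L`, to make it independent of `D` before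
    -- the two sums are exchanged.
    rw [Finset.mul_sum, Finset.sum_subset (below_mono hD)]
    · exact Finset.sum_congr rfl fun C _ => by ring
    · intro C _ hC
      have : stepCoeff C w D = 0 := indicate_neg (fun h => hC h.mem_below) _
      rw [this, zero_mul, mul_zero]
  rw [key, key, Finset.mul_sum]
  refine Finset.sum_congr rfl fun C _ => ?_
  rw [← mul_assoc]
  congr 1
  have := sum_stepCoeff_comm w.isBarred v.isBarred w.abs v.abs C L
  rw [w.ofBarred_abs, v.ofBarred_abs] at this
  rw [this, Bool.and_comm]

theorem tabSum_swap (p : List SuperWeight) (v w : SuperWeight) (l : List SuperWeight)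
    (L : SuperPartition) :
    tabSum (p ++ v :: w :: l) L =
      (bif v.isBarred && w.isBarred then -1 else 1) * tabSum (p ++ w :: v :: l) L := by
  induction p generalizing L with
  | nil => exact tabSum_swap_head v w l L
  | cons u p ih =>
    simp only [List.cons_append, tabSum, ih, Finset.mul_sum]
    exact Finset.sum_congr rfl fun C _ => by ring

/-! ### Inversions -/

theorem inv_nil : inv [] = 0 := by
  simp [inv]

theorem inv_cons (x : ℕ) (l : List ℕ) : inv (x :: l) = l.countP (· < x) + inv l := by
  unfold inv
  simp only [Finset.card_filter, Fintype.sum_prod_type]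
  change (∑ i : Fin (l.length + 1), ∑ j : Fin (l.length + 1), _) = _
  rw [Fin.sum_univ_succ]
  congr 1
  · rw [Fin.sum_univ_succ]
    simp only [lt_irrefl, false_and, if_false, zero_add, Fin.succ_pos, true_and]
    change ∑ j : Fin l.length, (if l.get j < x then 1 else 0) = _
    refine (Fin.sum_univ_fun_getElem l fun y => if y < x then 1 else 0).trans ?_
    induction l with
    | nil => rfl
    | cons y l ih => simp [List.countP_cons, ih, add_comm]
  · refine Finset.sum_congr rfl fun i _ => ?_
    rw [Fin.sum_univ_succ]
    simp only [Fin.not_lt_zero, false_and, if_false, zero_add, Fin.succ_lt_succ_iff]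
    rfl

theorem inv_append (p q : List ℕ) :
    inv (p ++ q) = inv p + inv q + (p.map fun x => q.countP (· < x)).sum := by
  induction p with
  | nil => simp [inv_nil]
  | cons x p ih =>
    rw [List.cons_append, inv_cons, inv_cons, ih, List.countP_append, List.map_cons, List.sum_cons]
    omega

theorem neg_one_pow_inv_swap {a b : ℕ} (hab : a ≠ b) (p q : List ℕ) :
    (-1 : ℤ) ^ inv (p ++ a :: b :: q) = -(-1) ^ inv (p ++ b :: a :: q) := by
  have h1 : ∀ x, (a :: b :: q).countP (· < x) = (b :: a :: q).countP (· < x) :=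
    fun x => (List.Perm.swap ..).countP_eq _
  simp only [inv_append, inv_cons, List.countP_cons, h1]
  rcases lt_or_gt_of_ne hab with h | h
  · have h' : ¬ b < a := by omega
    simp only [decide_eq_true_eq, h, h', if_true, if_false]
    ring
  · have h' : ¬ a < b := by omega
    simp only [decide_eq_true_eq, h, h', if_true, if_false]
    ring

/-- The signed number of tableaux of shape `L` with the labels `w`, in this order, and weight
`α`, with the sign of the order of the barred labels. -/
noncomputable def signedTabSum (α : ℕ → SuperWeight) (L : SuperPartition) (w : List ℕ) : ℤ :=
  (-1) ^ inv (w.filter fun i => (α i).isBarred) * tabSum (w.map α).reverse L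

theorem signedTabSum_swap (α : ℕ → SuperWeight) (L : SuperPartition) (p : List ℕ) (a b : ℕ)
    (q : List ℕ) :
    signedTabSum α L (p ++ a :: b :: q) = signedTabSum α L (p ++ b :: a :: q) := by
  rcases eq_or_ne a b with rfl | hab
  · rfl
  have h1 : ∀ a b, ((p ++ a :: b :: q).map α).reverse =
      (q.map α).reverse ++ α b :: α a :: (p.map α).reverse := by
    intro a b; simp
  unfold signedTabSum
  rw [h1, h1, tabSum_swap]
  simp only [List.filter_append, List.filter_cons]
  -- If both labels are barred, the signs from `tabSum_swap` and from the inversions cancel.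
  -- Otherwise neither changes.
  cases ha : (α a).isBarred <;> cases hb : (α b).isBarred <;> simp [neg_one_pow_inv_swap hab]

theorem List.Perm.eq_of_swap {A B : Type*} {f : List A → B}
    (hf : ∀ p a b q, f (p ++ a :: b :: q) = f (p ++ b :: a :: q)) {l l' : List A} (h : l.Perm l') :
    f l = f l' := by
  -- An arbitrary prefix is carried along, because the induction on permutations peels off leading
  -- letters.
  have key : ∀ p, f (p ++ l) = f (p ++ l') := by
    induction h with
    | nil => intro p; rfl
    | cons x _ ih => intro p; simpa using ih (p ++ [x])
    | swap x y l => intro p; exact hf p y x l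
    | trans _ _ ih1 ih2 => intro p; exact (ih1 p).trans (ih2 p)
  exact key []

theorem signedTabSum_perm (α : ℕ → SuperWeight) (L : SuperPartition) {w w' : List ℕ}
    (h : w.Perm w') : signedTabSum α L w = signedTabSum α L w' :=
  List.Perm.eq_of_swap (signedTabSum_swap α L) h

/-- No boxes means equal column heights. The heights drop strictly at fermionic components, so the
circles cannot move, and the remaining multiplicities are differences of heights. -/
theorem isStep_plain_zero_iff {C D : SuperPartition} : IsStep C (.plain 0) D ↔ C = D := by
  rw [isStep_plain_iff]
  constructor
  · rintro ⟨h1, h2, h3⟩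
    have hC : ∀ x ∈ C.a ++ C.s, x ≤ C.deg + D.deg := fun x hx => (le_deg hx).trans (by omega)
    have hD : ∀ x ∈ D.a ++ D.s, x ≤ C.deg + D.deg := fun x hx => (le_deg hx).trans (by omega)
    have h4 := h1.deg_eq hC hD
    have hcol : ∀ v, D.col v = C.col v := by
      intro v
      rcases lt_or_ge v (C.deg + D.deg) with hv | hv
      · have h5 : boxesBefore C D (C.deg + D.deg) = 0 := by omega
        rw [boxesBefore, Finset.sum_eq_zero_iff] at h5
        have := h5 v (Finset.mem_range.2 hv)
        have := (h1 v).1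
        omega
      · rw [col_eq_zero_of_le hC hv, col_eq_zero_of_le hD hv]
    have ha : D.a = C.a := by
      have hlen : D.a.length = C.a.length := by simpa using congrArg List.length h3
      refine List.ext_getElem hlen fun i h5 h6 => ?_
      have h7 : D.col D.a[i] = D.col C.a[i] := by
        have := List.getElem_of_eq h3 (i := i) (by simpa using h5)
        simpa using this
      rcases lt_trichotomy D.a[i] C.a[i] with h | h | h
      · have := C.col_strictAntiOn (List.getElem_mem h6) h
        rw [hcol, hcol] at h7
        omega
      · exact h
      · have := D.col_strictAntiOn (List.getElem_mem h5) h
        omega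
    have hs : D.s = C.s := by
      refine List.Perm.eq_of_pairwise (fun _ _ _ _ h1 h2 => le_antisymm h2 h1) D.s_sorted
        C.s_sorted ?_
      rw [List.perm_iff_count]
      intro v
      rcases v with _ | v
      · exact D.cfg_zero_snd.trans C.cfg_zero_snd.symm
      · have h5 := C.col_eq v
        have h6 := D.col_eq v
        rw [ha, hcol, hcol] at h6
        omega
    exact (SuperPartition.ext ha hs).symm
  · rintro rfl
    exact ⟨fun v => by omega, rfl, rfl⟩

theorem stepCoeff_plain_zero (C D : SuperPartition) :
    stepCoeff C (.plain 0) D = indicate (C = D) 1 := by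
  rw [stepCoeff, isStep_plain_zero_iff]

theorem tabSum_plain_zero (l : List SuperWeight) (L : SuperPartition) (k : ℕ) :
    tabSum (List.replicate k (.plain 0) ++ l) L = tabSum l L := by
  induction k with
  | zero => rfl
  | succ k ih =>
    rw [List.replicate_succ, List.cons_append, tabSum, ← ih, Finset.sum_eq_single L]
    · rw [stepCoeff_plain_zero, indicate_pos rfl, one_mul]
    · intro C _ hC
      rw [stepCoeff_plain_zero, indicate_neg hC, zero_mul]
    · intro h
      exact absurd (mem_below.2 ⟨le_rfl, le_rfl⟩) h

/-- Equal barred weights cancel. -/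
theorem signedTabSum_eq_zero (α : ℕ → SuperWeight) (L : SuperPartition) {w : List ℕ} {a b : ℕ}
    (hab : a ≠ b) (ha : a ∈ w) (hb : b ∈ w) (hα : α a = α b) (hbar : (α a).isBarred = true) :
    signedTabSum α L w = 0 := by
  have hb' : b ∈ w.erase a := (List.mem_erase_of_ne hab.symm).2 hb
  have h1 : w.Perm (a :: b :: (w.erase a).erase b) :=
    (List.perm_cons_erase ha).trans ((List.perm_cons_erase hb').cons a)
  -- With `a` and `b` in front, exchanging them leaves the value unchanged by symmetry. It also
  -- negates it, since the weights agree and only the inversion sign changes.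
  have h2 := signedTabSum_perm α L h1
  have h3 := signedTabSum_perm α L (h1.trans (List.Perm.swap b a _))
  have h4 : signedTabSum α L (a :: b :: (w.erase a).erase b) =
      - signedTabSum α L (b :: a :: (w.erase a).erase b) := by
    unfold signedTabSum
    have hbar' : (α b).isBarred = true := hα ▸ hbar
    have := neg_one_pow_inv_swap hab [] (((w.erase a).erase b).filter fun i => (α i).isBarred)
    simp only [List.nil_append] at this
    simp [hbar', hα, this]
  omega

end SuperNC

namespace SuperNC

open SuperPartition

/-! ### Tableaux of a given weight -/

open Classical in
/-- The sequences of superpartitions with `r` steps of weights `α 0, …, α (r - 1)` from the empty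
superpartition to `L`, continued by `L`. -/
noncomputable def chains (α : ℕ → SuperWeight) :
    ℕ → SuperPartition → Finset (ℕ → SuperPartition)
  | 0, L => if L = SuperPartition.empty then {fun _ => L} else ∅
  | r + 1, L => ((below L).filter fun C => IsStep C (α r) L).biUnion fun C =>
      (chains α r C).image fun c i => if i ≤ r then c i else L

theorem mem_chains {α : ℕ → SuperWeight} {r : ℕ} {L : SuperPartition} {c : ℕ → SuperPartition} :
    c ∈ chains α r L ↔ c 0 = SuperPartition.empty ∧
      (∀ i < r, IsStep (c i) (α i) (c (i + 1))) ∧ ∀ i, r ≤ i → c i = L := by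
  induction r generalizing L c with
  | zero =>
    simp only [chains]
    split_ifs with h
    · subst h
      rw [Finset.mem_singleton]
      constructor
      · rintro rfl; simp
      · rintro ⟨_, _, h⟩
        funext i
        exact h i (Nat.zero_le _)
    · simp only [Finset.notMem_empty, false_iff]
      rintro ⟨h1, _, h2⟩
      exact h ((h2 0 le_rfl).symm.trans h1)
  | succ r ih =>
    simp only [chains, Finset.mem_biUnion, Finset.mem_filter, Finset.mem_image]
    constructor
    · rintro ⟨C, ⟨_, hC⟩, c', hc', rfl⟩
      obtain ⟨h1, h2, h3⟩ := ih.1 hc'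
      refine ⟨by simpa using h1, fun i hi => ?_, fun i hi => if_neg (by omega)⟩
      beta_reduce
      rcases Nat.lt_or_eq_of_le (Nat.lt_succ_iff.1 hi) with hi | rfl
      · rw [if_pos (by omega), if_pos (by omega)]
        exact h2 i hi
      · rw [if_pos le_rfl, if_neg (by omega), h3 i le_rfl]
        exact hC
    · rintro ⟨h1, h2, h3⟩
      have hs := h2 r (by omega)
      rw [h3 (r + 1) le_rfl] at hs
      refine ⟨c r, ⟨hs.mem_below, hs⟩, fun i => if i ≤ r then c i else c r, ?_, ?_⟩
      · rw [ih]
        refine ⟨by simpa using h1, fun i hi => ?_, fun i hi => ?_⟩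
        · rw [if_pos (by omega), if_pos (by omega)]
          exact h2 i (by omega)
        · rcases Nat.lt_or_eq_of_le hi with hi | rfl
          · exact if_neg (by omega)
          · simp
      · funext i
        split_ifs with hi
        · exact if_pos hi
        · exact (h3 i (by omega)).symm

/-- Expanding the recursion of `tabSum` over the last step gives a sum over all sequences of
superpartitions. -/
theorem sum_chains (α : ℕ → SuperWeight) (r : ℕ) (L : SuperPartition) :
    ∑ c ∈ chains α r L, ∏ i ∈ Finset.range r, stepCoeff (c i) (α i) (c (i + 1)) =
      tabSum ((List.range r).map α).reverse L := by
  classical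
  induction r generalizing L with
  | zero =>
    simp only [chains, List.range_zero, List.map_nil, List.reverse_nil, tabSum, indicate]
    split_ifs <;> simp
  | succ r ih =>
    rw [List.range_succ, List.map_append, List.reverse_append]
    simp only [List.map_cons, List.map_nil, List.reverse_cons, List.reverse_nil, List.nil_append,
      List.cons_append, tabSum, chains]
    rw [Finset.sum_biUnion, Finset.sum_filter]
    · refine Finset.sum_congr rfl fun C _ => ?_
      split_ifs with hC
      · rw [Finset.sum_image, ← ih, Finset.mul_sum]
        · refine Finset.sum_congr rfl fun c hc => ?_
          beta_reduce
          rw [Finset.prod_range_succ, if_pos le_rfl, if_neg (by omega), mul_comm,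
            (mem_chains.1 hc).2.2 r le_rfl]
          congr 1
          refine Finset.prod_congr rfl fun i hi => ?_
          rw [Finset.mem_range] at hi
          rw [if_pos (by omega), if_pos (by omega)]
        · intro c hc c' hc' h
          funext i
          have := congrFun h i
          simp only at this
          split_ifs at this with hi
          · exact this
          · rw [(mem_chains.1 hc).2.2 i (by omega), (mem_chains.1 hc').2.2 i (by omega)]
      · have : stepCoeff C (α r) L = 0 := indicate_neg hC _
        rw [this, zero_mul]
    · intro C _ C' _ hCC'
      rw [Function.onFun, Finset.disjoint_left]
      intro c hc hc'
      rw [Finset.mem_image] at hc hc'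
      obtain ⟨c₁, h1, rfl⟩ := hc
      obtain ⟨c₂, h2, h3⟩ := hc'
      have := congrFun h3 r
      simp only [le_refl, if_true] at this
      rw [(mem_chains.1 h1).2.2 r le_rfl, (mem_chains.1 h2).2.2 r le_rfl] at this
      exact hCC' this.symm

namespace SSYT

variable {L : SuperPartition}

theorem ext_of_eq {T T' : SSYT L} (h1 : T.chain = T'.chain) (h2 : T.weight = T'.weight) :
    T = T' := by
  cases T; cases T'; simp only at h1 h2; subst h1 h2; rfl

theorem stable_of_weight (T : SSYT L) {r : ℕ} (h : ∀ i, r ≤ i → T.weight i = .plain 0) (i : ℕ)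
    (hi : r ≤ i) : T.chain i = L := by
  have hstep : ∀ j, r ≤ j → T.chain j = T.chain (j + 1) := fun j hj => by
    have := T.step j
    rw [h j hj] at this
    exact isStep_plain_zero_iff.1 this
  obtain ⟨r', hr'⟩ := T.stable
  have hconst : ∀ j, i ≤ j → T.chain j = T.chain i := by
    intro j hj
    induction j, hj using Nat.le_induction with
    | base => rfl
    | succ j hj ih => rw [← hstep j (by omega), ih]
  rw [← hconst (max i r') (le_max_left _ _)]
  exact (hr' _ (le_max_right _ _)).1

theorem image_chain {α : ℕ → SuperWeight} {r : ℕ} (h : ∀ i, r ≤ i → α i = .plain 0) :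
    (fun T : SSYT L => T.chain) '' {T | T.weight = α} = ↑(chains α r L) := by
  ext c
  rw [Finset.mem_coe, mem_chains]
  constructor
  · rintro ⟨T, rfl, rfl⟩
    exact ⟨T.chain_zero, fun i _ => T.step i, T.stable_of_weight h⟩
  · rintro ⟨h1, h2, h3⟩
    refine ⟨⟨c, α, h1, fun i => ?_, r, fun i hi => ⟨h3 i hi, h i hi⟩⟩, rfl, rfl⟩
    rcases lt_or_ge i r with hi | hi
    · exact h2 i hi
    · rw [h i hi, isStep_plain_zero_iff, h3 i hi, h3 (i + 1) (by omega)]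

theorem injOn_chain (α : ℕ → SuperWeight) :
    Set.InjOn (fun T : SSYT L => T.chain) {T | T.weight = α} := fun _ hT _ hT' h =>
  ext_of_eq h (hT.trans hT'.symm)

theorem finite_weight_eq {α : ℕ → SuperWeight} {r : ℕ} (h : ∀ i, r ≤ i → α i = .plain 0) :
    {T : SSYT L | T.weight = α}.Finite :=
  Set.Finite.of_finite_image (by rw [image_chain h]; exact Finset.finite_toSet _) (injOn_chain α)

theorem circleLabels_succ_plain (T : SSYT L) {i k : ℕ} (h : T.weight i = .plain k) :
    T.circleLabels (i + 1) = T.circleLabels i := by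
  rw [circleLabels, h]

theorem circleLabels_succ_barred (T : SSYT L) {i k : ℕ} (h : T.weight i = .barred k) :
    T.circleLabels (i + 1) =
      (T.circleLabels i).insertIdx (newIdx (T.chain i) (T.chain (i + 1))) i := by
  rw [circleLabels, h]

theorem newIdx_le {C D : SuperPartition} {k : ℕ} (h : IsStep C (.barred k) D) :
    newIdx C D ≤ C.df := by
  have h' := h.2.1
  obtain ⟨h1, _, v, hv, hg, _⟩ := (isStep_barred_iff C D k).1 h
  rw [newIdx_eq h1 hv hg]
  have := List.idxOf_lt_length_of_mem hv
  change _ < D.df at this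
  omega

theorem length_circleLabels (T : SSYT L) (i : ℕ) :
    (T.circleLabels i).length = (T.chain i).df := by
  induction i with
  | zero => simp [circleLabels, T.chain_zero, SuperPartition.empty, df]
  | succ i ih =>
    have h := T.step i
    rcases hw : T.weight i with k | k <;> rw [hw] at h
    · rw [T.circleLabels_succ_plain hw, ih]
      exact h.2.1.symm
    · rw [T.circleLabels_succ_barred hw, List.length_insertIdx, ih, if_pos (newIdx_le h)]
      exact h.2.1.symm

theorem circleLabels_perm (T : SSYT L) (i : ℕ) :
    (T.circleLabels i).Perm ((List.range i).filter fun j => (T.weight j).isBarred) := by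
  induction i with
  | zero => simp [circleLabels]
  | succ i ih =>
    have h := T.step i
    rw [List.range_succ, List.filter_append]
    rcases hw : T.weight i with k | k <;> rw [hw] at h
    · rw [T.circleLabels_succ_plain hw]
      simpa [hw, SuperWeight.isBarred] using ih
    · rw [T.circleLabels_succ_barred hw]
      have h1 : newIdx (T.chain i) (T.chain (i + 1)) ≤ (T.circleLabels i).length := by
        rw [length_circleLabels]; exact newIdx_le h
      refine (List.perm_insertIdx _ _ h1).trans ?_
      simp only [List.filter_cons, hw, SuperWeight.isBarred, if_true, List.filter_nil]
      exact (ih.cons i).trans (List.perm_append_singleton i _).symm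

theorem inv_insertIdx {l : List ℕ} {x p : ℕ} (hp : p ≤ l.length) (h : ∀ y ∈ l, y < x) :
    inv (l.insertIdx p x) = inv l + (l.length - p) := by
  induction l generalizing p with
  | nil =>
    obtain rfl : p = 0 := by simpa using hp
    simp [inv_cons]
  | cons y l ih =>
    rcases p with _ | p
    · rw [List.insertIdx_zero, inv_cons, List.countP_eq_length.2 fun z hz => by simpa using h z hz]
      omega
    · have hp' : p ≤ l.length := by simpa using hp
      rw [List.insertIdx_succ_cons, inv_cons, inv_cons, ih hp' fun z hz => h z (by simp [hz]),
        (List.perm_insertIdx x l hp').countP_eq, List.countP_cons, List.length_cons,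
        if_neg (by have := h y (by simp); simp; omega)]
      omega

/-- The label `i` is larger than all earlier ones, so inserting it creates one inversion with each
circle below the new one. This is the exponent in `stepCoeff`. -/
theorem neg_one_pow_inv_circleLabels (T : SSYT L) (i : ℕ) :
    (-1 : ℤ) ^ inv (T.circleLabels i) =
      ∏ j ∈ Finset.range i, stepCoeff (T.chain j) (T.weight j) (T.chain (j + 1)) := by
  induction i with
  | zero => simp [circleLabels, inv_nil]
  | succ i ih =>
    have h := T.step i
    have hs : stepCoeff (T.chain i) (T.weight i) (T.chain (i + 1)) = _ := indicate_pos h _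
    rw [Finset.prod_range_succ, ← ih, hs]
    rcases hw : T.weight i with k | k <;> rw [hw] at h
    · rw [T.circleLabels_succ_plain hw]
      simp
    · have h1 := newIdx_le h
      rw [T.circleLabels_succ_barred hw, inv_insertIdx, length_circleLabels, pow_add]
      · rw [length_circleLabels]; exact h1
      · intro y hy
        have := (T.circleLabels_perm i).mem_iff.1 hy
        simpa using (List.mem_filter.1 this).1

theorem circleWord_eq (T : SSYT L) {r : ℕ} (h : ∀ i, r ≤ i → T.weight i = .plain 0) :
    T.circleWord = T.circleLabels r := by
  have h1 : T.steps ≤ r := Nat.sInf_le fun i hi => ⟨T.stable_of_weight h i hi, h i hi⟩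
  have h2 := Nat.sInf_mem T.stable
  have h3 : ∀ j, T.steps ≤ j → T.circleLabels j = T.circleLabels T.steps := by
    intro j hj
    induction j, hj using Nat.le_induction with
    | base => rfl
    | succ j hj ih => rw [T.circleLabels_succ_plain (h2 j hj).2, ih]
  exact (h3 r h1).symm

/-- The signed number of tableaux of a given weight. -/
theorem finsum_weight_eq {α : ℕ → SuperWeight} {r : ℕ} (h : ∀ i, r ≤ i → α i = .plain 0) :
    ∑ᶠ T ∈ {T : SSYT L | T.weight = α}, (-1 : ℤ) ^ inv T.circleWord =
      tabSum ((List.range r).map α).reverse L := by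
  rw [← sum_chains, ← finsum_mem_coe_finset, ← image_chain h, finsum_mem_image (injOn_chain α)]
  refine finsum_mem_congr rfl fun T hT => ?_
  obtain rfl : T.weight = α := hT
  rw [T.circleWord_eq h, neg_one_pow_inv_circleLabels]

end SSYT

end SuperNC

namespace SuperNC

open SuperPartition

/-! ### The coefficients of a tableau -/

theorem card_fiber_eq_count {n : ℕ} (f : Fin n → ℕ) (j : ℕ) :
    Fintype.card {i // f i = j} = (List.ofFn f).count j := by
  rw [Fintype.card_subtype, Finset.card_filter]
  induction n with
  | zero => simp
  | succ n ih =>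
    rw [Fin.sum_univ_succ, List.ofFn_succ, List.count_cons, ← ih, add_comm]
    simp

/-- The number of ways to rearrange a word into another one. -/
theorem card_rearrangements {n : ℕ} (f : Fin n → ℕ) (w : List ℕ) :
    (Finset.univ.filter fun σ : Equiv.Perm (Fin n) => List.ofFn (fun i => f (σ i)) = w).card =
      if (List.ofFn f).Perm w then ∏ i ∈ w.toFinset, (w.count i).factorial else 0 := by
  split_ifs with h
  · have hn : w.length = n := by rw [← h.length_eq, List.length_ofFn]
    subst hn
    have hc : ∀ j, Fintype.card {i // w.get i = j} = Fintype.card {i // f i = j} := by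
      intro j
      rw [card_fiber_eq_count, card_fiber_eq_count, h.count_eq, List.ofFn_get]
    -- One rearrangement `e` exists because the letters have equal multiplicities. All others form a
    -- coset of the stabilizer of `f`, whose order is the product of the factorials.
    let e : Equiv.Perm (Fin w.length) := Equiv.ofFiberEquiv fun j => Fintype.equivOfCardEq (hc j)
    have he : ∀ i, f (e i) = w.get i := fun i => Equiv.ofFiberEquiv_map _ i
    have h1 : ∀ σ : Equiv.Perm (Fin w.length),
        List.ofFn (fun i => f (σ i)) = w ↔ f ∘ (σ * e⁻¹ : Equiv.Perm _) = f := by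
      intro σ
      have h2 : List.ofFn (fun i => f (σ i)) = w ↔ (fun i => f (σ i)) = w.get := by
        rw [← List.ofFn_injective.eq_iff, List.ofFn_get]
      rw [h2]
      constructor
      · intro h
        funext i
        have := congrFun h (e⁻¹ i)
        rw [← he, show e (e⁻¹ i) = i from e.apply_symm_apply i] at this
        exact this
      · intro h
        funext i
        have := congrFun h (e i)
        simp only [Function.comp_apply, Equiv.Perm.mul_apply, he,
          show e⁻¹ (e i) = i from e.symm_apply_apply i] at this
        exact this
    rw [← Fintype.card_subtype,
      Fintype.card_congr ((Equiv.mulRight e⁻¹).subtypeEquiv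
        (q := fun σ : Equiv.Perm (Fin w.length) => f ∘ σ = f) h1),
      DomMulAct.stabilizer_card']
    have himage : Finset.univ.image f = w.toFinset := by
      ext j
      rw [List.mem_toFinset, ← h.mem_iff, List.mem_ofFn]
      simp
    rw [himage]
    exact Finset.prod_congr rfl fun j _ => by rw [card_fiber_eq_count, h.count_eq]
  · rw [Finset.card_eq_zero, Finset.filter_eq_empty_iff]
    rintro σ _ rfl
    exact h (Equiv.Perm.ofFn_comp_perm σ f).symm

namespace SuperPartition

variable (L : SuperPartition)

theorem mem_boxes_iff (p : ℕ × ℕ) : p ∈ L.boxes ↔ p.1 < L.col p.2 := by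
  obtain ⟨r, c⟩ := p
  have h : L.col c ≤ L.length := by
    have := List.countP_le_length (p := fun x => decide (c < x)) (l := L.a ++ L.s)
    rwa [List.length_append] at this
  simp only [boxes, List.mem_flatMap, List.mem_map, List.mem_range, Prod.mk.injEq]
  constructor
  · rintro ⟨r, _, c, h2, rfl, rfl⟩
    exact (L.lt_row_iff _ _).1 h2
  · intro h2
    exact ⟨r, by omega, c, (L.lt_row_iff _ _).2 h2, rfl, rfl⟩

theorem boxes_nodup : L.boxes.Nodup := by
  rw [boxes, List.nodup_flatMap]
  refine ⟨fun r _ => List.nodup_range.map fun a b h => (Prod.mk.inj h).2, ?_⟩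
  refine List.nodup_range.imp fun {r r'} h => ?_
  rw [Function.onFun, List.disjoint_left]
  intro p hp hp'
  rw [List.mem_map] at hp hp'
  obtain ⟨_, _, rfl⟩ := hp
  obtain ⟨_, _, h'⟩ := hp'
  exact h (Prod.mk.inj h').1.symm

end SuperPartition

namespace SSYT

variable {L : SuperPartition} (T : SSYT L)

theorem col_mono (v : ℕ) : Monotone fun i => (T.chain i).col v :=
  monotone_nat_of_le_succ fun i => (((isHorizontalStrip_iff ..).1 (T.step i).1).1 v).1

theorem chain_mono_le {i r : ℕ} (h : ∀ i, r ≤ i → T.chain i = L) (v : ℕ) :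
    (T.chain i).col v ≤ L.col v := by
  have h1 := T.col_mono v (le_max_left i r)
  simp only [h (max i r) (le_max_right _ _)] at h1
  exact h1

theorem boxLabel_eq_iff {p : ℕ × ℕ} (hp : p ∈ L.boxes) (j : ℕ) :
    T.boxLabel p = j ↔ p ∈ skew (T.chain j) (T.chain (j + 1)) := by
  obtain ⟨r, c⟩ := p
  rw [mem_boxes_iff] at hp
  simp only at hp
  have hmem : ∀ i, (r, c) ∈ skew (T.chain i) (T.chain (i + 1)) ↔
      (T.chain i).col c ≤ r ∧ r < (T.chain (i + 1)).col c := fun i => mem_skew_iff ..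
  have huniq : ∀ i i', (r, c) ∈ skew (T.chain i) (T.chain (i + 1)) →
      (r, c) ∈ skew (T.chain i') (T.chain (i' + 1)) → i ≤ i' := by
    intro i i' h h'
    rw [hmem] at h h'
    by_contra! hlt
    have := T.col_mono c (show i' + 1 ≤ i by omega)
    simp only at this
    omega
  have hex : ∃ i, (r, c) ∈ skew (T.chain i) (T.chain (i + 1)) := by
    by_contra! hne
    have : ∀ i, (T.chain i).col c ≤ r := by
      intro i
      induction i with
      | zero => rw [T.chain_zero]; simp [col, SuperPartition.empty]
      | succ i ih =>
        by_contra! h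
        exact hne i ((hmem i).2 ⟨ih, h⟩)
    obtain ⟨r', hr'⟩ := T.stable
    have := this r'
    rw [(hr' r' le_rfl).1] at this
    omega
  have h0 : (r, c) ∈ skew (T.chain (T.boxLabel (r, c))) (T.chain (T.boxLabel (r, c) + 1)) :=
    Nat.sInf_mem (s := {i | (r, c) ∈ skew (T.chain i) (T.chain (i + 1))}) hex
  constructor
  · rintro rfl
    exact h0
  · intro h
    exact le_antisymm (huniq _ _ h0 h) (huniq _ _ h h0)

/-- The boxes with label `j` are those of the `j`th strip, counted column by column. -/
theorem count_boxLabel (j : ℕ) : (L.boxes.map T.boxLabel).count j = (T.weight j).abs := by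
  classical
  have hstep := T.step j
  have hstrip := ((isHorizontalStrip_iff ..).1 hstep.1).1
  set M := (T.chain j).deg + (T.chain (j + 1)).deg with hM
  have hC : ∀ x ∈ (T.chain j).a ++ (T.chain j).s, x ≤ M := fun x hx => (le_deg hx).trans (by omega)
  have hD : ∀ x ∈ (T.chain (j + 1)).a ++ (T.chain (j + 1)).s, x ≤ M :=
    fun x hx => (le_deg hx).trans (by omega)
  have h1 := hstrip.deg_eq hC hD
  have h2 := hstep.deg_eq
  have h3 : (T.weight j).abs = boxesBefore (T.chain j) (T.chain (j + 1)) M := by omega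
  obtain ⟨r', hr'⟩ := T.stable
  have h4 : (L.boxes.map T.boxLabel).count j =
      (L.boxes.toFinset.filter fun p => T.boxLabel p = j).card := by
    have h5 : (L.boxes.toFinset.filter fun p => T.boxLabel p = j) =
        (L.boxes.filter fun p => T.boxLabel p = j).toFinset := by
      ext; simp
    rw [h5, List.toFinset_card_of_nodup (L.boxes_nodup.filter _), List.count, List.countP_map,
      List.countP_eq_length_filter]
    rfl
  rw [h3, h4, boxesBefore]
  have h5 : (L.boxes.toFinset.filter fun p => T.boxLabel p = j) =
      ((Finset.range M).sigma fun c =>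
        Finset.Ico ((T.chain j).col c) ((T.chain (j + 1)).col c)).image fun q => (q.2, q.1) := by
    ext ⟨r, c⟩
    simp only [Finset.mem_filter, List.mem_toFinset, Finset.mem_image, Finset.mem_sigma,
      Finset.mem_range, Finset.mem_Ico, Prod.mk.injEq, Sigma.exists]
    constructor
    · rintro ⟨hp, hl⟩
      rw [T.boxLabel_eq_iff hp, mem_skew_iff] at hl
      refine ⟨c, r, ⟨?_, hl⟩, rfl, rfl⟩
      by_contra! hc
      rw [col_eq_zero_of_le hD hc] at hl
      omega
    · rintro ⟨c, r, ⟨_, hl⟩, rfl, rfl⟩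
      have hp : (r, c) ∈ L.boxes := by
        rw [mem_boxes_iff]
        exact hl.2.trans_le (T.chain_mono_le (fun i hi => (hr' i hi).1) c)
      exact ⟨hp, (T.boxLabel_eq_iff hp j).2 ((mem_skew_iff ..).2 hl)⟩
  rw [h5, Finset.card_image_of_injective, Finset.card_sigma]
  · simp
  · rintro ⟨c, r⟩ ⟨c', r'⟩ h
    simp only [Prod.mk.injEq] at h
    obtain ⟨rfl, rfl⟩ := h
    rfl

end SSYT

/-- The weight of the tableaux that contribute to the monomial `u`. -/
def SuperMonomial.weight (u : SuperMonomial) (i : ℕ) : SuperWeight :=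
  .ofBarred (decide (i ∈ u.1)) (u.2.count i)

theorem isBarred_ofBarred (β : Bool) (k : ℕ) : (SuperWeight.ofBarred β k).isBarred = β := by
  cases β <;> rfl

theorem SuperWeight.ext_iff' {v w : SuperWeight} :
    v = w ↔ v.isBarred = w.isBarred ∧ v.abs = w.abs := by
  constructor
  · rintro rfl; simp
  · rintro ⟨h1, h2⟩
    rw [← v.ofBarred_abs, ← w.ofBarred_abs, h1, h2]

namespace SSYT

variable {L : SuperPartition} (T : SSYT L)

theorem circleWord_nodup_and_mem :
    T.circleWord.Nodup ∧ ∀ j, j ∈ T.circleWord ↔ (T.weight j).isBarred = true := by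
  obtain ⟨r, hr⟩ := T.stable
  have h := T.circleLabels_perm r
  rw [← T.circleWord_eq fun i hi => (hr i hi).2] at h
  refine ⟨h.nodup_iff.2 (List.nodup_range.filter _), fun j => ?_⟩
  rw [h.mem_iff, List.mem_filter, List.mem_range, and_iff_right_iff_imp]
  intro hj
  by_contra! hle
  rw [(hr j hle).2] at hj
  simp [SuperWeight.isBarred] at hj

-- The circle word gives the barred labels and the box labels give the sizes, so `u` occurs iff the
-- weights agree. Then the permutations of the boxes that spell `u.2` are counted by
-- `card_rearrangements`.
open Classical in
theorem term_eq (u : SuperMonomial) :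
    T.term u = if T.weight = u.weight then
      (-1) ^ inv T.circleWord * ((∏ i ∈ u.2.toFinset, (u.2.count i).factorial : ℕ) : ℚ) else 0 := by
  obtain ⟨hnd, hmem⟩ := T.circleWord_nodup_and_mem
  have hofFn : List.ofFn (fun i => T.boxLabel (L.boxes.get i)) = L.boxes.map T.boxLabel := by
    refine (List.map_ofFn (f := L.boxes.get) (g := T.boxLabel)).symm.trans ?_
    rw [List.ofFn_get]
  have hiff : T.weight = u.weight ↔ T.circleWord.toFinset = u.1 ∧
      (List.ofFn fun i => T.boxLabel (L.boxes.get i)).Perm u.2 := by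
    rw [hofFn, List.perm_iff_count, funext_iff, Finset.ext_iff, ← forall_and]
    refine forall_congr' fun j => ?_
    rw [SuperWeight.ext_iff', T.count_boxLabel, SuperMonomial.weight, isBarred_ofBarred,
      abs_ofBarred, List.mem_toFinset, hmem]
    refine and_congr_left fun _ => ?_
    rw [Bool.eq_iff_iff, decide_eq_true_iff]
  unfold term coeffProd
  simp only [hnd, true_and]
  by_cases hs : T.circleWord.toFinset = u.1
  · have := card_rearrangements (fun i => T.boxLabel (L.boxes.get i)) u.2
    simp only [hs, true_and] at hiff ⊢
    rw [if_congr hiff.symm rfl rfl] at this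
    rw [← Finset.sum_filter, Finset.sum_const, this, nsmul_eq_mul]
    split_ifs
    · rw [mul_comm]
    · simp
  · rw [if_neg fun h => hs (hiff.1 h).1]
    simp [hs]

theorem weight_eventually (u : SuperMonomial) :
    ∃ r, ∀ i, r ≤ i → u.weight i = .plain 0 := by
  obtain ⟨s, w⟩ := u
  refine ⟨s.sup id + w.sum + 1, fun i hi => ?_⟩
  have h1 : i ∉ s := fun h => by
    have := Finset.le_sup (f := id) h
    simp only [id] at this
    omega
  have h2 : i ∉ w := fun h => by
    have := List.le_sum_of_mem h
    omega
  simp [SuperMonomial.weight, h1, List.count_eq_zero_of_not_mem h2, SuperWeight.ofBarred]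

theorem finite_term_ne_zero (u : SuperMonomial) : {T : SSYT L | T.term u ≠ 0}.Finite := by
  obtain ⟨r, hr⟩ := weight_eventually u
  refine (finite_weight_eq hr).subset fun T hT => ?_
  by_contra h
  exact hT ((term_eq T u).trans (if_neg h))

end SSYT

theorem finsum_mem_intCast {ι : Type*} {S : Set ι} (hS : S.Finite) (f : ι → ℤ) :
    ∑ᶠ i ∈ S, (f i : ℚ) = ((∑ᶠ i ∈ S, f i : ℤ) : ℚ) :=
  ((Int.castAddHom ℚ).map_finsum_mem f hS).symm

theorem schur_apply (L : SuperPartition) (u : SuperMonomial) {r : ℕ}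
    (hr : ∀ i, r ≤ i → u.weight i = .plain 0) :
    (schur L : SuperMonomial → ℚ) u = tabSum ((List.range r).map u.weight).reverse L *
      ((∏ i ∈ u.2.toFinset, (u.2.count i).factorial : ℕ) : ℚ) := by
  classical
  rw [← SSYT.finsum_weight_eq hr, ← finsum_mem_intCast (SSYT.finite_weight_eq hr),
    finsum_mem_mul]
  change ∑ᶠ T : SSYT L, T.term u = _
  refine finsum_congr fun T => ?_
  rw [SSYT.term_eq, finsum_eq_if]
  push_cast
  rfl

end SuperNC

namespace SuperNC

open SuperPartition

/-! ### Signs -/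

/-- The Vandermonde determinant is the product of `f j - f i` over `i < j`, with one negative factor
per inversion. Its behaviour under row permutations then relates inversions to signs of
permutations. -/
theorem neg_one_pow_inv_ofFn {m : ℕ} (f : Fin m → ℕ) (hf : Function.Injective f) :
    (-1 : ℤ) ^ inv (List.ofFn f) = (Matrix.vandermonde fun i => (f i : ℤ)).det.sign := by
  induction m with
  | zero => simp [inv_nil]
  | succ m ih =>
    have h1 : (Matrix.vandermonde fun i => (f i : ℤ)).det =
        (∏ j : Fin m, ((f j.succ : ℤ) - f 0)) *
          (Matrix.vandermonde fun i => (f (Fin.succ i) : ℤ)).det := by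
      rw [Matrix.det_vandermonde, Matrix.det_vandermonde, Fin.prod_univ_succ]
      simp
    rw [h1, Int.sign_mul, ← ih (fun i => f i.succ) (hf.comp (Fin.succ_injective m)),
      List.ofFn_succ, inv_cons, pow_add]
    congr 1
    have h2 : ∀ i : Fin m, f i.succ ≠ f 0 := fun i h => (Fin.succ_ne_zero i) (hf h)
    generalize f 0 = x at h2 ⊢
    have h3 : ∀ {m : ℕ} (g : Fin m → ℕ), (∀ i, g i ≠ x) →
        (-1 : ℤ) ^ (List.ofFn g).countP (· < x) = (∏ j, ((g j : ℤ) - x)).sign := by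
      intro m g
      clear * -
      induction m with
      | zero => simp
      | succ m ih =>
        intro hg
        rw [Fin.prod_univ_succ, Int.sign_mul, ← ih (fun i => g i.succ) fun i => hg i.succ,
          List.ofFn_succ, List.countP_cons]
        have := hg 0
        rcases lt_or_gt_of_ne this with h | h
        · rw [if_pos (by simpa using h), Int.sign_eq_neg_one_of_neg (by omega), pow_succ]
          ring
        · rw [if_neg (by simp; omega), Int.sign_eq_one_of_pos (by omega), add_zero, one_mul]
    exact h3 (fun i => f i.succ) h2

theorem neg_one_pow_inv_comp_perm {m : ℕ} (f : Fin m → ℕ) (hf : Function.Injective f)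
    (σ : Equiv.Perm (Fin m)) :
    (-1 : ℤ) ^ inv (List.ofFn (f ∘ σ)) = (σ.sign : ℤ) * (-1) ^ inv (List.ofFn f) := by
  rw [neg_one_pow_inv_ofFn _ (hf.comp σ.injective), neg_one_pow_inv_ofFn f hf]
  have h := Matrix.det_permute σ (Matrix.vandermonde fun i => (f i : ℤ))
  have h1 : (Matrix.vandermonde fun i => ((f ∘ σ) i : ℤ)) =
      (Matrix.vandermonde fun i => (f i : ℤ)).submatrix σ id := rfl
  rw [h1, h, Int.sign_mul]
  congr 1
  rcases Int.units_eq_one_or σ.sign with h | h <;> simp [h]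

theorem inv_eq_zero {l : List ℕ} (h : l.Pairwise (· < ·)) : inv l = 0 := by
  induction l with
  | nil => exact inv_nil
  | cons x l ih =>
    rw [List.pairwise_cons] at h
    rw [inv_cons, ih h.2, add_zero, List.countP_eq_zero]
    intro y hy
    have := h.1 y hy
    simp; omega

theorem exists_antitone_perm {m : ℕ} (f : Fin m → ℕ) :
    ∃ σ : Equiv.Perm (Fin m), Antitone fun i => f (σ i) :=
  ⟨Tuple.sort (OrderDual.toDual ∘ f), fun _ _ h => Tuple.monotone_sort (OrderDual.toDual ∘ f) h⟩

theorem exists_swap_list {m : ℕ} (σ : Equiv.Perm (Fin m)) :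
    ∃ l : List (Equiv.Perm (Fin m)), l.prod = σ ∧ ∀ t ∈ l, t.IsSwap :=
  ⟨_, (Equiv.Perm.swapFactors σ).2⟩

/-- A shortest list of sorting transpositions multiplies to a sorting permutation, and its length
has the parity of this permutation. -/
theorem SetSuperpartition.exists_perm_eps {n m : ℕ} (I : SetSuperpartition n m) :
    ∃ σ : Equiv.Perm (Fin m), (Antitone fun i : Fin m => I.fermSizes.getD (σ i) 0) ∧
      (-1 : ℤ) ^ I.eps = σ.sign := by
  have hne : {k | ∃ l : List (Equiv.Perm (Fin m)), l.length = k ∧ (∀ t ∈ l, t.IsSwap) ∧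
      Antitone fun i : Fin m => I.fermSizes.getD (l.prod i) 0}.Nonempty := by
    obtain ⟨σ, hσ⟩ := exists_antitone_perm fun i : Fin m => I.fermSizes.getD i 0
    obtain ⟨l, rfl, hl⟩ := exists_swap_list σ
    exact ⟨_, l, rfl, hl, hσ⟩
  obtain ⟨l, h1, h2, h3⟩ := Nat.sInf_mem hne
  refine ⟨l.prod, h3, ?_⟩
  rw [Equiv.Perm.sign_prod_list_swap h2, h1]
  simp [SetSuperpartition.eps]

theorem exists_perm_map_eq_sortDesc {A : Type*} (l : List A) (κ : A → ℕ) :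
    ∃ l' : List A, l'.Perm l ∧ l'.map κ = sortDesc (l.map κ) := by
  refine ⟨l.mergeSort fun x y => decide (κ y ≤ κ x), List.mergeSort_perm _ _, ?_⟩
  symm
  refine sortDesc_eq_of_perm ((List.mergeSort_perm _ _).map κ).symm ?_
  rw [List.pairwise_map]
  exact (List.pairwise_mergeSort (le := fun x y => decide (κ y ≤ κ x))
    (fun a b c h1 h2 => by simp at *; omega) (fun a b => by simp; omega) l).imp
      fun h => by simpa using h

/-! ### Degrees -/

theorem tabSum_ne_zero {l : List SuperWeight} {L : SuperPartition} (h : tabSum l L ≠ 0) :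
    L.deg = (l.map SuperWeight.abs).sum ∧ L.df = l.countP SuperWeight.isBarred := by
  induction l generalizing L with
  | nil =>
    by_cases hL : L = SuperPartition.empty
    · subst hL
      exact ⟨rfl, rfl⟩
    · exact absurd (indicate_neg hL _) h
  | cons w l ih =>
    obtain ⟨C, _, hC⟩ := Finset.exists_ne_zero_of_sum_ne_zero h
    have h1 := stepCoeff_ne_zero (left_ne_zero_of_mul hC)
    obtain ⟨h2, h3⟩ := ih (right_ne_zero_of_mul hC)
    have h4 := h1.deg_eq
    have h5 := h1.2
    rw [List.map_cons, List.sum_cons, List.countP_cons]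
    cases w <;> simp only [SuperWeight.isBarred, SuperWeight.abs] at h4 h5 ⊢
    · exact ⟨by omega, by simpa [h3] using h5.1⟩
    · exact ⟨by omega, by simpa [h3] using h5.1⟩

theorem sum_count_range {w : List ℕ} {r : ℕ} (h : ∀ i ∈ w, i < r) :
    ((List.range r).map fun i => w.count i).sum = w.length := by
  induction w with
  | nil => simp
  | cons x w ih =>
    rw [List.length_cons, ← ih fun i hi => h i (List.mem_cons_of_mem _ hi)]
    simp only [List.count_cons, List.sum_map_add]
    congr 1
    have h1 : ∀ l : List ℕ, (l.map fun i => if (x == i) = true then 1 else 0).sum = l.count x := by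
      intro l
      induction l with
      | nil => rfl
      | cons y l ih =>
        rw [List.map_cons, List.sum_cons, ih, List.count_cons, add_comm]
        simp only [beq_iff_eq, @eq_comm _ x y]
    rw [h1, List.count_eq_one_of_mem List.nodup_range (List.mem_range.2 (h x List.mem_cons_self))]

/-- The weight of a monomial determines its degrees. -/
theorem degrees_of_tabSum_ne_zero {L : SuperPartition} {u : SuperMonomial} {r : ℕ}
    (hs : ∀ i ∈ u.1, i < r) (hw : ∀ i ∈ u.2, i < r)
    (h : tabSum ((List.range r).map u.weight).reverse L ≠ 0) :
    L.deg = u.2.length ∧ L.df = u.1.card := by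
  obtain ⟨h1, h2⟩ := tabSum_ne_zero h
  rw [List.map_reverse, List.sum_reverse, List.map_map] at h1
  rw [List.countP_reverse, List.countP_map] at h2
  constructor
  · rw [h1, ← sum_count_range hw]
    congr 2
    funext i
    exact abs_ofBarred _ _
  · rw [h2, List.countP_eq_length_filter,
      ← List.toFinset_card_of_nodup (List.nodup_range.filter _)]
    congr 1
    ext i
    simp only [List.toFinset_filter, Function.comp_apply, SuperMonomial.weight, isBarred_ofBarred,
      Finset.mem_filter, List.mem_toFinset, List.mem_range, decide_eq_true_eq]
    exact and_iff_right_of_imp (hs i)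

/-! ### Sorting the weight of a monomial -/

theorem kostka_eq (L Om : SuperPartition) : kostka L Om =
    tabSum (Om.a.map SuperWeight.barred ++ Om.s.map SuperWeight.plain).reverse L := by
  have h : ∀ i, (Om.a.map SuperWeight.barred ++ Om.s.map SuperWeight.plain).length ≤ i →
      Om.weight i = .plain 0 := fun i hi => List.getD_eq_default _ _ hi
  rw [kostka, tableauxOfWeight, SSYT.finsum_weight_eq h]
  congr 2
  refine List.ext_getElem (by simp) fun i h1 h2 => ?_
  rw [List.getElem_map, List.getElem_range]
  exact List.getD_eq_getElem _ _ h2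

/-- The labels `0, …, r - 1` are permuted into `F`, the `θ`-letters in the order of `Om.a`, then
`B`, the other letters of the word, then the absent ones. By symmetry only the inversions of `F`
matter, and the absent letters contribute trivial steps at the end. -/
theorem tabSum_weight_eq {L Om : SuperPartition} {u : SuperMonomial} {r : ℕ}
    (hs : ∀ i ∈ u.1, i < r) (hw : ∀ i ∈ u.2, i < r) {F B : List ℕ} (hF : F.Nodup)
    (hF' : F.toFinset = u.1) (hB : B.Nodup) (hB' : ∀ i, i ∈ B ↔ i ∈ u.2 ∧ i ∉ u.1)
    (ha : F.map (u.2.count ·) = Om.a) (hs' : B.map (u.2.count ·) = Om.s) :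
    tabSum ((List.range r).map u.weight).reverse L = (-1) ^ inv F * kostka L Om := by
  have hFm : ∀ i, i ∈ F ↔ i ∈ u.1 := fun i => by rw [← hF', List.mem_toFinset]
  set Z := (List.range r).filter fun i => decide (i ∉ u.1 ∧ i ∉ u.2) with hZ
  have hZm : ∀ i, i ∈ Z ↔ i < r ∧ i ∉ u.1 ∧ i ∉ u.2 := fun i => by simp [hZ]
  have hperm : (List.range r).Perm (F ++ (B ++ Z)) := by
    rw [List.perm_ext_iff_of_nodup List.nodup_range]
    · intro i
      rw [List.mem_append, List.mem_append, hFm, hB', hZm, List.mem_range]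
      have := hs i
      have := hw i
      tauto
    · rw [List.nodup_append', List.nodup_append', List.disjoint_left, List.disjoint_left]
      refine ⟨hF, ⟨hB, List.nodup_range.filter _, ?_⟩, ?_⟩
      · intro i h1 h2
        rw [hB'] at h1
        rw [hZm] at h2
        exact h2.2.2 h1.1
      · intro i h1 h2
        rw [hFm] at h1
        rw [List.mem_append, hB', hZm] at h2
        tauto
  have h := signedTabSum_perm u.weight L hperm
  have hbar : ∀ i, (u.weight i).isBarred = decide (i ∈ u.1) := fun i => isBarred_ofBarred _ _
  unfold signedTabSum at h
  simp only [hbar] at h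
  -- In the original order the barred labels increase, so that side carries no sign.
  rw [inv_eq_zero (List.pairwise_lt_range.filter _), pow_zero, one_mul] at h
  rw [h, kostka_eq]
  have h1 : (F ++ (B ++ Z)).filter (fun i => decide (i ∈ u.1)) = F := by
    rw [List.filter_append, List.filter_eq_self.2 fun i hi => by simpa using (hFm i).1 hi,
      List.filter_eq_nil_iff.2, List.append_nil]
    intro i hi
    rw [List.mem_append, hB', hZm] at hi
    simp; tauto
  rw [h1]
  congr 1
  have h2 : F.map u.weight = Om.a.map SuperWeight.barred := by
    rw [← ha, List.map_map]
    refine List.map_congr_left fun i hi => ?_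
    simp [SuperMonomial.weight, (hFm i).1 hi, SuperWeight.ofBarred]
  have h3 : B.map u.weight = Om.s.map SuperWeight.plain := by
    rw [← hs', List.map_map]
    refine List.map_congr_left fun i hi => ?_
    simp [SuperMonomial.weight, ((hB' i).1 hi).2, SuperWeight.ofBarred]
  have h4 : Z.map u.weight = List.replicate Z.length (.plain 0) := by
    rw [← List.map_const']
    refine List.map_congr_left fun i hi => ?_
    have := (hZm i).1 hi
    simp [SuperMonomial.weight, this.2.1, SuperWeight.ofBarred,
      List.count_eq_zero_of_not_mem this.2.2]
  rw [List.map_append, List.map_append, h2, h3, h4, ← List.append_assoc, List.reverse_append,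
    List.reverse_replicate, tabSum_plain_zero]

/-- Two fermionic components of the same size cancel. -/
theorem tabSum_weight_eq_zero {L : SuperPartition} {u : SuperMonomial} {r : ℕ}
    (hs : ∀ i ∈ u.1, i < r) {a b : ℕ} (hab : a ≠ b) (ha : a ∈ u.1) (hb : b ∈ u.1)
    (h : u.2.count a = u.2.count b) : tabSum ((List.range r).map u.weight).reverse L = 0 := by
  have h1 := signedTabSum_eq_zero u.weight L (w := List.range r) hab (by simpa using hs a ha)
    (by simpa using hs b hb) (by simp [SuperMonomial.weight, ha, hb, h])
    (by simp [SuperMonomial.weight, isBarred_ofBarred, ha])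
  unfold signedTabSum at h1
  simpa using h1

end SuperNC

namespace SuperNC

open SuperPartition

/-! ### Positions of letters -/

/-- The positions, counted from `1`, of the letter `c` in the word `w`. -/
def positions (w : List ℕ) (c : ℕ) : Finset ℕ :=
  ((Finset.range w.length).filter fun j => w[j]? = some c).image (· + 1)

theorem mem_positions {w : List ℕ} {c x : ℕ} :
    x ∈ positions w c ↔ ∃ j, w[j]? = some c ∧ j + 1 = x := by
  simp only [positions, Finset.mem_image, Finset.mem_filter, Finset.mem_range]
  refine exists_congr fun j => and_congr_left fun _ => and_iff_right_of_imp fun h => ?_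
  exact (List.getElem?_eq_some_iff.1 h).1

theorem succ_mem_positions {w : List ℕ} {c j : ℕ} : j + 1 ∈ positions w c ↔ w[j]? = some c := by
  simp [mem_positions]

theorem zero_notMem_positions (w : List ℕ) (c : ℕ) : 0 ∉ positions w c := by
  simp [mem_positions]

theorem card_positions (w : List ℕ) (c : ℕ) : (positions w c).card = w.count c := by
  rw [positions, Finset.card_image_of_injective _ (add_left_injective 1), Finset.card_filter]
  induction w with
  | nil => rfl
  | cons x w ih =>
    rw [List.length_cons, Finset.sum_range_succ', List.count_cons, ← ih]
    simp

theorem eq_of_mem_positions {w : List ℕ} {c d x : ℕ} (hc : x ∈ positions w c)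
    (hd : x ∈ positions w d) : c = d := by
  obtain ⟨j, h1, rfl⟩ := mem_positions.1 hc
  rw [succ_mem_positions, h1] at hd
  exact Option.some_injective _ hd

theorem positions_nonempty {w : List ℕ} {c : ℕ} : (positions w c).Nonempty ↔ c ∈ w := by
  rw [← Finset.card_pos, card_positions, List.count_pos_iff]

/-- The block of positions of `c`, with `0` added if `θ_c` occurs. -/
def siteBlock (u : SuperMonomial) (c : ℕ) : Finset ℕ :=
  if c ∈ u.1 then insert 0 (positions u.2 c) else positions u.2 c

theorem succ_mem_siteBlock {u : SuperMonomial} {c j : ℕ} :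
    j + 1 ∈ siteBlock u c ↔ u.2[j]? = some c := by
  unfold siteBlock
  split_ifs <;> simp [succ_mem_positions]

theorem zero_mem_siteBlock {u : SuperMonomial} {c : ℕ} : 0 ∈ siteBlock u c ↔ c ∈ u.1 := by
  unfold siteBlock
  split_ifs with h <;> simp [h, zero_notMem_positions]

theorem siteBlock_inter {u : SuperMonomial} {c d : ℕ} (h : c ≠ d) :
    siteBlock u c ∩ siteBlock u d ⊆ {0} := by
  intro x hx
  rw [Finset.mem_inter] at hx
  rw [Finset.mem_singleton]
  obtain _ | j := x
  · rfl
  · rw [succ_mem_siteBlock, succ_mem_siteBlock] at hx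
    exact absurd (Option.some_injective _ (hx.1.symm.trans hx.2)) h

theorem card_siteBlock_of_mem {u : SuperMonomial} {c : ℕ} (h : c ∈ u.1) :
    (siteBlock u c).card - 1 = u.2.count c := by
  rw [siteBlock, if_pos h, Finset.card_insert_of_notMem (zero_notMem_positions _ _),
    card_positions, Nat.add_sub_cancel]

theorem card_siteBlock_of_notMem {u : SuperMonomial} {c : ℕ} (h : c ∉ u.1) :
    (siteBlock u c).card = u.2.count c := by
  rw [siteBlock, if_neg h, card_positions]

/-! ### The terms of a monomial function -/

/-- The index `p` of the monomial function of `I` contributes to the coefficient of `u`. -/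
structure Fits {n m : ℕ} (I : SetSuperpartition n m) (p : (Fin m → ℕ) × (Fin n → ℕ))
    (u : SuperMonomial) : Prop where
  mem : p ∈ I.indexSet
  nodup : (List.ofFn p.1).Nodup
  theta : (List.ofFn p.1).toFinset = u.1
  word : List.ofFn p.2 = u.2

namespace Fits

variable {n m : ℕ} {I J : SetSuperpartition n m} {p q : (Fin m → ℕ) × (Fin n → ℕ)}
  {u : SuperMonomial}

theorem getElem?_eq (h : Fits I p u) (j : Fin n) : u.2[(j : ℕ)]? = some (p.2 j) := by
  rw [← h.word]
  simp

theorem mem_theta (h : Fits I p u) {c : ℕ} : c ∈ u.1 ↔ ∃ i, p.1 i = c := by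
  rw [← h.theta]
  simp

theorem _root_.SuperNC.SetSuperpartition.block_unique (I : SetSuperpartition n m) {A B : Finset ℕ}
    (hA : A ∈ I.blocks) (hB : B ∈ I.blocks) {x : ℕ} (hx : x + 1 ∈ A) (hx' : x + 1 ∈ B) :
    A = B := by
  by_contra hne
  have hsymm : Std.Symm fun A B : Finset ℕ => A ∩ B ⊆ {0} :=
    ⟨fun A B h => by rwa [Finset.inter_comm]⟩
  have := I.inter.forall hA hB hne (Finset.mem_inter.2 ⟨hx, hx'⟩)
  simp at this

theorem _root_.SuperNC.SetSuperpartition.exists_fin_of_mem (I : SetSuperpartition n m)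
    {B : Finset ℕ} (hB : B ∈ I.blocks) {x : ℕ} (hx : x + 1 ∈ B) : ∃ j : Fin n, (j : ℕ) = x := by
  have := (I.cover (x + 1)).1 ⟨by omega, B, hB, hx⟩
  exact ⟨⟨x, by omega⟩, rfl⟩

theorem take_blocks (h : Fits I p u) : I.blocks.take m = (List.ofFn p.1).map (siteBlock u) := by
  have hlen := I.m_le_length
  refine List.ext_getElem (by simp [hlen]) fun i h1 h2 => ?_
  have hi : i < m := by simpa using h2
  rw [List.getElem_take, List.getElem_map, List.getElem_ofFn]
  have h3 := (h.mem.1 ⟨i, hi⟩ ·)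
  simp only at h3
  rw [List.getD_eq_getElem _ _ (by omega)] at h3
  ext x
  obtain _ | x := x
  · refine iff_of_true (I.fermionic _ ?_) (zero_mem_siteBlock.2 (h.mem_theta.2 ⟨_, rfl⟩))
    rw [← List.getElem_take (h := h1)]
    exact List.getElem_mem _
  · rw [succ_mem_siteBlock]
    constructor
    · intro hx
      obtain ⟨j, rfl⟩ := I.exists_fin_of_mem (List.getElem_mem _) hx
      rw [h.getElem?_eq, (h3 j).2 hx]
    · intro hx
      have : x < n := by
        have := (List.getElem?_eq_some_iff.1 hx).1
        rw [← h.word] at this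
        simpa using this
      have h4 := h.getElem?_eq ⟨x, this⟩
      rw [hx] at h4
      exact (h3 ⟨x, this⟩).1 (Option.some_injective _ h4)

/-- A bosonic block contains some position, hence consists of all positions of the letter there.
That letter has no `θ`, since otherwise the block would share a position with a fermionic one. -/
theorem exists_drop_blocks (h : Fits I p u) : ∃ B : List ℕ, B.Nodup ∧
    (∀ i, i ∈ B ↔ i ∈ u.2 ∧ i ∉ u.1) ∧ I.blocks.drop m = B.map (siteBlock u) := by
  have hsub : ∀ {B}, B ∈ I.blocks.drop m → B ∈ I.blocks := fun hB => List.mem_of_mem_drop hB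
  have hrange : I.blocks.drop m ∈ Set.range (List.map (siteBlock u)) := by
    rw [Set.range_list_map]
    intro B hB
    obtain ⟨x, hx⟩ := I.nonempty B (hsub hB)
    obtain _ | x := x
    · exact absurd hx (I.bosonic B hB)
    obtain ⟨j, rfl⟩ := I.exists_fin_of_mem (hsub hB) hx
    refine ⟨p.2 j, ?_⟩
    ext y
    obtain _ | y := y
    · refine iff_of_false ?_ (I.bosonic B hB)
      rw [zero_mem_siteBlock, h.mem_theta]
      rintro ⟨i, hi⟩
      have hlen := I.m_le_length
      have h1 := (h.mem.1 i j).1 hi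
      rw [List.getD_eq_getElem _ _ (by omega)] at h1
      have h2 := I.block_unique (List.getElem_mem _) (hsub hB) h1 hx
      refine I.bosonic B hB (h2 ▸ I.fermionic _ ?_)
      rw [List.mem_take_iff_getElem]
      exact ⟨i, by omega, rfl⟩
    · rw [succ_mem_siteBlock]
      constructor
      · intro hy
        have : y < n := by
          have := (List.getElem?_eq_some_iff.1 hy).1
          rw [← h.word] at this
          simpa using this
        have h4 := h.getElem?_eq ⟨y, this⟩
        rw [hy] at h4
        obtain ⟨A, hA, h5, h6⟩ := (h.mem.2 j ⟨y, this⟩).1 (Option.some_injective _ h4)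
        rwa [← I.block_unique hA (hsub hB) h5 hx]
      · intro hy
        obtain ⟨k, rfl⟩ := I.exists_fin_of_mem (hsub hB) hy
        rw [h.getElem?_eq, (h.mem.2 k j).2 ⟨B, hsub hB, hy, hx⟩]
  obtain ⟨B, hB⟩ := hrange
  refine ⟨B, ?_, fun i => ⟨fun hi => ?_, fun ⟨hi, hi'⟩ => ?_⟩, hB.symm⟩
  · refine List.Nodup.of_map (siteBlock u) ?_
    rw [hB]
    exact (I.order.imp fun h => h.1 : I.blocks.Nodup).sublist (List.drop_sublist _ _)
  · have h1 : siteBlock u i ∈ I.blocks.drop m := hB ▸ List.mem_map_of_mem hi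
    have h2 : i ∉ u.1 := fun h3 => I.bosonic _ h1 (zero_mem_siteBlock.2 h3)
    refine ⟨?_, h2⟩
    have h3 := I.nonempty _ (hsub h1)
    rwa [siteBlock, if_neg h2, positions_nonempty] at h3
  · rw [← h.word, List.mem_ofFn] at hi
    obtain ⟨j, rfl⟩ := hi
    obtain ⟨A, hA, h1, -⟩ := (h.mem.2 j j).1 rfl
    rw [← List.take_append_drop m I.blocks, h.take_blocks, ← hB, ← List.map_append,
      List.mem_map] at hA
    obtain ⟨c, hc, rfl⟩ := hA
    rw [succ_mem_siteBlock, h.getElem?_eq] at h1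
    obtain rfl := Option.some_injective _ h1
    rw [List.mem_append, ← List.mem_toFinset, h.theta] at hc
    exact hc.resolve_left hi'

/-- The monomial determines the set of blocks, and the asymmetric relation in `order` determines
their sequence. The fermionic blocks then recover the order of the `θ`s, because distinct letters
have distinct blocks. -/
theorem unique (h : Fits I p u) (h' : Fits J q u) : I = J ∧ p = q := by
  obtain ⟨B, hB1, hB2, hB3⟩ := h.exists_drop_blocks
  obtain ⟨B', hB1', hB2', hB3'⟩ := h'.exists_drop_blocks
  have hperm : I.blocks.Perm J.blocks := by
    rw [← List.take_append_drop m I.blocks, ← List.take_append_drop m J.blocks, h.take_blocks,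
      h'.take_blocks, hB3, hB3']
    refine List.Perm.append (List.Perm.map _ ?_) (List.Perm.map _ ?_)
    · rw [List.perm_ext_iff_of_nodup h.nodup h'.nodup]
      intro a
      rw [← List.mem_toFinset, ← List.mem_toFinset, h.theta, h'.theta]
    · rw [List.perm_ext_iff_of_nodup hB1 hB1']
      exact fun a => (hB2 a).trans (hB2' a).symm
  have hblocks : I.blocks = J.blocks :=
    hperm.eq_of_pairwise (fun A B _ _ h1 h2 => absurd h1.2 h2.2.not_gt) I.order J.order
  have hI : I = J := by
    obtain ⟨⟨b, _, _, _, _, _, _, _, _⟩, _⟩ := I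
    obtain ⟨⟨b', _, _, _, _, _, _, _, _⟩, _⟩ := J
    simp only at hblocks
    subst hblocks
    rfl
  refine ⟨hI, Prod.ext ?_ (List.ofFn_injective (h.word.trans h'.word.symm))⟩
  subst hI
  have hnd : ((List.ofFn p.1).map (siteBlock u)).Nodup := by
    rw [← h.take_blocks]
    exact (I.order.imp fun h => h.1 : I.blocks.Nodup).sublist (List.take_sublist _ _)
  funext i
  have h1 := h.take_blocks.symm.trans h'.take_blocks
  rw [List.map_ofFn, List.map_ofFn] at h1
  refine List.inj_on_of_nodup_map hnd (by simp) ?_ (congrFun (List.ofFn_injective h1) i)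
  rw [← List.mem_toFinset, h.theta]
  exact h'.mem_theta.2 ⟨i, rfl⟩

theorem fermSizes_eq (h : Fits I p u) : I.fermSizes = (List.ofFn p.1).map (u.2.count ·) := by
  rw [SetSuperpartition.fermSizes, h.take_blocks, List.map_map]
  refine List.map_congr_left fun c hc => card_siteBlock_of_mem ?_
  rwa [← h.theta, List.mem_toFinset]

theorem bosSizes_perm (h : Fits I p u) {B : List ℕ} (hB : B.Nodup)
    (hB' : ∀ i, i ∈ B ↔ i ∈ u.2 ∧ i ∉ u.1) : I.bosSizes.Perm (B.map (u.2.count ·)) := by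
  obtain ⟨B', h1, h2, h3⟩ := h.exists_drop_blocks
  rw [SetSuperpartition.bosSizes, h3, List.map_map]
  refine (List.Perm.of_eq (List.map_congr_left fun c hc =>
    card_siteBlock_of_notMem ((h2 c).1 hc).2)).trans (List.Perm.map _ ?_)
  rw [List.perm_ext_iff_of_nodup h1 hB]
  exact fun a => (h2 a).trans (hB' a).symm

end Fits

open Classical in
theorem monomial_apply_of_fits {n m : ℕ} {I : SetSuperpartition n m}
    {p : (Fin m → ℕ) × (Fin n → ℕ)} {u : SuperMonomial} (h : Fits I p u) :
    (I.monomial : SuperMonomial → ℚ) u = (-1) ^ inv (List.ofFn p.1) := by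
  change ∑ᶠ q ∈ I.indexSet, coeffProd (List.ofFn q.1) (List.ofFn q.2) u = _
  rw [finsum_eq_single _ p, finsum_eq_if (p := p ∈ I.indexSet), if_pos h.mem, coeffProd,
    if_pos ⟨h.nodup, h.theta, h.word⟩]
  intro q hq
  rw [finsum_eq_if (p := q ∈ I.indexSet)]
  refine ite_eq_right_iff.2 fun hq' => ?_
  rw [coeffProd, if_neg]
  rintro ⟨h1, h2, h3⟩
  exact hq (h.unique ⟨hq', h1, h2, h3⟩).2.symm

theorem exists_fits_of_monomial_apply_ne_zero {n m : ℕ} {I : SetSuperpartition n m}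
    {u : SuperMonomial} (h : (I.monomial : SuperMonomial → ℚ) u ≠ 0) : ∃ p, Fits I p u := by
  obtain ⟨p, hp, hp'⟩ := exists_ne_zero_of_finsum_mem_ne_zero h
  unfold coeffProd at hp'
  obtain ⟨h1, h2, h3⟩ := (ite_ne_right_iff.1 hp').1
  exact ⟨p, hp, h1, h2, h3⟩

end SuperNC

namespace SuperNC

open SuperPartition

/-! ### The set superpartition of a monomial -/

theorem exists_ascending_list (s : Finset ℕ) (κ : ℕ → ℕ) (h : Set.InjOn κ s) :
    ∃ l : List ℕ, l.Nodup ∧ (∀ i, i ∈ l ↔ i ∈ s) ∧ l.Pairwise fun a b => κ a < κ b := by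
  obtain ⟨l, h1, h2⟩ := exists_perm_map_eq_sortDesc s.toList κ
  have hmem : ∀ i, i ∈ l ↔ i ∈ s := fun i => h1.mem_iff.trans Finset.mem_toList
  have hnd : l.Nodup := h1.nodup_iff.2 s.nodup_toList
  refine ⟨l.reverse, by simpa using hnd, by simpa using hmem, ?_⟩
  rw [List.pairwise_reverse]
  have h3 : l.Pairwise fun a b => κ a ≥ κ b := by
    rw [← List.pairwise_map, h2]
    exact sortDesc_pairwise _
  refine (h3.and hnd).imp_of_mem fun {a b} ha hb h4 => lt_of_le_of_ne h4.1 fun h5 => h4.2 ?_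
  exact h ((hmem a).1 ha) ((hmem b).1 hb) h5.symm

/-- The first position of `c`, or `0` if there is none. -/
noncomputable def firstPosition (w : List ℕ) (c : ℕ) : ℕ := sInf (positions w c : Set ℕ)

theorem firstPosition_mem {w : List ℕ} {c : ℕ} (h : c ∈ w) :
    firstPosition w c ∈ positions w c := by
  exact Finset.mem_coe.1 (Nat.sInf_mem (Finset.coe_nonempty.2 (positions_nonempty.2 h)))

theorem firstPosition_eq_zero {w : List ℕ} {c : ℕ} (h : c ∉ w) : firstPosition w c = 0 := by
  have : positions w c = ∅ := by
    rwa [← Finset.not_nonempty_iff_eq_empty, positions_nonempty]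
  simp [firstPosition, this]

theorem firstPosition_pos {w : List ℕ} {c : ℕ} (h : c ∈ w) : 0 < firstPosition w c := by
  refine Nat.pos_of_ne_zero fun h1 => zero_notMem_positions w c ?_
  rw [← h1]
  exact firstPosition_mem h

theorem count_eq_of_firstPosition_eq {w : List ℕ} {c d : ℕ}
    (h : firstPosition w c = firstPosition w d) : c = d ∨ w.count c = w.count d := by
  by_cases hc : c ∈ w
  · by_cases hd : d ∈ w
    · left
      have h1 := firstPosition_mem hc
      rw [h] at h1
      exact eq_of_mem_positions h1 (firstPosition_mem hd)
    · rw [firstPosition_eq_zero hd] at h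
      exact absurd h (firstPosition_pos hc).ne'
  · by_cases hd : d ∈ w
    · rw [firstPosition_eq_zero hc] at h
      exact absurd h (firstPosition_pos hd).ne
    · right
      rw [List.count_eq_zero_of_not_mem hc, List.count_eq_zero_of_not_mem hd]

/-- Blocks of different letters share at most `0`, and under this hypothesis `0` is removed. Hence
comparing blocks amounts to comparing first positions. -/
theorem siteBlock_sdiff {u : SuperMonomial} {c d : ℕ} (h : c ≠ d) (hcd : c ∈ u.1 → d ∈ u.1) :
    siteBlock u c \ siteBlock u d = positions u.2 c := by
  ext x
  rw [Finset.mem_sdiff]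
  obtain _ | x := x
  · rw [zero_mem_siteBlock, zero_mem_siteBlock]
    simp only [zero_notMem_positions, iff_false]
    tauto
  · rw [succ_mem_siteBlock, succ_mem_siteBlock, succ_mem_positions]
    refine and_iff_left_of_imp fun h1 h2 => h ?_
    exact Option.some_injective _ (h1.symm.trans h2)

theorem sInf_siteBlock_sdiff {u : SuperMonomial} {c d : ℕ} (hc : c ∈ u.1) (hd : d ∉ u.1) :
    sInf ((siteBlock u c \ siteBlock u d : Finset ℕ) : Set ℕ) = 0 := by
  refine Nat.sInf_eq_zero.2 (Or.inl ?_)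
  simp [zero_mem_siteBlock, hc, hd]

theorem siteBlock_order_of_firstPosition_lt {u : SuperMonomial} {c d : ℕ}
    (h : firstPosition u.2 c < firstPosition u.2 d) (hcd : c ∈ u.1 ↔ d ∈ u.1) :
    siteBlock u c ≠ siteBlock u d ∧
      sInf ((siteBlock u c \ siteBlock u d : Finset ℕ) : Set ℕ) <
        sInf ((siteBlock u d \ siteBlock u c : Finset ℕ) : Set ℕ) := by
  have hne : c ≠ d := by
    rintro rfl
    exact lt_irrefl _ h
  have h2 : sInf ((siteBlock u c \ siteBlock u d : Finset ℕ) : Set ℕ) <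
        sInf ((siteBlock u d \ siteBlock u c : Finset ℕ) : Set ℕ) := by
    rw [siteBlock_sdiff hne hcd.1, siteBlock_sdiff hne.symm hcd.2]
    exact h
  refine ⟨fun h3 => ?_, h2⟩
  rw [h3] at h2
  exact lt_irrefl _ h2

/-- The blocks are those of the `θ`-letters followed by those of the other letters of the word, each
group ordered by first position. -/
theorem exists_fits {n m : ℕ} {u : SuperMonomial} (hn : u.2.length = n) (hm : u.1.card = m)
    (hinj : Set.InjOn (u.2.count ·) u.1) : ∃ (I : SetSuperpartition n m) (p : _), Fits I p u := by
  -- Letters absent from the word all have first position `0`. Their multiplicity is `0` too, so by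
  -- `hinj` at most one `θ`-letter is absent and there is no tie.
  obtain ⟨F, hF, hF', hFs⟩ := exists_ascending_list u.1 (firstPosition u.2) fun c hc d hd h =>
    (count_eq_of_firstPosition_eq h).elim id (hinj hc hd ·)
  obtain ⟨B, hB, hB', hBs⟩ := exists_ascending_list (u.2.toFinset \ u.1) (firstPosition u.2)
    fun c hc d hd h => by
      simp only [Finset.coe_sdiff, Set.mem_sdiff, Finset.mem_coe, List.mem_toFinset] at hc hd
      have h1 := firstPosition_mem hc.1
      rw [h] at h1
      exact eq_of_mem_positions h1 (firstPosition_mem hd.1)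
  replace hB' : ∀ i, i ∈ B ↔ i ∈ u.2 ∧ i ∉ u.1 := fun i => by rw [hB']; simp
  have hFlen : F.length = m := by
    rw [← hm, ← List.toFinset_card_of_nodup hF]
    congr 1
    ext i
    simp [hF']
  have htake : ((F ++ B).map (siteBlock u)).take m = F.map (siteBlock u) := by
    rw [List.map_append, List.take_left' (by simpa using hFlen)]
  have hdrop : ((F ++ B).map (siteBlock u)).drop m = B.map (siteBlock u) := by
    rw [List.map_append, List.drop_left' (by simpa using hFlen)]
  have hall : ∀ c ∈ u.2, c ∈ F ++ B := fun c hc => by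
    rw [List.mem_append, hF', hB']
    tauto
  have hnd : (F ++ B).Nodup := by
    rw [List.nodup_append']
    refine ⟨hF, hB, fun c hc hc' => ?_⟩
    exact ((hB' c).1 hc').2 ((hF' c).1 hc)
  have hofF : (List.ofFn fun i : Fin m => F.getD i 0) = F := by
    refine List.ext_getElem (by simp [hFlen]) fun i h1 h2 => ?_
    rw [List.getElem_ofFn, List.getD_eq_getElem _ _ h2]
  have hofw : (List.ofFn fun i : Fin n => u.2.getD i 0) = u.2 := by
    refine List.ext_getElem (by simp [hn]) fun i h1 h2 => ?_
    rw [List.getElem_ofFn, List.getD_eq_getElem _ _ h2]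
  have hget : ∀ j : Fin n, u.2[(j : ℕ)]? = some (u.2.getD j 0) := fun j => by
    have : (j : ℕ) < u.2.length := by omega
    rw [List.getD_eq_getElem _ _ this, List.getElem?_eq_getElem this]
  let I : SetSuperpartition n m :=
    { blocks := (F ++ B).map (siteBlock u)
      m_le := by
        rw [← hm, ← hn]
        -- The `m` multiplicities are distinct numbers in `{0, …, n}`.
        have := Finset.card_le_card_of_injOn (s := u.1) (t := Finset.range (u.2.length + 1))
          (u.2.count ·) (fun c _ => by simpa [Nat.lt_succ_iff] using List.count_le_length) hinj
        simpa using this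
      nonempty := by
        intro A hA
        rw [List.mem_map] at hA
        obtain ⟨c, hc, rfl⟩ := hA
        by_cases h : c ∈ u.1
        · exact ⟨0, zero_mem_siteBlock.2 h⟩
        · rw [siteBlock, if_neg h, positions_nonempty]
          rw [List.mem_append, hF', hB'] at hc
          tauto
      cover := by
        intro x
        obtain _ | x := x
        · simp
        constructor
        · rintro ⟨-, A, hA, hx⟩
          rw [List.mem_map] at hA
          obtain ⟨c, hc, rfl⟩ := hA
          have := (List.getElem?_eq_some_iff.1 (succ_mem_siteBlock.1 hx)).1
          omega
        · rintro ⟨-, hx⟩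
          have := hget ⟨x, hx⟩
          exact ⟨by omega, _, List.mem_map_of_mem (hall _ (List.mem_of_getElem? this)),
            succ_mem_siteBlock.2 this⟩
      inter := by
        rw [List.pairwise_map]
        exact hnd.imp siteBlock_inter
      m_le_length := by simp [hFlen]
      fermionic := by
        rw [htake]
        intro A hA
        rw [List.mem_map] at hA
        obtain ⟨c, hc, rfl⟩ := hA
        exact zero_mem_siteBlock.2 ((hF' c).1 hc)
      bosonic := by
        rw [hdrop]
        intro A hA
        rw [List.mem_map] at hA
        obtain ⟨c, hc, rfl⟩ := hA
        exact fun h => ((hB' c).1 hc).2 (zero_mem_siteBlock.1 h)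
      sorted := by
        -- The coercion in `sorted` is a monadic map over the whole list of blocks and has to be
        -- unfolded first.
        rw [hdrop, bind_pure_comp, List.map_eq_map, List.pairwise_map, List.pairwise_map]
        refine hBs.imp_of_mem fun {c d} hc hd h => ?_
        rw [siteBlock, siteBlock, if_neg ((hB' c).1 hc).2, if_neg ((hB' d).1 hd).2]
        exact h
      order := by
        rw [List.pairwise_map, List.pairwise_append]
        refine ⟨hFs.imp_of_mem fun {c d} hc hd h => ?_, hBs.imp_of_mem fun {c d} hc hd h => ?_,
          fun c hc d hd => ?_⟩
        · exact siteBlock_order_of_firstPosition_lt h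
            (iff_of_true ((hF' c).1 hc) ((hF' d).1 hd))
        · exact siteBlock_order_of_firstPosition_lt h
            (iff_of_false ((hB' c).1 hc).2 ((hB' d).1 hd).2)
        · rw [hF'] at hc
          rw [hB'] at hd
          have hne : d ≠ c := fun h => hd.2 (h ▸ hc)
          rw [sInf_siteBlock_sdiff hc hd.2, siteBlock_sdiff hne fun h => absurd h hd.2]
          refine ⟨fun h => hd.2 ?_, firstPosition_pos hd.1⟩
          rwa [← zero_mem_siteBlock, ← h, zero_mem_siteBlock] }
  refine ⟨I, (fun i => F.getD i 0, fun j => u.2.getD j 0), ⟨⟨fun i j => ?_, fun i j => ?_⟩, ?_, ?_,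
    hofw⟩⟩
  · have hi : (i : ℕ) < F.length := by omega
    have h1 : I.blocks.getD i ∅ = siteBlock u (F.getD i 0) := by
      change ((F ++ B).map (siteBlock u)).getD i ∅ = _
      rw [List.getD_eq_getElem _ _ (by simp; omega), List.getD_eq_getElem _ _ hi,
        List.getElem_map, List.getElem_append_left hi]
    rw [h1, succ_mem_siteBlock, hget, Option.some_inj, eq_comm]
  · constructor
    · intro h
      refine ⟨_, List.mem_map_of_mem (hall _ (List.mem_of_getElem? (hget i))),
        succ_mem_siteBlock.2 (hget i), succ_mem_siteBlock.2 ?_⟩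
      rw [hget]
      exact congrArg some h.symm
    · rintro ⟨A, hA, h1, h2⟩
      change A ∈ (F ++ B).map (siteBlock u) at hA
      rw [List.mem_map] at hA
      obtain ⟨c, -, rfl⟩ := hA
      rw [succ_mem_siteBlock, hget] at h1 h2
      exact Option.some_injective _ (h1.trans h2.symm)
  · rwa [hofF]
  · rw [hofF]
    ext i
    rw [List.mem_toFinset, hF']

namespace Fits

variable {n m : ℕ} {I : SetSuperpartition n m} {p : (Fin m → ℕ) × (Fin n → ℕ)}
  {u : SuperMonomial}

theorem exists_hasType (h : Fits I p u) (hinj : Set.InjOn (u.2.count ·) u.1) :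
    ∃ Om, I.HasType Om := by
  refine ⟨⟨sortDesc I.fermSizes, sortDesc I.bosSizes, ?_, sortDesc_pairwise _, ?_⟩, rfl, rfl⟩
  · have hnd : (sortDesc I.fermSizes).Nodup := by
      rw [(sortDesc_perm _).nodup_iff, h.fermSizes_eq]
      refine h.nodup.map_on fun c hc d hd => hinj ?_ ?_
      · rwa [Finset.mem_coe, ← h.theta, List.mem_toFinset]
      · rwa [Finset.mem_coe, ← h.theta, List.mem_toFinset]
    exact ((sortDesc_pairwise _).and hnd).imp fun h => lt_of_le_of_ne h.1 h.2.symm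
  · intro x hx
    rw [(sortDesc_perm _).mem_iff, SetSuperpartition.bosSizes, List.mem_map] at hx
    obtain ⟨B, hB, rfl⟩ := hx
    exact Finset.card_pos.2 (I.nonempty B (List.mem_of_mem_drop hB))

theorem factorial_eq (h : Fits I p u) {Om : SuperPartition} (hOm : I.HasType Om) :
    Om.factorial = ∏ i ∈ u.2.toFinset, (u.2.count i).factorial := by
  have hB := h.bosSizes_perm (u.2.toFinset \ u.1).nodup_toList (fun i => by simp)
  rw [SuperPartition.factorial, ← hOm.1, ← hOm.2]
  have h1 : (sortDesc I.fermSizes ++ sortDesc I.bosSizes).Perm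
      ((List.ofFn p.1 ++ (u.2.toFinset \ u.1).toList).map (u.2.count ·)) := by
    rw [List.map_append, ← h.fermSizes_eq]
    exact (sortDesc_perm _).append ((sortDesc_perm _).trans hB)
  rw [(h1.map _).prod_eq, List.map_map, List.map_append, List.prod_append,
    ← List.prod_toFinset _ h.nodup, h.theta, Finset.prod_map_toList, mul_comm,
    ← Finset.prod_inter_mul_prod_sdiff u.2.toFinset u.1, mul_comm]
  congr 1
  symm
  refine Finset.prod_subset Finset.inter_subset_right fun i hi hi' => ?_
  have : i ∉ u.2 := fun h => hi' (by simp [h, hi])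
  simp [List.count_eq_zero_of_not_mem this]

/-- The `θ`-letters are listed in the order of the index `p`, composed with a permutation sorting
the fermionic sizes. The inversion sign of this list is the sign of `p` times `(-1) ^ ε(I)`. -/
theorem tabSum_eq (h : Fits I p u) {Om : SuperPartition} (hOm : I.HasType Om)
    (L : SuperPartition) {r : ℕ} (hs : ∀ i ∈ u.1, i < r) (hw : ∀ i ∈ u.2, i < r) :
    tabSum ((List.range r).map u.weight).reverse L =
      (-1) ^ I.eps * (-1) ^ inv (List.ofFn p.1) * kostka L Om := by
  obtain ⟨σ, h1, h2⟩ := I.exists_perm_eps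
  obtain ⟨B, hB, hB'⟩ := exists_perm_map_eq_sortDesc (u.2.toFinset \ u.1).toList (u.2.count ·)
  have hBm : ∀ i, i ∈ B ↔ i ∈ u.2 ∧ i ∉ u.1 := fun i => by
    rw [hB.mem_iff]
    simp
  have hBn : B.Nodup := hB.nodup_iff.2 (Finset.nodup_toList _)
  have hperm : (List.ofFn (p.1 ∘ σ)).Perm (List.ofFn p.1) := Equiv.Perm.ofFn_comp_perm σ p.1
  have hF : (List.ofFn (p.1 ∘ σ)).map (u.2.count ·) = Om.a := by
    rw [← hOm.1, h.fermSizes_eq]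
    symm
    refine sortDesc_eq_of_perm (hperm.map _).symm ?_
    rw [List.map_ofFn, List.pairwise_ofFn]
    intro i j hij
    have := h1 hij.le
    simp only [h.fermSizes_eq] at this
    rw [List.getD_eq_getElem _ _ (by simp), List.getD_eq_getElem _ _ (by simp)] at this
    simpa using this
  have hBs : B.map (u.2.count ·) = Om.s := by
    rw [hB', ← hOm.2]
    exact sortDesc_eq_of_perm
      ((h.bosSizes_perm (Finset.nodup_toList _) (fun i => by simp)).symm.trans
        (sortDesc_perm _).symm) (sortDesc_pairwise _)
  rw [tabSum_weight_eq hs hw (hperm.nodup_iff.2 h.nodup)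
    ((List.toFinset_eq_of_perm _ _ hperm).trans h.theta) hBn hBm hF hBs,
    neg_one_pow_inv_comp_perm _ (List.nodup_ofFn.1 h.nodup), h2]

end Fits

/-! ### The expansion -/

theorem mem_sPar_of_kostka_ne_zero {L Om : SuperPartition} (h : kostka L Om ≠ 0) :
    Om ∈ sPar L.deg L.df := by
  rw [kostka_eq] at h
  obtain ⟨h1, h2⟩ := tabSum_ne_zero h
  rw [mem_sPar, h1, h2]
  simp only [List.map_reverse, List.sum_reverse, List.countP_reverse, List.map_append,
    List.sum_append, List.map_map, List.countP_append, List.countP_map]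
  have e1 : SuperWeight.abs ∘ SuperWeight.barred = id := rfl
  have e2 : SuperWeight.abs ∘ SuperWeight.plain = id := rfl
  have e3 : SuperWeight.isBarred ∘ SuperWeight.barred = fun _ => true := rfl
  have e4 : SuperWeight.isBarred ∘ SuperWeight.plain = fun _ => false := rfl
  simp [e1, e2, e3, e4, SuperPartition.deg, SuperPartition.df]

theorem mem_ofType {n m : ℕ} {Om : SuperPartition} {I : SetSuperpartition n m} :
    I ∈ ofType n m Om ↔ I.HasType Om := by
  simp [ofType]

theorem schur_apply_eq {n m : ℕ} {L : SuperPartition} (hL : L ∈ sPar n m) (u : SuperMonomial) :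
    (schur L : SuperMonomial → ℚ) u = ∑ Om ∈ sPar n m, (kostka L Om : ℚ) * (Om.factorial : ℚ) *
      ∑ I ∈ ofType n m Om, (-1 : ℚ) ^ I.eps * (I.monomial : SuperMonomial → ℚ) u := by
  have hL' := mem_sPar.1 hL
  obtain ⟨r, hr⟩ := SSYT.weight_eventually u
  have hs : ∀ i ∈ u.1, i < r := fun i hi => by
    by_contra h
    have := congrArg SuperWeight.isBarred (hr i (not_lt.1 h))
    rw [SuperMonomial.weight, isBarred_ofBarred] at this
    exact absurd hi (of_decide_eq_false this)
  have hw : ∀ i ∈ u.2, i < r := fun i hi => by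
    by_contra h
    have := congrArg SuperWeight.abs (hr i (not_lt.1 h))
    rw [SuperMonomial.weight, abs_ofBarred] at this
    exact (List.count_pos_iff.2 hi).ne' this
  rw [schur_apply L u hr]
  -- If some `I` of a type contributes, it is the only term of the double sum. Otherwise the
  -- right-hand side is zero, and so must be `tabSum`.
  by_cases hex : ∃ (I : SetSuperpartition n m) (p : _) (Om : _), Fits I p u ∧ I.HasType Om
  · obtain ⟨I, p, Om, h, hOm⟩ := hex
    have huniq : ∀ J : SetSuperpartition n m, (J.monomial : SuperMonomial → ℚ) u ≠ 0 → J = I := by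
      intro J hJ
      obtain ⟨q, hq⟩ := exists_fits_of_monomial_apply_ne_zero hJ
      exact (hq.unique h).1
    rw [Finset.sum_eq_single Om, Finset.sum_eq_single I]
    · rw [monomial_apply_of_fits h, h.factorial_eq hOm, h.tabSum_eq hOm L hs hw]
      push_cast
      ring
    · intro J _ hJ
      by_contra h1
      exact hJ (huniq J (right_ne_zero_of_mul h1))
    · intro h1
      exact absurd (mem_ofType.2 hOm) h1
    · intro Om' _ hne
      refine mul_eq_zero_of_right _ (Finset.sum_eq_zero fun J hJ => ?_)
      by_contra h1
      obtain rfl := huniq J (right_ne_zero_of_mul h1)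
      have h2 := mem_ofType.1 hJ
      exact hne (SuperPartition.ext (h2.1.symm.trans hOm.1) (h2.2.symm.trans hOm.2))
    · intro h1
      have h2 : kostka L Om = 0 := by
        by_contra h3
        have := mem_sPar_of_kostka_ne_zero h3
        rw [hL'.1, hL'.2] at this
        exact h1 this
      rw [h2]
      simp
  · have h1 : tabSum ((List.range r).map u.weight).reverse L = 0 := by
      by_contra h1
      obtain ⟨h2, h3⟩ := degrees_of_tabSum_ne_zero hs hw h1
      -- A nonzero signed number excludes equal barred weights, so the multiplicities of the
      -- `θ`-letters are distinct and a fitting `I` exists after all.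
      have hinj : Set.InjOn (u.2.count ·) u.1 := fun a ha b hb hab => by
        by_contra hne
        exact h1 (tabSum_weight_eq_zero hs hne ha hb hab)
      obtain ⟨I, p, h⟩ := exists_fits (h2.symm.trans hL'.1) (h3.symm.trans hL'.2) hinj
      obtain ⟨Om, hOm⟩ := h.exists_hasType hinj
      exact hex ⟨I, p, Om, h, hOm⟩
    rw [h1, Int.cast_zero, zero_mul]
    symm
    refine Finset.sum_eq_zero fun Om _ => mul_eq_zero_of_right _ (Finset.sum_eq_zero fun I hI => ?_)
    by_contra h2
    obtain ⟨p, hp⟩ := exists_fits_of_monomial_apply_ne_zero (right_ne_zero_of_mul h2)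
    exact hex ⟨I, p, Om, hp, mem_ofType.1 hI⟩

end SuperNC

theorem mainTheorem10 (n m : ℕ) (L : SuperNC.SuperPartition) (hL : L ∈ SuperNC.sPar n m) :
    (∀ u : SuperNC.SuperMonomial, {T : SuperNC.SSYT L | T.term u ≠ 0}.Finite) ∧
    (∀ Om ∈ SuperNC.sPar n m, (SuperNC.tableauxOfWeight L Om).Finite) ∧
    SuperNC.schur L =
      ∑ Om ∈ SuperNC.sPar n m, ((SuperNC.kostka L Om : ℚ) * (Om.factorial : ℚ)) •
        ∑ I ∈ SuperNC.ofType n m Om, ((-1 : ℚ) ^ I.eps) • I.monomial := by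
  refine ⟨SuperNC.SSYT.finite_term_ne_zero, fun Om _ => ?_, ?_⟩
  · exact SuperNC.SSYT.finite_weight_eq fun i hi => List.getD_eq_default _ _ hi
  · refine Subtype.ext (funext fun u => ?_)
    rw [SuperNC.schur_apply_eq hL]
    simp [Finset.sum_apply]
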